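/- Let $\mu>0$, $2\mu+3\lambda>0$, $\omega>0$, $k_p=\omega/\sqrt{2\mu+\lambda}$, $k_s=\omega/\sqrt{\mu}$. Let $D\subset\mathbb R^3$ be a bounded open set with $C^2$ boundary and connected exterior $D^c:=\mathbb R^3\setminus\overline D$, and let $R>0$ with $\overline D\subset B_R=\{|x|<R\}$, $S_R=\partial B_R$. The solution operator $G:[H^{1/2}(\partial D)]^3\to[L^2(S_R)]^3$ maps $h$ to $v|_{S_R}$, where $v\in[H^1_{loc}(D^c)]^3$ solves $\mu\Delta v+(\lambda+\mu)\nabla(\nabla\cdot v)+\omega^2v=0$ in $D^c$ (smoothly, after choosing the smooth representative), $v=h$ on $\partial D$ in the sense of traces, and $v$ satisfies the Kupradze radiation condition: with $v_p=-k_p^{-2}\nabla(\nabla\cdot v)$ and $v_s=k_s^{-2}\nabla\times(\nabla\times v)$, $$\lim_{r=|x|\to\infty} r\,[\partial_r v_\alpha-ik_\alpha v_\alpha]=0,\qquad \alpha=p,s,$$ uniformly in all directions. Let $\{Y_n^m:\ n\ge0,\ -n\le m\le n\}$ be any orthonormal system of spherical harmonics on $\mathbb S^2$ ($Y_n^m$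 of order $n$), $\delta_n=n(n+1)$, and put $U_n^m=\delta_n^{-1/2}\nabla_{\mathbb S^2}Y_n^m$ (with $U_0^0=0$), $V_n^m=\hat x\times U_n^m$, $W_n^m=Y_n^m\,\hat x$, and let $M_n^m=(V_n^m,U_n^m,W_n^m)$ be the matrix with these columns. With the spherical Hankel functions $h_n=h_n^{(1)}$ let $$A_n(r)=\begin{pmatrix}h_n(k_sr)&0&0\\0&-\big(h_n(k_sr)+k_sr\,h_n'(k_sr)\big)/r&\sqrt{\delta_n}\,h_n(k_pr)/r\\0&-\sqrt{\delta_n}\,h_n(k_sr)/r&k_p\,h_n'(k_pr)\end{pmatrix}.$$ The outgoing-to-incoming (OtI) mapping $\mathcal T$ is defined as follows: if $\varphi=u|_{S_R}\in\mathrm{Range}(G)$ with $u$ a radiating solution as above, expanded as $$u(x)=\sum_{n=0}^\infty\sum_{m=-n}^nM_n^m(\hat x)A_n(|x|)\alpha_n^m,\qquad |x|\ge R,\quad \alpha_n^m\in\mathbb C^3,$$ then $$\mathcal T\varphi=\tilde u|_{S_R},\qquad \tilde u(x)=-\sum_{n=0}^\infty\sum_{m=-n}^nM_n^m(\hat x)\overline{A_n(|x|)}\,\alpha_n^m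 .$$ Here the expansion of $u$ is meant as convergence in $[L^2(S_r)]^3$ for every $r\ge R$, and that of $\tilde u|_{S_R}$ in $[L^2(S_R)]^3$. Then the matrices $A_n(R)$ are invertible for all $n\ge0$, the definition above determines a well-defined mapping $\mathcal T:\mathrm{Range}(G)\to[L^2(S_R)]^3$ (each $\varphi\in\mathrm{Range}(G)$ has exactly one image), and for every $\varphi\in\mathrm{Range}(G)$ $$(\mathcal T\varphi)(x)=-\frac1{R^2}\sum_{n=0}^\infty\sum_{m=-n}^nM_n^m(\hat x)\,\overline{A_n(R)}\,[A_n(R)]^{-1}\int_{S_R}\overline{M_n^m(\hat y)}^{\top}\varphi(y)\,ds(y),$$ where the series converges in $[L^2(S_R)]^3$. -/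

import Mathlib

open MeasureTheory Filter Topology
open scoped ContDiff Matrix

noncomputable section

namespace ElasticOtI

/-- Physical space `ℝ³`. -/
abbrev E3 : Type := EuclideanSpace ℝ (Fin 3)

/-- The values of displacement fields, `ℂ³` with its Hermitian norm. -/
abbrev C3 : Type := EuclideanSpace ℂ (Fin 3)

/-! ### Differential operators -/

/-- The partial derivative `∂_j f`. -/
def pd (j : Fin 3) (f : E3 → ℂ) (x : E3) : ℂ :=
  fderiv ℝ f x (EuclideanSpace.single j 1)

/-- The gradient of a complex scalar field. -/
def grad (f : E3 → ℂ) (x : E3) : C3 := WithLp.toLp 2 fun j => pd j f x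

/-- The divergence of a complex vector field. -/
def dvg (u : E3 → C3) (x : E3) : ℂ := ∑ j, pd j (fun y => u y j) x

/-- The curl of a complex vector field. -/
def curl (u : E3 → C3) (x : E3) : C3 :=
  !₂[pd 1 (fun y => u y 2) x - pd 2 (fun y => u y 1) x,
     pd 2 (fun y => u y 0) x - pd 0 (fun y => u y 2) x,
     pd 0 (fun y => u y 1) x - pd 1 (fun y => u y 0) x]

/-- The Lamé operator `Δ* u = μ Δ u + (λ + μ) ∇ (∇ · u)`; here `la` is `λ` and `mu` is `μ`. -/
def lame (la mu : ℝ) (u : E3 → C3) (x : E3) : C3 :=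
  mu • Laplacian.laplacian u x + (la + mu) • grad (dvg u) x

/-- The compressional wave number `k_p = ω / √(2μ + λ)`. -/
def kp (la mu om : ℝ) : ℝ := om / Real.sqrt (2 * mu + la)

/-- The shear wave number `k_s = ω / √μ`. -/
def ks (mu om : ℝ) : ℝ := om / Real.sqrt mu

/-- The compressional part `u_p = - k_p⁻² ∇ (∇ · u)`. -/
def pPart (la mu om : ℝ) (u : E3 → C3) (x : E3) : C3 :=
  -(((kp la mu om) ^ 2)⁻¹ • grad (dvg u) x)

/-- The shear part `u_s = k_s⁻² ∇ × (∇ × u)`, so that `u = u_p + u_s` for solutions of the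
Navier equation. -/
def sPart (mu om : ℝ) (u : E3 → C3) (x : E3) : C3 :=
  ((ks mu om) ^ 2)⁻¹ • curl (curl u) x

/-- The unit vector `x̂ = x / |x|`. -/
def unitVec (x : E3) : E3 := ‖x‖⁻¹ • x

/-- The Sommerfeld condition `r (∂u/∂r - i k u) → 0` as `r = |x| → ∞`, uniformly in all
directions. -/
def Sommerfeld (k : ℝ) (u : E3 → C3) : Prop :=
  Tendsto (fun x : E3 => ‖x‖ * ‖fderiv ℝ u x (unitVec x) - (Complex.I * (k : ℂ)) • u x‖)
    (Bornology.cobounded E3) (𝓝 0)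

/-- The Kupradze radiation condition. -/
def Kupradze (la mu om : ℝ) (u : E3 → C3) : Prop :=
  Sommerfeld (kp la mu om) (pPart la mu om u) ∧ Sommerfeld (ks mu om) (sPart mu om u)

/-! ### The obstacle, the boundary space and the solution operator -/

/-- A set with `C²` boundary: near each boundary point it is the sublevel set `{g < 0}` of a `C²`
function with nonzero differential at that point. -/
def HasC2Boundary (D : Set E3) : Prop :=
  ∀ x ∈ frontier D, ∃ U : Set E3, IsOpen U ∧ x ∈ U ∧ ∃ g : E3 → ℝ,
    ContDiffOn ℝ 2 g U ∧ fderiv ℝ g x ≠ 0 ∧ D ∩ U = {y ∈ U | g y < 0}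

/-- An obstacle inside `B_R`: open, with `C²` boundary, closure contained in `B_R`, and connected
exterior. -/
structure IsObstacle (D : Set E3) (R : ℝ) : Prop where
  isOpen : IsOpen D
  closure_subset : closure D ⊆ Metric.ball 0 R
  boundary : HasC2Boundary D
  exterior_connected : IsConnected (closure D)ᶜ

/-- The surface measure on `∂D`. -/
def bdMeasure (D : Set E3) : Measure E3 :=
  Measure.restrict (Measure.euclideanHausdorffMeasure 2) (frontier D)

/-- Membership in `[H^{1/2}(∂D)]³`: square integrable, with finite Sobolev–Slobodeckij seminorm
(`∂D` is two-dimensional, so the kernel is `|x - y|⁻³`). -/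
def MemHHalf (D : Set E3) (h : E3 → C3) : Prop :=
  MemLp h 2 (bdMeasure D) ∧
    ∫⁻ x, ∫⁻ y, ‖h x - h y‖ₑ ^ 2 / ‖x - y‖ₑ ^ 3 ∂(bdMeasure D) ∂(bdMeasure D) < ⊤

/-- `v` (smooth in the exterior of `D`) belongs to `[H¹(D^c ∩ B_ρ)]³` for every `ρ`. -/
def MemHOneLoc (D : Set E3) (v : E3 → C3) : Prop :=
  ∀ ρ : ℝ, 0 < ρ →
    MemLp v 2 (volume.restrict ((closure D)ᶜ ∩ Metric.ball 0 ρ)) ∧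
    MemLp (fderiv ℝ v) 2 (volume.restrict ((closure D)ᶜ ∩ Metric.ball 0 ρ))

/-- `h` is the trace of `v` on `∂D`: there are functions smooth on all of space that converge to
`v` in `H¹(D^c ∩ B_R)` and whose restrictions to `∂D` converge to `h` in `L²(∂D)`. -/
def HasTrace (D : Set E3) (R : ℝ) (v h : E3 → C3) : Prop :=
  ∃ w : ℕ → E3 → C3, (∀ j, ContDiff ℝ ∞ (w j)) ∧
    Tendsto (fun j => eLpNorm (fun x => w j x - v x) 2
      (volume.restrict ((closure D)ᶜ ∩ Metric.ball 0 R))) atTop (𝓝 0) ∧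
    Tendsto (fun j => eLpNorm (fun x => fderiv ℝ (w j) x - fderiv ℝ v x) 2
      (volume.restrict ((closure D)ᶜ ∩ Metric.ball 0 R))) atTop (𝓝 0) ∧
    Tendsto (fun j => eLpNorm (fun x => w j x - h x) 2 (bdMeasure D)) atTop (𝓝 0)

/-- `v` is a radiating `H¹_loc` solution of the Navier equation in the exterior of `D` with
boundary value `h`. Solutions are represented by their smooth representative, on which the
radiation condition is read. -/
structure IsRadiatingSolution (la mu om : ℝ) (D : Set E3) (R : ℝ) (h v : E3 → C3) : Prop where
  smooth : ContDiffOn ℝ ∞ v (closure D)ᶜ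
  hOneLoc : MemHOneLoc D v
  navier : ∀ x ∈ (closure D)ᶜ, lame la mu v x + (om ^ 2) • v x = 0
  boundary_value : HasTrace D R v h
  radiation : Kupradze la mu om v

/-- The surface measure on the sphere `S_R`, as a measure on `ℝ³`: the push-forward of `R²` times
the surface measure of the unit sphere under `y ↦ R y`. -/
def sphereMeasure (R : ℝ) : Measure E3 :=
  ENNReal.ofReal (R ^ 2) •
    Measure.map (fun y : Metric.sphere (0 : E3) 1 => R • (y : E3)) (volume : Measure E3).toSphere

/-- The space `[L²(S_R)]³`. -/
abbrev L2S (R : ℝ) : Type := Lp C3 2 (sphereMeasure R)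

/-- The graph of the solution operator `G : [H^{1/2}(∂D)]³ → [L²(S_R)]³`, `h ↦ v|_{S_R}`, with the
solution `v` displayed. -/
def IsSolutionOn (la mu om : ℝ) (D : Set E3) (R : ℝ) (h v : E3 → C3) (φ : L2S R) : Prop :=
  MemHHalf D h ∧ IsRadiatingSolution la mu om D R h v ∧ φ =ᵐ[sphereMeasure R] v

/-- `Range(G)`. -/
def rangeG (la mu om : ℝ) (D : Set E3) (R : ℝ) : Set (L2S R) :=
  {φ | ∃ h v : E3 → C3, IsSolutionOn la mu om D R h v φ}

/-! ### Spherical harmonics and the matrices `M_n^m` and `A_n` -/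

/-- `f` restricted to the unit sphere is a spherical harmonic of order `n`: the restriction of a
homogeneous harmonic polynomial of degree `n`. -/
def IsSphericalHarmonic (n : ℕ) (f : E3 → ℂ) : Prop :=
  ∃ p : MvPolynomial (Fin 3) ℂ, p.IsHomogeneous n ∧
    ∑ i, MvPolynomial.pderiv i (MvPolynomial.pderiv i p) = 0 ∧
    ∀ x : E3, ‖x‖ = 1 → f x = MvPolynomial.eval (fun i => ((x i : ℝ) : ℂ)) p

/-- `Y n m`, `n ≥ 0`, `-n ≤ m ≤ n`, is an orthonormal sequence of spherical harmonics on the unit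
sphere, `Y n m` being of order `n`. Only the values on the unit sphere matter. -/
structure IsSphericalHarmonicSystem (Y : ℕ → ℤ → E3 → ℂ) : Prop where
  harmonic : ∀ (n : ℕ) (m : ℤ), m ∈ Finset.Icc (-(n : ℤ)) n → IsSphericalHarmonic n (Y n m)
  orthonormal : ∀ (n n' : ℕ) (m m' : ℤ),
    m ∈ Finset.Icc (-(n : ℤ)) n → m' ∈ Finset.Icc (-(n' : ℤ)) n' →
    ∫ x, Y n m x * (starRingEnd ℂ) (Y n' m' x) ∂(sphereMeasure 1)
      = if n = n' ∧ m = m' then 1 else 0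

/-- The number `√δ_n = √(n (n + 1))`. -/
def sqrtDelta (n : ℕ) : ℝ := Real.sqrt ((n : ℝ) * ((n : ℝ) + 1))

/-- The surface gradient on the unit sphere at a point `x` with `|x| = 1`: the gradient of the
extension of `f` that is homogeneous of degree `0`. -/
def surfGrad (f : E3 → ℂ) (x : E3) : Fin 3 → ℂ := fun j => pd j (fun y => f (unitVec y)) x

/-- `U_n^m = (√δ_n)⁻¹ ∇_{S²} Y_n^m`; it is `0` for `n = 0`. -/
def vshU (Y : ℕ → ℤ → E3 → ℂ) (n : ℕ) (m : ℤ) (x : E3) : Fin 3 → ℂ :=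
  ((sqrtDelta n : ℂ))⁻¹ • surfGrad (Y n m) x

/-- `V_n^m(x) = x × U_n^m(x)` for `|x| = 1`. -/
def vshV (Y : ℕ → ℤ → E3 → ℂ) (n : ℕ) (m : ℤ) (x : E3) : Fin 3 → ℂ :=
  (fun i => ((x i : ℝ) : ℂ)) ⨯₃ vshU Y n m x

/-- `W_n^m(x) = Y_n^m(x) x` for `|x| = 1`. -/
def vshW (Y : ℕ → ℤ → E3 → ℂ) (n : ℕ) (m : ℤ) (x : E3) : Fin 3 → ℂ :=
  fun i => Y n m x * ((x i : ℝ) : ℂ)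

/-- The matrix `M_n^m(x)` with columns `V_n^m(x)`, `U_n^m(x)`, `W_n^m(x)`, for `|x| = 1`. -/
def vshM (Y : ℕ → ℤ → E3 → ℂ) (n : ℕ) (m : ℤ) (x : E3) : Matrix (Fin 3) (Fin 3) ℂ :=
  Matrix.of fun i j => ![vshV Y n m x i, vshU Y n m x i, vshW Y n m x i] j

/-- The spherical Hankel function `h_n^{(1)}(t)` for `t > 0`, i.e.
`(-i)^{n+1} (e^{it} / t) ∑_{k ≤ n} (n+k)! / (k! (n-k)!) (i / (2t))^k`. -/
def hankel (n : ℕ) (t : ℝ) : ℂ :=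
  (-Complex.I) ^ (n + 1) * (Complex.exp (Complex.I * (t : ℂ)) / (t : ℂ)) *
    ∑ k ∈ Finset.range (n + 1),
      ((Nat.factorial (n + k) : ℂ) / ((Nat.factorial k : ℂ) * (Nat.factorial (n - k) : ℂ))) *
        (Complex.I / (2 * (t : ℂ))) ^ k

/-- The matrix `A_n(r)`. -/
def matA (la mu om : ℝ) (n : ℕ) (r : ℝ) : Matrix (Fin 3) (Fin 3) ℂ :=
  !![hankel n (ks mu om * r), 0, 0;
     0, -(hankel n (ks mu om * r)
          + ((ks mu om * r : ℝ) : ℂ) * deriv (hankel n) (ks mu om * r)) / (r : ℂ),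
        (sqrtDelta n : ℂ) * hankel n (kp la mu om * r) / (r : ℂ);
     0, -((sqrtDelta n : ℂ) * hankel n (ks mu om * r)) / (r : ℂ),
        (kp la mu om : ℂ) * deriv (hankel n) (kp la mu om * r)]

/-- The entrywise complex conjugate of a matrix. -/
def conjM (A : Matrix (Fin 3) (Fin 3) ℂ) : Matrix (Fin 3) (Fin 3) ℂ := A.map (starRingEnd ℂ)

/-- `∑_{n=0}^∞ f_n = ψ` in `[L²(S_r)]³`. -/
def HasL2Sum (r : ℝ) (f : ℕ → E3 → C3) (ψ : E3 → C3) : Prop :=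
  Tendsto (fun N : ℕ => eLpNorm (fun x => ψ x - ∑ n ∈ Finset.range N, f n x) 2 (sphereMeasure r))
    atTop (𝓝 0)

/-- The `n`-th term `∑_{m=-n}^n M_n^m(x̂) A_n(|x|) α_n^m` of an outgoing expansion. -/
def outTerm (la mu om : ℝ) (Y : ℕ → ℤ → E3 → ℂ) (α : ℕ → ℤ → Fin 3 → ℂ) (n : ℕ) (x : E3) : C3 :=
  WithLp.toLp 2 (∑ m ∈ Finset.Icc (-(n : ℤ)) n,
    vshM Y n m (unitVec x) *ᵥ (matA la mu om n ‖x‖ *ᵥ α n m))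

/-- The `n`-th term `- ∑_{m=-n}^n M_n^m(x̂) conj(A_n(|x|)) α_n^m` of the incoming expansion. -/
def inTerm (la mu om : ℝ) (Y : ℕ → ℤ → E3 → ℂ) (α : ℕ → ℤ → Fin 3 → ℂ) (n : ℕ) (x : E3) : C3 :=
  WithLp.toLp 2 (-∑ m ∈ Finset.Icc (-(n : ℤ)) n,
    vshM Y n m (unitVec x) *ᵥ (conjM (matA la mu om n ‖x‖) *ᵥ α n m))

/-- The defining relation `𝒯 φ = ψ` of the outgoing-to-incoming mapping: `φ` is the restriction
to `S_R` of a radiating solution `u` which has the outgoing expansion with coefficients `α` on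
every sphere `S_r`, `r ≥ R`, and `ψ` is the restriction to `S_R` of the incoming expansion with
the same coefficients. -/
def OtIGraph (la mu om : ℝ) (D : Set E3) (R : ℝ) (Y : ℕ → ℤ → E3 → ℂ) (φ ψ : L2S R) : Prop :=
  ∃ (h u : E3 → C3) (α : ℕ → ℤ → Fin 3 → ℂ), IsSolutionOn la mu om D R h u φ ∧
    (∀ r : ℝ, R ≤ r → HasL2Sum r (outTerm la mu om Y α) u) ∧
    HasL2Sum R (inTerm la mu om Y α) ψ

/-- The `n`-th term of the series representation,
`- R⁻² ∑_{m=-n}^n M_n^m(x̂) conj(A_n(R)) A_n(R)⁻¹ ∫_{S_R} conj(M_n^m(ŷ))ᵀ φ(y) ds(y)`. -/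
def otiTerm (la mu om R : ℝ) (Y : ℕ → ℤ → E3 → ℂ) (φ : E3 → C3) (n : ℕ) (x : E3) : C3 :=
  WithLp.toLp 2 (-((R : ℂ) ^ 2)⁻¹ • ∑ m ∈ Finset.Icc (-(n : ℤ)) n,
    vshM Y n m (unitVec x) *ᵥ ((conjM (matA la mu om n R) * (matA la mu om n R)⁻¹) *ᵥ
      ∫ y, (vshM Y n m (unitVec y))ᴴ *ᵥ (φ y).ofLp ∂(sphereMeasure R)))

end ElasticOtI

end

/-!
Outside a ball of radius `a < R` a radiating solution splits as `u = ∇f + w` with `w` divergence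
free, where the components of `∇f` and of `w` are radiating Helmholtz fields with wave numbers `k_p`
and `k_s`. Paired over the sphere of radius `r` with a harmonic polynomial of degree `n`, such a
field solves the spherical Bessel equation of order `n` in `r`, and the radiation condition leaves
only the multiples of `h_n(k r)`. Pairing `u` with the vector spherical harmonics therefore gives
the coefficients `A_n(r) α_n^m`; since these harmonics form a Hilbert basis of `[L²(S²)]³`, this is
the outgoing expansion of `u`.

The parts of `α_n^m` coming from `f` and from `w` each meet at most one entry of every row of
`A_n(R)`, so conjugating the matrix does not change the moduli of its products with them, and the
incoming series is square summable along with the outgoing one.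

The Wronskian gives `Im (h_n' conj h_n) > 0`. If `det A_n(R)` were zero, then with `s = k_s R` and
`t = k_p R` one would have `(h_n(s) + s h_n'(s)) t h_n'(t) = δ_n h_n(s) h_n(t)`, which these signs
of imaginary parts rule out. So `A_n(R)` is invertible, `α_n^m` can be read off from
`φ`, and the formula for `𝒯 φ` follows, with uniqueness.

For `n = 0` the fields `U` and `V` vanish, so that only the last component of `α_0^0` is determined.
-/

open scoped ComplexConjugate

noncomputable section

namespace ElasticOtI

/-! ### Vector calculus in an algebra with three commuting derivations -/

/-- A commutative algebra with coordinate elements `X j` and commuting partial derivatives `d j`.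
It makes one set of vector identities available both for polynomials and for smooth functions. -/
structure VecCalc (R A : Type*) [CommRing R] [CommRing A] [Algebra R A] where
  d : Fin 3 → Derivation R A A
  X : Fin 3 → A
  d_X : ∀ i j, d i (X j) = if i = j then 1 else 0
  d_comm : ∀ i j f, d i (d j f) = d j (d i f)

namespace VecCalc

variable {R A B : Type*} [CommRing R] [CommRing A] [Algebra R A] [CommRing B] [Algebra R B]

section Operators

variable (S : VecCalc R A)

/-- The angular derivative `(x × ∇)_j`. Indices are taken modulo `3`. -/
def ang (j : Fin 3) : Derivation R A A := S.X (j + 1) • S.d (j + 2) - S.X (j + 2) • S.d (j + 1)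

/-- The Euler operator `x · ∇`. -/
def eul : Derivation R A A := S.X 0 • S.d 0 + S.X 1 • S.d 1 + S.X 2 • S.d 2

/-- The Laplace operator. -/
def lap : A →ₗ[R] A := ∑ j, (S.d j : A →ₗ[R] A) ∘ₗ (S.d j : A →ₗ[R] A)

/-- The divergence of a vector field. -/
def div (v : Fin 3 → A) : A := ∑ j, S.d j (v j)

/-- The curl of a vector field, with indices modulo `3`. -/
def curl (v : Fin 3 → A) (j : Fin 3) : A := S.d (j + 1) (v (j + 2)) - S.d (j + 2) (v (j + 1))

/-- The cross product `x × v`, with indices modulo `3`. -/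
def xcross (v : Fin 3 → A) (j : Fin 3) : A := S.X (j + 1) * v (j + 2) - S.X (j + 2) * v (j + 1)

/-- The product `x · v`. -/
def xdot (v : Fin 3 → A) : A := ∑ j, S.X j * v j

/-- The squared radius `x · x`. -/
def rsq : A := ∑ j, S.X j ^ 2

lemma ang_apply (j : Fin 3) (f : A) :
    S.ang j f = S.X (j + 1) * S.d (j + 2) f - S.X (j + 2) * S.d (j + 1) f := by
  simp [ang]

lemma eul_apply (f : A) : S.eul f = ∑ j, S.X j * S.d j f := by
  simp [eul, Fin.sum_univ_three]

lemma lap_apply (f : A) : S.lap f = ∑ j, S.d j (S.d j f) := by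
  simp [lap]

lemma xcross_d (f : A) (j : Fin 3) : S.xcross (fun i => S.d i f) j = S.ang j f :=
  (S.ang_apply j f).symm

lemma lap_d (f : A) (j : Fin 3) : S.lap (S.d j f) = S.d j (S.lap f) := by
  simp [lap_apply, S.d_comm j]

lemma ang_rsq (j : Fin 3) : S.ang j S.rsq = 0 := by
  fin_cases j <;>
  · simp only [ang_apply, rsq, pow_two, Fin.sum_univ_three, map_add, Derivation.leibniz, d_X,
      smul_eq_mul, Fin.reduceAdd, Fin.reduceEq, Fin.zero_eta, Fin.mk_one, Fin.reduceFinMk,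
      ↓reduceIte, zero_add]
    ring

lemma ang_rsq_mul (j : Fin 3) (f : A) : S.ang j (S.rsq * f) = S.rsq * S.ang j f := by
  rw [Derivation.leibniz, ang_rsq, smul_zero, add_zero, smul_eq_mul]

lemma rsq_mul_lap (f : A) :
    S.rsq * S.lap f = S.eul (S.eul f) + S.eul f + ∑ j, S.ang j (S.ang j f) := by
  simp only [rsq, lap_apply, eul_apply, ang_apply, Fin.sum_univ_three, map_add, map_sub,
    Derivation.leibniz, d_X, S.d_comm 1 0, S.d_comm 2 0, S.d_comm 2 1, smul_eq_mul,
    Fin.reduceAdd, Fin.reduceEq, ↓reduceIte, zero_add]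
  ring

lemma lap_ang (j : Fin 3) (f : A) : S.lap (S.ang j f) = S.ang j (S.lap f) := by
  fin_cases j <;>
  · simp only [lap_apply, ang_apply, Fin.sum_univ_three, map_add, map_sub, Derivation.leibniz,
      d_X, S.d_comm 1 0, S.d_comm 2 0, S.d_comm 2 1, smul_eq_mul, Fin.reduceAdd, Fin.reduceEq,
      Fin.zero_eta, Fin.mk_one, Fin.reduceFinMk, ↓reduceIte, zero_add, map_zero,
      Derivation.map_one_eq_zero]
    ring

lemma lap_rsq_mul (f : A) : S.lap (S.rsq * f) = S.rsq * S.lap f + 4 * S.eul f + 6 * f := by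
  simp only [rsq, pow_two, lap_apply, eul_apply, Fin.sum_univ_three, map_add, Derivation.leibniz,
    d_X, smul_eq_mul, Fin.reduceEq, ↓reduceIte, map_zero, Derivation.map_one_eq_zero]
  ring

lemma lap_xdot (v : Fin 3 → A) :
    S.lap (S.xdot v) = S.xdot (fun j => S.lap (v j)) + 2 * S.div v := by
  simp only [lap_apply, xdot, div, Fin.sum_univ_three, map_add, Derivation.leibniz, d_X,
    smul_eq_mul, Fin.reduceEq, ↓reduceIte, map_zero, Derivation.map_one_eq_zero]
  ring

lemma d_xdot (v : Fin 3 → A) (j : Fin 3) :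
    S.d j (S.xdot v) = v j + S.eul (v j) + S.xcross (S.curl v) j := by
  fin_cases j <;>
  · simp only [xdot, eul_apply, xcross, curl, Fin.sum_univ_three, map_add, Derivation.leibniz,
      d_X, smul_eq_mul, Fin.reduceAdd, Fin.reduceEq, Fin.zero_eta, Fin.mk_one, Fin.reduceFinMk,
      ↓reduceIte, zero_add]
    ring

lemma xdot_xcross (v : Fin 3 → A) : S.xdot (S.xcross v) = 0 := by
  simp only [xdot, xcross, Fin.sum_univ_three, Fin.reduceAdd, zero_add]
  ring

lemma xdot_ang (f : A) : S.xdot (fun j => S.ang j f) = 0 := by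
  simpa only [← xcross_d] using S.xdot_xcross fun i => S.d i f

lemma xcross_xcross (v : Fin 3 → A) (j : Fin 3) :
    S.xcross (S.xcross v) j = S.X j * S.xdot v - S.rsq * v j := by
  fin_cases j <;>
  · simp only [xdot, xcross, rsq, Fin.sum_univ_three, Fin.reduceAdd, Fin.zero_eta, Fin.mk_one,
      Fin.reduceFinMk, zero_add]
    ring

lemma xcross_ang (f : A) (j : Fin 3) :
    S.xcross (fun i => S.ang i f) j = S.X j * S.eul f - S.rsq * S.d j f := by
  simpa only [← xcross_d, eul_apply, xdot] using S.xcross_xcross (fun i => S.d i f) j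

lemma sum_ang_xcross (v : Fin 3 → A) :
    ∑ j, S.ang j (S.xcross v j) = S.rsq * S.div v - S.xdot v - S.eul (S.xdot v) := by
  simp only [rsq, xdot, eul_apply, xcross, ang_apply, div, Fin.sum_univ_three, map_add, map_sub,
    Derivation.leibniz, d_X, smul_eq_mul, Fin.reduceAdd, Fin.reduceEq, ↓reduceIte, zero_add]
  ring

lemma sum_ang_d (f : A) : ∑ j, S.ang j (S.d j f) = 0 := by
  simp only [ang_apply, Fin.sum_univ_three, Fin.reduceAdd, zero_add, S.d_comm 1 0, S.d_comm 2 0,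
    S.d_comm 2 1]
  ring

lemma div_ang (f : A) : S.div (fun j => S.ang j f) = 0 := by
  simp only [div, ang_apply, Fin.sum_univ_three, map_sub, Derivation.leibniz, d_X, smul_eq_mul,
    Fin.reduceAdd, Fin.reduceEq, ↓reduceIte, zero_add, S.d_comm 1 0, S.d_comm 2 0, S.d_comm 2 1]
  ring

lemma sum_ang_xcross_ang (f : A) : ∑ j, S.ang j (S.xcross (fun i => S.ang i f) j) = 0 := by
  rw [sum_ang_xcross, div_ang, xdot_ang, map_zero, mul_zero, sub_zero, sub_zero]

lemma div_curl (v : Fin 3 → A) : S.div (S.curl v) = 0 := by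
  simp only [curl, div, Fin.sum_univ_three, map_sub, Fin.reduceAdd, zero_add, S.d_comm 1 0,
    S.d_comm 2 0, S.d_comm 2 1]
  ring

lemma curl_curl (v : Fin 3 → A) (j : Fin 3) :
    S.curl (S.curl v) j = S.d j (S.div v) - S.lap (v j) := by
  fin_cases j <;>
  · simp only [lap_apply, curl, div, Fin.sum_univ_three, map_add, map_sub, Fin.reduceAdd,
      Fin.zero_eta, Fin.mk_one, Fin.reduceFinMk, zero_add, S.d_comm 1 0, S.d_comm 2 0,
      S.d_comm 2 1]
    ring

section Fields

/-- The radial field `q x` with potential `q`. -/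
def radialField : A →ₗ[R] (Fin 3 → A) := LinearMap.pi fun j => LinearMap.mulLeft R (S.X j)

/-- The toroidal field `x × ∇ q` with potential `q`. -/
def toroidalField : A →ₗ[R] (Fin 3 → A) := LinearMap.pi fun j => (S.ang j : A →ₗ[R] A)

/-- The linear map `v ↦ x × v` on vector fields. -/
def xcrossₗ : (Fin 3 → A) →ₗ[R] (Fin 3 → A) where
  toFun := S.xcross
  map_add' v w := by
    ext j
    simp only [xcross, Pi.add_apply]
    ring
  map_smul' c v := by
    ext j
    simp only [xcross, Pi.smul_apply, mul_smul_comm, smul_sub, RingHom.id_apply]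

/-- The tangential gradient field `x × (x × ∇ q)` with potential `q`. -/
def tangentField : A →ₗ[R] (Fin 3 → A) := S.xcrossₗ ∘ₗ S.toroidalField

lemma radialField_rsq_mul (q : A) : S.radialField (S.rsq * q) = S.rsq • S.radialField q :=
  funext fun _ => mul_left_comm _ _ _

lemma toroidalField_rsq_mul (q : A) : S.toroidalField (S.rsq * q) = S.rsq • S.toroidalField q :=
  funext fun j => S.ang_rsq_mul j q

lemma tangentField_rsq_mul (q : A) : S.tangentField (S.rsq * q) = S.rsq • S.tangentField q := by
  change S.xcross (S.toroidalField _) = _ • S.xcross (S.toroidalField q)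
  rw [toroidalField_rsq_mul]
  ext j
  simp only [xcross, Pi.smul_apply, smul_eq_mul]
  ring

lemma xcrossₗ_grad (f : A) : S.xcrossₗ (fun j => S.d j f) = S.toroidalField f :=
  funext fun j => S.xcross_d f j

lemma xcrossₗ_xcrossₗ (v : Fin 3 → A) :
    S.xcrossₗ (S.xcrossₗ v) = S.radialField (S.xdot v) - S.rsq • v :=
  funext fun j => S.xcross_xcross v j

lemma rsq_smul_grad (f : A) :
    S.rsq • (fun j => S.d j f) = S.radialField (S.eul f) - S.tangentField f := by
  ext j
  change S.rsq * S.d j f = S.X j * S.eul f - S.xcross (fun i => S.ang i f) j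
  rw [xcross_ang]
  ring

end Fields

section Lame

variable (a b c : R) (u : Fin 3 → A)

lemma div_lame :
    S.div (fun i => a • S.lap (u i) + b • S.d i (S.div u) + c • u i) =
      (a + b) • S.lap (S.div u) + c • S.div u := by
  have hlap : ∑ j, S.d j (S.lap (u j)) = S.lap (S.div u) := by
    simp only [div, map_sum, lap_d]
  simp only [div, map_add, Derivation.map_smul, Finset.sum_add_distrib, ← Finset.smul_sum,
    add_smul] at hlap ⊢
  rw [hlap, lap_apply]

lemma curl_lame (j : Fin 3) :
    S.curl (fun i => a • S.lap (u i) + b • S.d i (S.div u) + c • u i) j =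
      a • S.lap (S.curl u j) + c • S.curl u j := by
  simp only [curl, map_add, Derivation.map_smul, S.d_comm (j + 2) (j + 1) (S.div u), map_sub,
    lap_d, smul_sub]
  abel

lemma curl_curl_lame (j : Fin 3) :
    S.curl (S.curl (fun i => a • S.lap (u i) + b • S.d i (S.div u) + c • u i)) j =
      a • S.lap (S.curl (S.curl u) j) + c • S.curl (S.curl u) j := by
  have hcurl : S.curl (fun i => a • S.lap (u i) + b • S.d i (S.div u) + c • u i) =
      fun j => a • S.lap (S.curl u j) + (0 : R) • S.d j (S.div (S.curl u)) + c • S.curl u j := by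
    funext j
    rw [curl_lame, zero_smul, add_zero]
  rw [hcurl, curl_lame]

end Lame

end Operators

/-- A homomorphism of algebras that respects coordinates and partial derivatives. -/
structure Compat (S : VecCalc R A) (T : VecCalc R B) (φ : A →ₐ[R] B) : Prop where
  X : ∀ j, φ (S.X j) = T.X j
  d : ∀ j f, φ (S.d j f) = T.d j (φ f)

section Compat

variable {S : VecCalc R A} {T : VecCalc R B} {φ : A →ₐ[R] B}

lemma Compat.ang (h : Compat S T φ) (j : Fin 3) (f : A) : φ (S.ang j f) = T.ang j (φ f) := by
  simp only [ang_apply, map_sub, map_mul, h.X, h.d]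

lemma Compat.xcross (h : Compat S T φ) (v : Fin 3 → A) (j : Fin 3) :
    φ (S.xcross v j) = T.xcross (fun i => φ (v i)) j := by
  simp only [VecCalc.xcross, map_sub, map_mul, h.X]

lemma Compat.rsq (h : Compat S T φ) : φ S.rsq = T.rsq := by
  simp only [VecCalc.rsq, map_sum, map_pow, h.X]

lemma Compat.radialField (h : Compat S T φ) (q : A) :
    φ.toLinearMap.compLeft (Fin 3) (S.radialField q) = T.radialField (φ q) :=
  funext fun j => (map_mul φ _ _).trans (congrArg (· * _) (h.X j))

lemma Compat.toroidalField (h : Compat S T φ) (q : A) :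
    φ.toLinearMap.compLeft (Fin 3) (S.toroidalField q) = T.toroidalField (φ q) :=
  funext fun j => h.ang j q

lemma Compat.tangentField (h : Compat S T φ) (q : A) :
    φ.toLinearMap.compLeft (Fin 3) (S.tangentField q) = T.tangentField (φ q) := by
  change _ = T.xcrossₗ (T.toroidalField (φ q))
  rw [← h.toroidalField]
  exact funext fun j => h.xcross _ j

end Compat

end VecCalc

/-! ### Spherical Hankel functions -/

section WavePolynomials

open Polynomial

/-- The Bessel polynomial with coefficients `(n + k)! / (k! (n - k)!)`, so that
`h_n(t) = (-i)^{n+1} (e^{it} / t) p(i / (2t))`. -/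
def besselPoly (n : ℕ) : ℂ[X] :=
  ∑ k ∈ Finset.range (n + 1),
    C (((n + k).factorial : ℂ) / ((k.factorial : ℂ) * ((n - k).factorial : ℂ))) * X ^ k

lemma coeff_besselPoly_of_le {n k : ℕ} (hk : k ≤ n) : (besselPoly n).coeff k =
    ((n + k).factorial : ℂ) / ((k.factorial : ℂ) * ((n - k).factorial : ℂ)) := by
  simp only [besselPoly, finsetSum_coeff, coeff_C_mul, coeff_X_pow, mul_ite, mul_one, mul_zero,
    Finset.sum_ite_eq, Finset.mem_range, Nat.lt_succ_iff, if_pos hk]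

lemma coeff_besselPoly_of_lt {n k : ℕ} (hk : n < k) : (besselPoly n).coeff k = 0 := by
  simp only [besselPoly, finsetSum_coeff, coeff_C_mul, coeff_X_pow, mul_ite, mul_one, mul_zero,
    Finset.sum_ite_eq, Finset.mem_range, Nat.lt_succ_iff, if_neg hk.not_ge]

lemma eval_zero_besselPoly (n : ℕ) : (besselPoly n).eval 0 = 1 := by
  rw [← coeff_zero_eq_eval_zero, coeff_besselPoly_of_le n.zero_le]
  simp [Nat.factorial_ne_zero]

lemma coeff_besselPoly_succ (n k : ℕ) : (besselPoly n).coeff (k + 1) * (k + 1) =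
    (besselPoly n).coeff k * ((n * (n + 1) : ℂ) - k * (k + 1)) := by
  rcases lt_trichotomy k n with hk | rfl | hk
  · obtain ⟨m, rfl⟩ := Nat.exists_eq_add_of_lt hk
    have hk_fact : (k.factorial : ℂ) ≠ 0 := by exact_mod_cast k.factorial_ne_zero
    have hm_fact : (m.factorial : ℂ) ≠ 0 := by exact_mod_cast m.factorial_ne_zero
    have hk_succ : (k : ℂ) + 1 ≠ 0 := by exact_mod_cast k.succ_ne_zero
    have hm_succ : (m : ℂ) + 1 ≠ 0 := by exact_mod_cast m.succ_ne_zero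
    rw [coeff_besselPoly_of_le (k := k + 1) hk, coeff_besselPoly_of_le hk.le,
      show k + m + 1 - (k + 1) = m by omega, show k + m + 1 - k = m + 1 by omega, ← add_assoc,
      Nat.factorial_succ (k + m + 1 + k), Nat.factorial_succ m, Nat.factorial_succ k]
    push_cast
    field_simp
    ring
  · simp [coeff_besselPoly_of_lt k.lt_succ_self]
  · simp [coeff_besselPoly_of_lt hk, coeff_besselPoly_of_lt (hk.trans k.lt_succ_self)]

lemma besselPoly_ode (n : ℕ) :
    X ^ 2 * derivative (derivative (besselPoly n)) + (2 * X + 1) * derivative (besselPoly n) =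
      C (n * (n + 1) : ℂ) * besselPoly n := by
  ext k
  have hrec := coeff_besselPoly_succ n k
  rcases k with _ | _ | k <;>
    simp [add_mul, mul_assoc, coeff_derivative, coeff_X_pow_mul'] at hrec ⊢ <;>
    linear_combination hrec

/-- The function `t ↦ (e^{it} / t) q(i / (2t))`. -/
def wave (q : ℂ[X]) (t : ℝ) : ℂ :=
  Complex.exp (Complex.I * t) / t * q.eval (Complex.I / (2 * t))

/-- The action of `d/dt` on the polynomial factor of `wave`. -/
def waveDeriv (q : ℂ[X]) : ℂ[X] := C Complex.I * (q + 2 * X * q + 2 * X ^ 2 * derivative q)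

lemma hasDerivAt_wave (q : ℂ[X]) {t : ℝ} (ht : t ≠ 0) :
    HasDerivAt (wave q) (wave (waveDeriv q) t) t := by
  have htc : (t : ℂ) ≠ 0 := by exact_mod_cast ht
  have hid : HasDerivAt (fun s : ℂ => s) 1 (t : ℂ) := hasDerivAt_id _
  have hexp := (hid.const_mul Complex.I).cexp
  have hpoly := (q.hasDerivAt (Complex.I / (2 * t))).comp (t : ℂ)
    ((hasDerivAt_const (t : ℂ) Complex.I).fun_div (hid.const_mul 2) (by simpa using htc))
  refine ((hexp.fun_div hid htc).fun_mul hpoly).comp_ofReal.congr_deriv ?_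
  simp only [wave, waveDeriv, eval_mul, eval_add, eval_C, eval_ofNat, eval_X, eval_pow,
    Function.comp_apply]
  generalize q.eval (Complex.I / (2 * t)) = a, (derivative q).eval (Complex.I / (2 * t)) = b
  field_simp
  linear_combination (-2 * t * a - Complex.I * b) * Complex.I_sq

lemma tendsto_ofReal_inv : Tendsto (fun t : ℝ => ((t : ℂ))⁻¹) atTop (𝓝 0) := by
  simpa using (tendsto_inv_atTop_zero (𝕜 := ℝ)).ofReal

lemma tendsto_norm_mul_wave (q : ℂ[X]) :
    Tendsto (fun t : ℝ => ‖(t : ℂ) * wave q t‖) atTop (𝓝 ‖q.eval 0‖) := by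
  have harg : Tendsto (fun t : ℝ => Complex.I / (2 * (t : ℂ))) atTop (𝓝 0) := by
    simpa [div_eq_mul_inv, mul_comm, mul_assoc] using
      (tendsto_ofReal_inv.const_mul 2⁻¹).const_mul Complex.I
  refine ((q.continuous.tendsto 0).comp harg).norm.congr' ?_
  filter_upwards [eventually_ne_atTop 0] with t ht
  have htc : (t : ℂ) ≠ 0 := by exact_mod_cast ht
  rw [wave, ← mul_assoc, mul_div_cancel₀ _ htc, norm_mul, mul_comm Complex.I,
    Complex.norm_exp_ofReal_mul_I, one_mul, Function.comp_apply]

lemma waveDeriv_waveDeriv_besselPoly (n : ℕ) (c : ℂ) :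
    waveDeriv (waveDeriv (C c * besselPoly n)) =
      4 * X * C Complex.I * waveDeriv (C c * besselPoly n)
        - (1 + 4 * C (n * (n + 1) : ℂ) * X ^ 2) * (C c * besselPoly n) := by
  have hI : (C Complex.I : ℂ[X]) ^ 2 = -1 := by rw [← C_pow, Complex.I_sq, C_neg, C_1]
  have hode := besselPoly_ode n
  generalize C (n * (n + 1) : ℂ) = δ at hode ⊢
  simp only [waveDeriv, pow_two X, derivative_mul, derivative_add, derivative_C, derivative_X,
    derivative_ofNat, derivative_zero] at hode ⊢
  linear_combination (-4 * X ^ 2 * C c) * hode + C c * (besselPoly n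
    + (4 * X ^ 2 + 8 * X ^ 3) * derivative (besselPoly n)
    + 4 * X ^ 4 * derivative (derivative (besselPoly n))) * hI

/-- The polynomial factor of the spherical Hankel function: `h_n = wave (hankelPoly n)`. -/
def hankelPoly (n : ℕ) : ℂ[X] := C ((-Complex.I) ^ (n + 1)) * besselPoly n

lemma hankel_eq_wave (n : ℕ) : hankel n = wave (hankelPoly n) := by
  funext t
  simp only [hankel, wave, hankelPoly, besselPoly, eval_mul, eval_C, eval_finsetSum, eval_pow,
    eval_X]
  ring

lemma norm_eval_zero_hankelPoly (n : ℕ) : ‖(hankelPoly n).eval 0‖ = 1 := by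
  simp [hankelPoly, eval_zero_besselPoly]

/-- The derivative `h_n'` of the spherical Hankel function. -/
def hankelDeriv (n : ℕ) : ℝ → ℂ := wave (waveDeriv (hankelPoly n))

lemma hasDerivAt_hankel (n : ℕ) {t : ℝ} (ht : t ≠ 0) :
    HasDerivAt (hankel n) (hankelDeriv n t) t := by
  rw [hankel_eq_wave]
  exact hasDerivAt_wave _ ht

lemma hasDerivAt_hankelDeriv (n : ℕ) {t : ℝ} (ht : t ≠ 0) :
    HasDerivAt (hankelDeriv n)
      ((-2 * t * hankelDeriv n t - ((t : ℂ) ^ 2 - n * (n + 1)) * hankel n t) / t ^ 2) t := by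
  have htc : (t : ℂ) ≠ 0 := by exact_mod_cast ht
  refine (hasDerivAt_wave _ ht).congr_deriv ?_
  rw [hankel_eq_wave, hankelDeriv, hankelPoly, waveDeriv_waveDeriv_besselPoly, ← hankelPoly]
  simp only [wave, eval_mul, eval_add, eval_sub, eval_C, eval_ofNat, eval_X, eval_pow, eval_one]
  generalize (waveDeriv (hankelPoly n)).eval (Complex.I / (2 * t)) = b,
    (hankelPoly n).eval (Complex.I / (2 * t)) = a
  field_simp
  linear_combination (8 * t * b - 4 * n * (n + 1) * a) * Complex.I_sq

lemma tendsto_norm_mul_hankel (n : ℕ) :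
    Tendsto (fun t : ℝ => ‖(t : ℂ) * hankel n t‖) atTop (𝓝 1) := by
  rw [hankel_eq_wave, ← norm_eval_zero_hankelPoly n]
  exact tendsto_norm_mul_wave _

lemma tendsto_hankelDeriv_sub (n : ℕ) :
    Tendsto (fun t : ℝ => (t : ℂ) * (hankelDeriv n t - Complex.I * hankel n t)) atTop (𝓝 0) := by
  rw [tendsto_zero_iff_norm_tendsto_zero]
  have h := tendsto_norm_mul_wave (waveDeriv (hankelPoly n) - C Complex.I * hankelPoly n)
  rw [show ‖(waveDeriv (hankelPoly n) - C Complex.I * hankelPoly n).eval 0‖ = 0 by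
    simp [waveDeriv]] at h
  refine h.congr fun t => ?_
  rw [hankelDeriv, hankel_eq_wave]
  simp only [wave, eval_sub, eval_mul, eval_C]
  ring_nf

end WavePolynomials

/-! ### Solutions of the spherical Bessel equation -/

/-- `F` solves the spherical Bessel equation of order `n` with wave number `k` on `(a, ∞)`, and
`F1 = r F'`. -/
def IsBessel (k : ℝ) (n : ℕ) (a : ℝ) (F F1 : ℝ → ℂ) : Prop :=
  ∀ r, a < r → HasDerivAt F (F1 r / r) r ∧
    HasDerivAt F1 ((-F1 r + ((n : ℂ) * (n + 1) - (k : ℂ) ^ 2 * (r : ℂ) ^ 2) * F r) / r) r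

lemma IsBessel.conj {k : ℝ} {n : ℕ} {a : ℝ} {F F1 : ℝ → ℂ} (h : IsBessel k n a F F1) :
    IsBessel k n a (fun r => conj (F r)) (fun r => conj (F1 r)) := by
  intro r hr
  obtain ⟨hF, hF1⟩ := h r hr
  exact ⟨hF.star.congr_deriv (by simp), hF1.star.congr_deriv (by simp)⟩

lemma IsBessel.wronskian {k : ℝ} {n : ℕ} {a : ℝ} (ha : 0 ≤ a) {F F1 G G1 : ℝ → ℂ}
    (hF : IsBessel k n a F F1) (hG : IsBessel k n a G G1) :
    ∃ c, ∀ r, a < r → (r : ℂ) * (F r * G1 r - F1 r * G r) = c := by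
  have hderiv : ∀ r, a < r →
      HasDerivAt (fun r : ℝ => (r : ℂ) * (F r * G1 r - F1 r * G r)) 0 r := by
    intro r hr
    have hrc : (r : ℂ) ≠ 0 := by exact_mod_cast (ha.trans_lt hr).ne'
    obtain ⟨hF, hF1⟩ := hF r hr
    obtain ⟨hG, hG1⟩ := hG r hr
    refine ((hasDerivAt_id r).ofReal_comp.fun_mul
      ((hF.fun_mul hG1).fun_sub (hF1.fun_mul hG))).congr_deriv ?_
    simp only [id_eq, Complex.ofReal_one]
    field_simp
    ring
  exact isOpen_Ioi.exists_is_const_of_deriv_eq_zero isPreconnected_Ioi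
    (fun r hr => (hderiv r hr).differentiableAt.differentiableWithinAt)
    fun r hr => (hderiv r hr).deriv

/-- The function `r ↦ h_n(k r)`. -/
def scaledHankel (k : ℝ) (n : ℕ) (r : ℝ) : ℂ := hankel n (k * r)

/-- The function `r ↦ r (d/dr) h_n(k r)`. -/
def scaledHankelDeriv (k : ℝ) (n : ℕ) (r : ℝ) : ℂ := (k * r : ℝ) * hankelDeriv n (k * r)

section ScaledHankel

variable {k : ℝ} (hk : 0 < k) (n : ℕ)

include hk

lemma isBessel_scaledHankel {a : ℝ} (ha : 0 ≤ a) :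
    IsBessel k n a (scaledHankel k n) (scaledHankelDeriv k n) := by
  intro r hr
  have hkr : k * r ≠ 0 := (mul_pos hk (ha.trans_lt hr)).ne'
  have hrc : (r : ℂ) ≠ 0 := by exact_mod_cast (ha.trans_lt hr).ne'
  have hkc : (k : ℂ) ≠ 0 := by exact_mod_cast hk.ne'
  have hmul : HasDerivAt (fun s : ℝ => k * s) k r := by
    simpa using (hasDerivAt_id r).const_mul k
  constructor
  · refine ((hasDerivAt_hankel n hkr).scomp r hmul).congr_deriv ?_
    simp only [scaledHankelDeriv, Complex.real_smul]
    push_cast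
    field_simp
  · refine (hmul.ofReal_comp.fun_mul
      ((hasDerivAt_hankelDeriv n hkr).scomp r hmul)).congr_deriv ?_
    simp only [scaledHankelDeriv, scaledHankel, Complex.real_smul, Function.comp_apply]
    push_cast
    field_simp
    ring

lemma tendsto_norm_scaledHankel :
    Tendsto (fun r : ℝ => ‖((k * r : ℝ) : ℂ) * scaledHankel k n r‖) atTop (𝓝 1) :=
  (tendsto_norm_mul_hankel n).comp (tendsto_id.const_mul_atTop hk)

lemma tendsto_scaledHankelDeriv_sub :
    Tendsto (fun r : ℝ =>
      scaledHankelDeriv k n r - Complex.I * ((k * r : ℝ) : ℂ) * scaledHankel k n r) atTop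
      (𝓝 0) := by
  refine ((tendsto_hankelDeriv_sub n).comp (tendsto_id.const_mul_atTop hk)).congr fun r => ?_
  simp only [scaledHankelDeriv, scaledHankel, Function.comp_apply, id_eq]
  ring

lemma tendsto_scaledHankel : Tendsto (scaledHankel k n) atTop (𝓝 0) := by
  rw [tendsto_zero_iff_norm_tendsto_zero]
  have h := (tendsto_norm_scaledHankel hk n).div_atTop (tendsto_id.const_mul_atTop hk)
  refine h.congr' ?_
  filter_upwards [eventually_gt_atTop 0] with r hr
  have hkr : 0 < k * r := mul_pos hk hr
  rw [norm_mul, Complex.norm_of_nonneg hkr.le, id_eq, mul_div_cancel_left₀ _ hkr.ne']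

lemma tendsto_scaledHankelDeriv_div :
    Tendsto (fun r : ℝ => scaledHankelDeriv k n r / r) atTop (𝓝 0) := by
  have h := ((tendsto_scaledHankelDeriv_sub hk n).mul tendsto_ofReal_inv).add
    ((tendsto_scaledHankel hk n).const_mul (Complex.I * k))
  simp only [mul_zero, add_zero] at h
  refine h.congr' ?_
  filter_upwards [eventually_gt_atTop 0] with r hr
  have hrc : (r : ℂ) ≠ 0 := by exact_mod_cast hr.ne'
  push_cast
  field_simp
  ring

lemma tendsto_wronskian_scaledHankel :
    Tendsto (fun r : ℝ => (r : ℂ) * (scaledHankel k n r * conj (scaledHankelDeriv k n r)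
      - scaledHankelDeriv k n r * conj (scaledHankel k n r))) atTop (𝓝 (-(2 * Complex.I / k))) := by
  have hkc : (k : ℂ) ≠ 0 := by exact_mod_cast hk.ne'
  have hnorm := tendsto_norm_scaledHankel hk n
  have hcross : Tendsto (fun r : ℝ => ((k * r : ℝ) : ℂ) * scaledHankel k n r *
      conj (scaledHankelDeriv k n r - Complex.I * ((k * r : ℝ) : ℂ) * scaledHankel k n r)) atTop
      (𝓝 0) := by
    rw [tendsto_zero_iff_norm_tendsto_zero]
    simpa only [norm_mul, RCLike.norm_conj, norm_zero, mul_zero] using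
      hnorm.mul (tendsto_scaledHankelDeriv_sub hk n).norm
  have hlim := ((hcross.sub ((Complex.continuous_conj.tendsto 0).comp hcross)).sub
    ((hnorm.ofReal.pow 2).const_mul (2 * Complex.I))).div_const (k : ℂ)
  simp only [map_zero, sub_zero, zero_sub, Complex.ofReal_one, one_pow, mul_one, neg_div]
    at hlim
  refine hlim.congr fun r => ?_
  simp only [Function.comp_apply, ← Complex.mul_conj', map_sub, map_mul, map_neg,
    Complex.conj_conj, Complex.conj_I, Complex.conj_ofReal]
  push_cast
  field_simp
  ring

lemma wronskian_scaledHankel {r : ℝ} (hr : 0 < r) :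
    (r : ℂ) * (scaledHankel k n r * conj (scaledHankelDeriv k n r)
      - scaledHankelDeriv k n r * conj (scaledHankel k n r)) = -(2 * Complex.I / k) := by
  have hB := isBessel_scaledHankel hk n le_rfl
  obtain ⟨c, hc⟩ := hB.wronskian le_rfl hB.conj
  rw [hc r hr]
  refine tendsto_nhds_unique (tendsto_const_nhds.congr' ?_) (tendsto_wronskian_scaledHankel hk n)
  filter_upwards [eventually_gt_atTop 0] with s hs using (hc s hs).symm

lemma scaledHankel_im_pos {r : ℝ} (hr : 0 < r) :
    0 < (scaledHankelDeriv k n r * conj (scaledHankel k n r)).im := by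
  have h := congrArg Complex.im (wronskian_scaledHankel hk n hr)
  rw [← Complex.conj_conj (scaledHankel k n r * _), map_mul, Complex.conj_conj,
    Complex.im_ofReal_mul, mul_comm (conj _), Complex.sub_im, Complex.conj_im, Complex.neg_im,
    Complex.div_ofReal_im, Complex.mul_I_im, Complex.re_ofNat] at h
  have hpos : 0 < 2 / k := by positivity
  nlinarith

lemma scaledHankel_ne_zero {r : ℝ} (hr : 0 < r) : scaledHankel k n r ≠ 0 := by
  intro h
  simpa [h] using scaledHankel_im_pos hk n hr

end ScaledHankel

section BesselSolutions

variable {k : ℝ} (hk : 0 < k) {n : ℕ} {a : ℝ} (ha : 0 ≤ a) {F F1 : ℝ → ℂ}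
  (hF : IsBessel k n a F F1)

include hk ha hF

lemma IsBessel.eq_scaledHankel_add : ∃ α β : ℂ, ∀ r, a < r →
    F r = α * scaledHankel k n r + β * conj (scaledHankel k n r) ∧
    F1 r = α * scaledHankelDeriv k n r + β * conj (scaledHankelDeriv k n r) := by
  have hB := isBessel_scaledHankel hk n ha
  have hkc : (k : ℂ) ≠ 0 := by exact_mod_cast hk.ne'
  obtain ⟨c, hc⟩ := hF.wronskian ha hB
  obtain ⟨e, he⟩ := hF.wronskian ha hB.conj
  refine ⟨-e / (2 * Complex.I / k), c / (2 * Complex.I / k), fun r hr => ?_⟩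
  have hw := wronskian_scaledHankel hk n (ha.trans_lt hr)
  have hcr := hc r hr
  have her := he r hr
  have hw_ne : (2 * Complex.I / k : ℂ) ≠ 0 := by simp [hkc]
  generalize (2 * Complex.I / k : ℂ) = w at hw hw_ne ⊢
  constructor
  · field_simp
    linear_combination F r * hw + conj (scaledHankel k n r) * hcr - scaledHankel k n r * her
  · field_simp
    linear_combination F1 r * hw + conj (scaledHankelDeriv k n r) * hcr
      - scaledHankelDeriv k n r * her

lemma IsBessel.eq_scaledHankel_of_radiating
    (hrad : Tendsto (fun r : ℝ => F1 r - Complex.I * ((k * r : ℝ) : ℂ) * F r) atTop (𝓝 0)) :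
    ∃ α : ℂ, ∀ r, a < r → F r = α * scaledHankel k n r ∧ F1 r = α * scaledHankelDeriv k n r := by
  obtain ⟨α, β, h⟩ := hF.eq_scaledHankel_add hk ha
  have hout := tendsto_scaledHankelDeriv_sub hk n
  have hin := (Complex.continuous_conj.tendsto 0).comp hout
  rw [map_zero] at hin
  have hlim := ((hrad.sub (hout.const_mul α)).sub (hin.const_mul β)).norm
  simp only [mul_zero, sub_zero, norm_zero] at hlim
  -- The incoming wave `β conj (h_n)` violates the radiation condition by `-2 i k r β conj (h_n)`.
  have hβ : 2 * ‖β‖ * 1 = 0 := by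
    refine tendsto_nhds_unique ((tendsto_norm_scaledHankel hk n).const_mul (2 * ‖β‖))
      (hlim.congr' ?_)
    filter_upwards [eventually_gt_atTop a] with r hr
    rw [(h r hr).1, (h r hr).2, ← RCLike.norm_conj (((k * r : ℝ) : ℂ) * scaledHankel k n r),
      show (2 : ℝ) = ‖(-2 * Complex.I : ℂ)‖ by simp, ← norm_mul, ← norm_mul]
    congr 1
    simp only [Function.comp_apply, map_sub, map_mul, Complex.conj_I, Complex.conj_ofReal]
    ring
  obtain rfl : β = 0 := by simpa using hβ
  exact ⟨α, fun r hr => by simpa using h r hr⟩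

lemma IsBessel.tendsto_zero :
    Tendsto F atTop (𝓝 0) ∧ Tendsto (fun r : ℝ => F1 r / r) atTop (𝓝 0) := by
  obtain ⟨α, β, h⟩ := hF.eq_scaledHankel_add hk ha
  have tendsto_comb : ∀ {u : ℝ → ℂ}, Tendsto u atTop (𝓝 0) →
      Tendsto (fun r => α * u r + β * conj (u r)) atTop (𝓝 0) := fun hu => by
    simpa using (hu.const_mul α).add (((Complex.continuous_conj.tendsto 0).comp hu).const_mul β)
  constructor
  · refine (tendsto_comb (tendsto_scaledHankel hk n)).congr' ?_
    filter_upwards [eventually_gt_atTop a] with r hr using (h r hr).1.symm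
  · refine (tendsto_comb (tendsto_scaledHankelDeriv_div hk n)).congr' ?_
    filter_upwards [eventually_gt_atTop a] with r hr
    rw [(h r hr).2, map_div₀, Complex.conj_ofReal]
    ring

end BesselSolutions

/-! ### The matrices `A_n` -/

lemma kp_pos {la mu om : ℝ} (hla : 0 < 2 * mu + la) (hom : 0 < om) : 0 < kp la mu om :=
  div_pos hom (Real.sqrt_pos.mpr hla)

lemma ks_pos {mu om : ℝ} (hmu : 0 < mu) (hom : 0 < om) : 0 < ks mu om :=
  div_pos hom (Real.sqrt_pos.mpr hmu)

lemma mul_ne_of_im_pos {s s1 p p1 : ℂ} (hs : 0 < (s1 * conj s).im) (hp : 0 < (p1 * conj p).im)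
    (d : ℝ) : (s + s1) * p1 ≠ (d : ℂ) ^ 2 * s * p := by
  -- Multiplied by `conj (s p1)`, the left side has positive and the right side nonpositive
  -- imaginary part.
  intro h
  have hp1 : 0 < ‖p1‖ ^ 2 := by
    have : p1 ≠ 0 := by rintro rfl; simp at hp
    positivity
  have hmul : ((‖p1‖ ^ 2 : ℝ) : ℂ) * (((‖s‖ ^ 2 : ℝ) : ℂ) + s1 * conj s) =
      ((d ^ 2 * ‖s‖ ^ 2 : ℝ) : ℂ) * conj (p1 * conj p) := by
    push_cast
    rw [← Complex.mul_conj', ← Complex.mul_conj', map_mul, Complex.conj_conj]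
    linear_combination conj s * conj p1 * h
  have him := congrArg Complex.im hmul
  rw [Complex.im_ofReal_mul, Complex.im_ofReal_mul, Complex.add_im, Complex.ofReal_im, zero_add,
    Complex.conj_im] at him
  nlinarith [mul_pos hp1 hs, mul_nonneg (by positivity : 0 ≤ d ^ 2 * ‖s‖ ^ 2) hp.le]

section MatA

variable {la mu om : ℝ} (hp : 0 < kp la mu om) (hs : 0 < ks mu om) (n : ℕ) {r : ℝ} (hr : 0 < r)

include hp hs hr

lemma matA_eq : matA la mu om n r =
    !![scaledHankel (ks mu om) n r, 0, 0;
      0, -(scaledHankel (ks mu om) n r + scaledHankelDeriv (ks mu om) n r) / r,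
        sqrtDelta n * scaledHankel (kp la mu om) n r / r;
      0, -(sqrtDelta n * scaledHankel (ks mu om) n r) / r,
        scaledHankelDeriv (kp la mu om) n r / r] := by
  have hrc : (r : ℂ) ≠ 0 := by exact_mod_cast hr.ne'
  have hderiv : (kp la mu om : ℂ) * hankelDeriv n (kp la mu om * r) =
      scaledHankelDeriv (kp la mu om) n r / r := by
    simp only [scaledHankelDeriv]
    push_cast
    field_simp
  simp only [matA, (hasDerivAt_hankel n (mul_pos hs hr).ne').deriv,
    (hasDerivAt_hankel n (mul_pos hp hr).ne').deriv, hderiv]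
  rfl

theorem isUnit_matA : IsUnit (matA la mu om n r) := by
  have hrc : (r : ℂ) ≠ 0 := by exact_mod_cast hr.ne'
  have hs0 := scaledHankel_ne_zero hs n hr
  have hne := mul_ne_of_im_pos (scaledHankel_im_pos hs n hr) (scaledHankel_im_pos hp n hr)
    (sqrtDelta n)
  rw [Matrix.isUnit_iff_isUnit_det, isUnit_iff_ne_zero, matA_eq hp hs n hr, Matrix.det_fin_three]
  intro hdet
  simp only [Matrix.of_apply, Matrix.cons_val', Matrix.cons_val_zero, Matrix.cons_val_one,
    Matrix.cons_val] at hdet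
  field_simp at hdet
  refine hne (sub_eq_zero.mp ((mul_eq_zero.mp ?_).resolve_left hs0))
  linear_combination -hdet

end MatA

/-! ### Polynomials and smooth functions -/

/-- Polynomials in the three space variables. -/
abbrev Poly (R : Type*) [CommSemiring R] : Type _ := MvPolynomial (Fin 3) R

/-- Vector calculus of polynomials in three variables. -/
def polyCalc (R : Type*) [CommRing R] : VecCalc R (Poly R) where
  d := MvPolynomial.pderiv
  X := MvPolynomial.X
  d_X i j := by simp [Pi.single_apply, eq_comm]
  d_comm i j f := by
    have h : ⁅MvPolynomial.pderiv (R := R) i, MvPolynomial.pderiv (R := R) j⁆ = 0 := by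
      refine MvPolynomial.derivation_ext fun k => ?_
      simp only [Derivation.commutator_apply, MvPolynomial.pderiv_X, Pi.single_apply]
      split_ifs <;> simp
    simpa [Derivation.commutator_apply, sub_eq_zero] using DFunLike.congr_fun h f

lemma VecCalc.compat_aeval {R A : Type*} [CommRing R] [CommRing A] [Algebra R A]
    (T : VecCalc R A) : Compat (polyCalc R) T (MvPolynomial.aeval T.X) where
  X j := MvPolynomial.aeval_X T.X j
  d j f := by
    change MvPolynomial.aeval T.X (MvPolynomial.pderiv j f) = _
    induction f using MvPolynomial.induction_on with
    | C a =>
      rw [MvPolynomial.pderiv_C, map_zero, MvPolynomial.aeval_C, Derivation.map_algebraMap]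
    | add p q hp hq => simp only [map_add, hp, hq]
    | mul_X p i hp =>
      simp only [Derivation.leibniz, smul_eq_mul, map_add, map_mul, hp, MvPolynomial.aeval_X,
        MvPolynomial.pderiv_X, T.d_X, Pi.single_apply, eq_comm (a := i), apply_ite, map_one,
        map_zero]

/-- The algebra of smooth complex functions on `ℝ³`. -/
def SmoothFun : Subalgebra ℂ (E3 → ℂ) where
  carrier := {f | ContDiff ℝ ∞ f}
  mul_mem' {f g} hf hg := ContDiff.mul (𝕜 := ℝ) (n := ∞) (f := f) (g := g) hf hg
  add_mem' {f g} hf hg := ContDiff.add (𝕜 := ℝ) (n := ∞) (f := f) (g := g) hf hg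
  algebraMap_mem' c := contDiff_const (𝕜 := ℝ) (n := ∞) (c := c)

namespace SmoothFun

lemma contDiff (f : SmoothFun) : ContDiff ℝ ∞ f.1 := f.2

lemma continuous (f : SmoothFun) : Continuous f.1 := (contDiff f).continuous

lemma differentiable (f : SmoothFun) : Differentiable ℝ f.1 := (contDiff f).differentiable (by simp)

/-- The partial derivatives as derivations of the algebra of smooth functions. -/
def d (j : Fin 3) : Derivation ℂ SmoothFun SmoothFun where
  toFun f := ⟨pd j f.1, ((contDiff f).fderiv_right (m := ∞) (by simp)).clm_apply contDiff_const⟩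
  map_add' f g := by
    ext x
    exact DFunLike.congr_fun (fderiv_add (differentiable f x) (differentiable g x)) _
  map_smul' c f := by
    ext x
    exact DFunLike.congr_fun (fderiv_const_smul (differentiable f x) c) _
  map_one_eq_zero' := by
    ext x
    exact DFunLike.congr_fun (fderiv_const_apply (1 : ℂ)) _
  leibniz' f g := by
    ext x
    exact DFunLike.congr_fun (fderiv_mul (differentiable f x) (differentiable g x)) _

/-- The `j`-th coordinate function. -/
def X (j : Fin 3) : SmoothFun :=
  ⟨fun x => ((x j : ℝ) : ℂ),
    ((Complex.ofRealCLM.comp (EuclideanSpace.proj (𝕜 := ℝ) j)).contDiff : ContDiff ℝ ∞ _)⟩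

lemma X_apply (j : Fin 3) (x : E3) : (X j).1 x = ((x j : ℝ) : ℂ) := rfl

lemma d_X (i j : Fin 3) : d i (X j) = if i = j then 1 else 0 := by
  ext x
  have h := (Complex.ofRealCLM.comp (EuclideanSpace.proj (𝕜 := ℝ) j)).hasFDerivAt (x := x)
  change fderiv ℝ (Complex.ofRealCLM.comp (EuclideanSpace.proj (𝕜 := ℝ) j)) x _ = _
  rw [h.fderiv]
  rcases eq_or_ne i j with rfl | hij
  · simp
  · simp [hij, hij.symm]

lemma d_comm (i j : Fin 3) (f : SmoothFun) : d i (d j f) = d j (d i f) := by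
  ext x
  have hd : Differentiable ℝ (fderiv ℝ f.1) :=
    ((contDiff f).fderiv_right (m := ∞) (by simp)).differentiable (by simp)
  have h (a b : Fin 3) : pd a (pd b f.1) x = fderiv ℝ (fderiv ℝ f.1) x
      (EuclideanSpace.single a 1) (EuclideanSpace.single b 1) := by
    change fderiv ℝ (fun y => fderiv ℝ f.1 y _) x _ = _
    rw [fderiv_clm_apply (hd x) (differentiableAt_const _)]
    simp
  change pd i (pd j f.1) x = pd j (pd i f.1) x
  rw [h, h]
  exact ((contDiff f).contDiffAt.isSymmSndFDerivAt
    (by simpa using WithTop.coe_le_coe.mpr (le_top : (2 : ℕ∞) ≤ ⊤))) _ _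

end SmoothFun

/-- Vector calculus of smooth functions. -/
def smoothCalc : VecCalc ℂ SmoothFun where
  d := SmoothFun.d
  X := SmoothFun.X
  d_X := SmoothFun.d_X
  d_comm := SmoothFun.d_comm

/-- The smooth function defined by a polynomial. -/
def polyToSmooth : Poly ℂ →ₐ[ℂ] SmoothFun := MvPolynomial.aeval SmoothFun.X

lemma polyToSmooth_apply (p : Poly ℂ) (x : E3) :
    (polyToSmooth p).1 x = MvPolynomial.eval (fun i => ((x i : ℝ) : ℂ)) p := by
  have h : ((Pi.evalAlgHom ℂ (fun _ : E3 => ℂ) x).comp SmoothFun.val).comp polyToSmooth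
      = MvPolynomial.aeval fun i => ((x i : ℝ) : ℂ) := by
    ext i
    simp [polyToSmooth, SmoothFun.X]
  rw [← MvPolynomial.coe_aeval_eq_eval]
  exact DFunLike.congr_fun h p

lemma compat_polyToSmooth : VecCalc.Compat (polyCalc ℂ) smoothCalc polyToSmooth :=
  smoothCalc.compat_aeval

/-! ### Integrals over the unit sphere -/

/-- The unit sphere. -/
abbrev S2 : Type := Metric.sphere (0 : E3) 1

/-- The surface measure of the unit sphere. -/
abbrev sigma : Measure S2 := (volume : Measure E3).toSphere

lemma integrable_of_continuous {F : Type*} [NormedAddCommGroup F] {g : S2 → F}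
    (hg : Continuous g) : Integrable g sigma :=
  hg.integrable_of_hasCompactSupport (HasCompactSupport.of_compactSpace g)

lemma hasDerivAt_integral_sphere {G G' : ℝ → S2 → ℂ} (hG : ∀ t, Continuous (G t))
    (hG' : Continuous (Function.uncurry G'))
    (h : ∀ t y, HasDerivAt (fun s => G s y) (G' t y) t) (t : ℝ) :
    HasDerivAt (fun s => ∫ y, G s y ∂sigma) (∫ y, G' t y ∂sigma) t := by
  obtain ⟨C, hC⟩ := ((isCompact_closedBall t 1).prod
    (isCompact_univ (X := S2))).exists_bound_of_continuousOn hG'.continuousOn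
  exact (hasDerivAt_integral_of_dominated_loc_of_deriv_le (bound := fun _ => C)
    (Metric.closedBall_mem_nhds t one_pos)
    (.of_forall fun s => (hG s).aestronglyMeasurable) (integrable_of_continuous (hG t))
    (hG'.comp (by fun_prop : Continuous fun y : S2 => (t, y))).aestronglyMeasurable
    (.of_forall fun y s hs => hC (s, y) ⟨hs, Set.mem_univ _⟩) (integrable_const C)
    (.of_forall fun y s _ => h s y)).2

namespace SmoothFun

lemma continuous_sphere (f : SmoothFun) : Continuous fun y : S2 => f.1 y :=
  (continuous f).comp continuous_subtype_val

/-- The dilation `f ↦ f (r ·)`. -/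
def dilate (r : ℝ) : SmoothFun →ₐ[ℂ] SmoothFun where
  toFun f := ⟨fun x => f.1 (r • x), (contDiff f).comp (contDiff_const_smul r)⟩
  map_one' := rfl
  map_mul' _ _ := rfl
  map_zero' := rfl
  map_add' _ _ := rfl
  commutes' _ := rfl

lemma dilate_apply (r : ℝ) (f : SmoothFun) (x : E3) : (dilate r f).1 x = f.1 (r • x) := rfl

lemma dilate_X (r : ℝ) (j : Fin 3) : dilate r (X j) = (r : ℂ) • X j := by
  ext x
  simp [dilate_apply, X_apply]

lemma d_dilate (r : ℝ) (f : SmoothFun) (j : Fin 3) :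
    d j (dilate r f) = (r : ℂ) • dilate r (d j f) := by
  ext x
  have h := (differentiable f (r • x)).hasFDerivAt.comp x
    (r • ContinuousLinearMap.id ℝ E3).hasFDerivAt
  refine (DFunLike.congr_fun h.fderiv _).trans ?_
  change fderiv ℝ f.1 (r • x) (r • _) = (r : ℂ) * fderiv ℝ f.1 (r • x) _
  rw [map_smul, Complex.real_smul]
  rfl

lemma ang_dilate (r : ℝ) (f : SmoothFun) (j : Fin 3) :
    smoothCalc.ang j (dilate r f) = dilate r (smoothCalc.ang j f) := by
  simp [VecCalc.ang_apply, smoothCalc, d_dilate, dilate_X]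

lemma fderiv_eq_sum (f : SmoothFun) (x v : E3) :
    fderiv ℝ f.1 x v = ∑ j, (v j : ℂ) * (d j f).1 x := by
  have hv : v = ∑ j, v j • EuclideanSpace.single j (1 : ℝ) := by
    ext i
    fin_cases i <;> simp [Fin.sum_univ_three]
  conv_lhs => rw [hv, map_sum]
  simp only [map_smul, Complex.real_smul]
  rfl

lemma eul_eq_sum (f : SmoothFun) (x : E3) :
    (smoothCalc.eul f).1 x = ∑ j, (x j : ℂ) * (d j f).1 x := by
  rw [VecCalc.eul_apply, Fin.sum_univ_three, Fin.sum_univ_three]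
  rfl

lemma eul_eq_fderiv (f : SmoothFun) (x : E3) : (smoothCalc.eul f).1 x = fderiv ℝ f.1 x x := by
  rw [eul_eq_sum, fderiv_eq_sum]

end SmoothFun

/-- The integral over the unit sphere. -/
def sphereIntegral : SmoothFun →ₗ[ℂ] ℂ where
  toFun f := ∫ y : S2, f.1 y ∂sigma
  map_add' f g := integral_add (integrable_of_continuous (SmoothFun.continuous_sphere f))
    (integrable_of_continuous (SmoothFun.continuous_sphere g))
  map_smul' c _ := integral_const_mul c _

/-- The pairing `∫ f(r y) q(y)` over the unit sphere. For harmonic `q` it is a Fourier coefficient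
of the restriction of `f` to the sphere of radius `r`. -/
def spherePairing (r : ℝ) : SmoothFun →ₗ[ℂ] SmoothFun →ₗ[ℂ] ℂ :=
  ((LinearMap.mul ℂ SmoothFun).compr₂ sphereIntegral).comp (SmoothFun.dilate r).toLinearMap

lemma spherePairing_apply (r : ℝ) (f q : SmoothFun) :
    spherePairing r f q = ∫ y : S2, f.1 (r • (y : E3)) * q.1 y ∂sigma := rfl

lemma spherePairing_congr {f g p q : SmoothFun} {r s : ℝ}
    (h : ∀ y : S2, f.1 (r • (y : E3)) * p.1 y = g.1 (s • (y : E3)) * q.1 y) :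
    spherePairing r f p = spherePairing s g q :=
  integral_congr_ae (.of_forall h)

/-- The pairing `∫ v(r y) · w(y)` of vector fields over the unit sphere. -/
def fieldPairing (r : ℝ) : (Fin 3 → SmoothFun) →ₗ[ℂ] (Fin 3 → SmoothFun) →ₗ[ℂ] ℂ :=
  ∑ i, (spherePairing r).compl₁₂ (LinearMap.proj i) (LinearMap.proj i)

lemma fieldPairing_apply (r : ℝ) (v w : Fin 3 → SmoothFun) :
    fieldPairing r v w = ∑ i, spherePairing r (v i) (w i) := by
  simp [fieldPairing]

lemma hasDerivAt_spherePairing (f q : SmoothFun) {r : ℝ} (hr : r ≠ 0) :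
    HasDerivAt (fun s => spherePairing s f q) (spherePairing r (smoothCalc.eul f) q / r) r := by
  have hrad (t : ℝ) (y : S2) : HasDerivAt (fun s : ℝ => f.1 (s • (y : E3)) * q.1 y)
      ((∑ j, ((y : E3) j : ℂ) * (SmoothFun.d j f).1 (t • (y : E3))) * q.1 y) t := by
    rw [← SmoothFun.fderiv_eq_sum]
    have hl : HasDerivAt (fun s : ℝ => s • (y : E3)) (y : E3) t := by
      simpa using (hasDerivAt_id t).smul_const (y : E3)
    exact ((SmoothFun.differentiable f _).hasFDerivAt.comp_hasDerivAt t hl).mul_const _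
  have hcont (t : ℝ) : Continuous fun y : S2 => f.1 (t • (y : E3)) * q.1 y :=
    SmoothFun.continuous_sphere (SmoothFun.dilate t f * q)
  have hcont' : Continuous (Function.uncurry fun (t : ℝ) (y : S2) =>
      (∑ j, ((y : E3) j : ℂ) * (SmoothFun.d j f).1 (t • (y : E3))) * q.1 y) := by
    have hd (j : Fin 3) : Continuous fun z : ℝ × S2 => (SmoothFun.d j f).1 (z.1 • (z.2 : E3)) :=
      (SmoothFun.continuous _).comp (by fun_prop)
    have hq : Continuous fun z : ℝ × S2 => q.1 z.2 :=
      (SmoothFun.continuous_sphere q).comp continuous_snd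
    exact (continuous_finsetSum _ fun j _ => (by fun_prop : Continuous
      fun z : ℝ × S2 => (((z.2 : E3) j : ℝ) : ℂ)).mul (hd j)).mul hq
  refine (hasDerivAt_integral_sphere hcont hcont' hrad r).congr_deriv ?_
  rw [spherePairing_apply, ← integral_div]
  refine integral_congr_ae (.of_forall fun y => ?_)
  have hrc : (r : ℂ) ≠ 0 := by exact_mod_cast hr
  simp only [SmoothFun.eul_eq_sum, PiLp.smul_apply, smul_eq_mul, Complex.ofReal_mul, mul_assoc,
    ← Finset.mul_sum]
  field_simp

/-- The rotation by the angle `t` about the `j`-th coordinate axis, as a linear map. -/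
def rotLin (j : Fin 3) (t : ℝ) : E3 →ₗ[ℝ] E3 where
  toFun x := WithLp.toLp 2 fun i =>
    if i = j + 1 then Real.cos t * x (j + 1) - Real.sin t * x (j + 2)
    else if i = j + 2 then Real.sin t * x (j + 1) + Real.cos t * x (j + 2) else x i
  map_add' x y := by
    ext i
    simp only [PiLp.add_apply]
    split_ifs <;> ring
  map_smul' c x := by
    ext i
    simp only [PiLp.smul_apply, smul_eq_mul, RingHom.id_apply]
    split_ifs <;> ring

lemma norm_rotLin (j : Fin 3) (t : ℝ) (x : E3) : ‖rotLin j t x‖ = ‖x‖ := by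
  have h := Real.sin_sq_add_cos_sq t
  rw [EuclideanSpace.norm_eq, EuclideanSpace.norm_eq]
  congr 1
  simp only [Real.norm_eq_abs, sq_abs, Fin.sum_univ_three, rotLin, LinearMap.coe_mk, AddHom.coe_mk]
  fin_cases j <;> simp only [Fin.reduceFinMk, Fin.reduceAdd, Fin.reduceEq, if_true, if_false]
  · linear_combination (x 1 ^ 2 + x 2 ^ 2) * h
  · linear_combination (x 0 ^ 2 + x 2 ^ 2) * h
  · linear_combination (x 0 ^ 2 + x 1 ^ 2) * h

/-- The rotation by the angle `t` about the `j`-th coordinate axis, as an isometry. -/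
def rot (j : Fin 3) (t : ℝ) : E3 ≃ₗᵢ[ℝ] E3 :=
  LinearIsometry.toLinearIsometryEquiv ⟨rotLin j t, norm_rotLin j t⟩ rfl

lemma rotLin_zero (j : Fin 3) (x : E3) : rotLin j 0 x = x := by
  ext i
  simp only [rotLin, LinearMap.coe_mk, AddHom.coe_mk]
  split_ifs with h h' <;> simp [*]

lemma continuous_rotLin (j : Fin 3) : Continuous fun z : ℝ × S2 => rotLin j z.1 (z.2 : E3) := by
  refine (PiLp.continuous_toLp 2 _).comp (continuous_pi fun i => ?_)
  split_ifs <;> fun_prop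

lemma hasDerivAt_of_apply {n : ℕ} {c : ℝ → EuclideanSpace ℝ (Fin n)} {c' : EuclideanSpace ℝ (Fin n)}
    {t : ℝ} (h : ∀ i, HasDerivAt (fun s => c s i) (c' i) t) : HasDerivAt c c' t :=
  (PiLp.continuousLinearEquiv 2 ℝ fun _ : Fin n => ℝ).symm.toContinuousLinearMap
    |>.hasFDerivAt.comp_hasDerivAt t (hasDerivAt_pi.mpr h)

lemma hasDerivAt_rotLin (j : Fin 3) (x : E3) (t : ℝ) : HasDerivAt (fun s => rotLin j s x)
    (rotLin j t x (j + 1) • EuclideanSpace.single (j + 2) 1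
      - rotLin j t x (j + 2) • EuclideanSpace.single (j + 1) (1 : ℝ)) t := by
  refine hasDerivAt_of_apply fun i => ?_
  have hs := Real.hasDerivAt_sin t
  have hc := Real.hasDerivAt_cos t
  fin_cases j <;> fin_cases i <;>
  · simp only [rotLin, LinearMap.coe_mk, AddHom.coe_mk, Fin.isValue, Fin.zero_eta, Fin.mk_one,
      Fin.reduceFinMk, Fin.reduceAdd, zero_add, PiLp.sub_apply, PiLp.smul_apply, PiLp.single_apply,
      Fin.reduceEq, zero_ne_one, one_ne_zero, if_true, if_false, smul_eq_mul, mul_zero, mul_one,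
      sub_self, sub_zero, zero_sub]
    first
      | exact hasDerivAt_const _ _
      | exact ((hs.mul_const _).fun_add (hc.mul_const _)).congr_deriv (by ring)
      | exact ((hc.mul_const _).fun_sub (hs.mul_const _)).congr_deriv (by ring)

lemma hasDerivAt_comp_rotLin (f : SmoothFun) (j : Fin 3) (x : E3) (t : ℝ) :
    HasDerivAt (fun s => f.1 (rotLin j s x)) ((smoothCalc.ang j f).1 (rotLin j t x)) t := by
  refine ((SmoothFun.differentiable f _).hasFDerivAt.comp_hasDerivAt t
    (hasDerivAt_rotLin j x t)).congr_deriv ?_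
  rw [map_sub, map_smul, map_smul, Complex.real_smul, Complex.real_smul]
  rfl

/-- The action of an isometry on the unit sphere. -/
def sphereMap (T : E3 ≃ₗᵢ[ℝ] E3) : S2 ≃ₜ S2 where
  toFun y := ⟨T y, by simp⟩
  invFun y := ⟨T.symm y, by simp⟩
  left_inv y := by simp
  right_inv y := by simp

open scoped Pointwise in
lemma measurePreserving_sphereMap (T : E3 ≃ₗᵢ[ℝ] E3) :
    MeasurePreserving (sphereMap T) sigma sigma := by
  refine ⟨(sphereMap T).measurable, Measure.ext fun s hs => ?_⟩
  rw [Measure.map_apply (sphereMap T).measurable hs, Measure.toSphere_apply' _ hs,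
    Measure.toSphere_apply' _ ((sphereMap T).measurable hs),
    ← T.measurePreserving.measure_preimage_emb T.toHomeomorph.measurableEmbedding
      (Set.Ioo (0 : ℝ) 1 • (Subtype.val '' s : Set E3))]
  congr 2
  ext x
  simp only [Set.mem_smul, Set.mem_image, Set.mem_preimage]
  constructor
  · rintro ⟨a, ha, _, ⟨y, hy, rfl⟩, rfl⟩
    exact ⟨a, ha, _, ⟨sphereMap T y, hy, rfl⟩, by simp [sphereMap]⟩
  · rintro ⟨a, ha, _, ⟨y, hy, rfl⟩, hx⟩
    refine ⟨a, ha, _, ⟨(sphereMap T).symm y, by simpa using hy, rfl⟩, ?_⟩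
    simp [sphereMap, ← map_smul, hx]

lemma sphereIntegral_ang (j : Fin 3) (f : SmoothFun) :
    sphereIntegral (smoothCalc.ang j f) = 0 := by
  have hcont (t : ℝ) : Continuous fun y : S2 => f.1 (rotLin j t (y : E3)) :=
    (SmoothFun.continuous f).comp
      ((LinearMap.continuous_of_finiteDimensional (rotLin j t)).comp continuous_subtype_val)
  have hderiv := hasDerivAt_integral_sphere hcont
    (G' := fun t y => (smoothCalc.ang j f).1 (rotLin j t y))
    ((SmoothFun.continuous _).comp (continuous_rotLin j))
    (fun t y => hasDerivAt_comp_rotLin f j (y : E3) t) 0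
  have hconst (t : ℝ) : ∫ y : S2, f.1 (rotLin j t y) ∂sigma = ∫ y : S2, f.1 y ∂sigma :=
    (measurePreserving_sphereMap (rot j t)).integral_comp
      (sphereMap (rot j t)).measurableEmbedding (fun y : S2 => f.1 y)
  simp only [hconst, rotLin_zero] at hderiv
  exact hderiv.unique (hasDerivAt_const _ _)

lemma spherePairing_ang (j : Fin 3) (f q : SmoothFun) (r : ℝ) :
    spherePairing r (smoothCalc.ang j f) q
      = -spherePairing r f (smoothCalc.ang j q) := by
  have h := sphereIntegral_ang j (SmoothFun.dilate r f * q)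
  rw [Derivation.leibniz, SmoothFun.ang_dilate, map_add, smul_eq_mul, smul_eq_mul,
    mul_comm q] at h
  exact eq_neg_of_add_eq_zero_right h

lemma fieldPairing_toroidalField (r : ℝ) (v : Fin 3 → SmoothFun) (q : SmoothFun) :
    fieldPairing r v (smoothCalc.toroidalField q)
      = -spherePairing r (∑ j, smoothCalc.ang j (v j)) q := by
  rw [fieldPairing_apply, map_sum, LinearMap.sum_apply, ← Finset.sum_neg_distrib]
  exact Finset.sum_congr rfl fun j _ => by rw [spherePairing_ang, neg_neg]; rfl

/-! ### Harmonic polynomials -/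

section HarmonicPoly

variable {R : Type*} [CommRing R] {n : ℕ} {p : Poly R}

/-- Homogeneous harmonic polynomials of degree `n`. -/
def IsHarmonicPoly (n : ℕ) (p : Poly R) : Prop :=
  p.IsHomogeneous n ∧ (polyCalc R).lap p = 0

lemma polyCalc_eul (hp : p.IsHomogeneous n) : (polyCalc R).eul p = (n : R) • p := by
  rw [VecCalc.eul_apply, Nat.cast_smul_eq_nsmul]
  exact hp.sum_X_mul_pderiv

lemma isHomogeneous_ang (hp : p.IsHomogeneous n) (j : Fin 3) :
    ((polyCalc R).ang j p).IsHomogeneous n := by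
  have hX (a b : Fin 3) : (MvPolynomial.X a * MvPolynomial.pderiv b p).IsHomogeneous n := by
    rcases n with _ | n
    · rw [MvPolynomial.totalDegree_eq_zero_iff_eq_C.mp (Nat.le_zero.mp hp.totalDegree_le),
        MvPolynomial.pderiv_C, mul_zero]
      exact MvPolynomial.isHomogeneous_zero _ _ _
    · simpa [add_comm] using (MvPolynomial.isHomogeneous_X R a).mul (hp.pderiv (i := b))
  rw [VecCalc.ang_apply]
  exact (hX _ _).sub (hX _ _)

lemma IsHarmonicPoly.ang (hp : IsHarmonicPoly n p) (j : Fin 3) :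
    IsHarmonicPoly n ((polyCalc R).ang j p) :=
  ⟨isHomogeneous_ang hp.1 j, by rw [VecCalc.lap_ang, hp.2, map_zero]⟩

lemma IsHarmonicPoly.sum_ang_ang (hp : IsHarmonicPoly n p) :
    ∑ j, (polyCalc R).ang j ((polyCalc R).ang j p) = (-((n : R) * (n + 1))) • p := by
  have h := (polyCalc R).rsq_mul_lap p
  rw [hp.2, mul_zero, polyCalc_eul hp.1, Derivation.map_smul, polyCalc_eul hp.1] at h
  linear_combination (norm := module) -h

end HarmonicPoly

/-- The coefficientwise complex conjugate of a polynomial. -/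
def polyConj : Poly ℂ →+* Poly ℂ :=
  MvPolynomial.map (starRingEnd ℂ)

lemma polyToSmooth_polyConj (p : Poly ℂ) (x : E3) :
    (polyToSmooth (polyConj p)).1 x = conj ((polyToSmooth p).1 x) := by
  rw [polyToSmooth_apply, polyToSmooth_apply, polyConj, MvPolynomial.eval_map,
    MvPolynomial.eval₂_eq', MvPolynomial.eval_eq', map_sum]
  exact Finset.sum_congr rfl fun d _ => by simp

lemma polyConj_d (j : Fin 3) (p : Poly ℂ) :
    polyConj ((polyCalc ℂ).d j p) = (polyCalc ℂ).d j (polyConj p) := MvPolynomial.pderiv_map.symm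

lemma IsHarmonicPoly.polyConj {n : ℕ} {p : Poly ℂ} (hp : IsHarmonicPoly n p) :
    IsHarmonicPoly n (polyConj p) := by
  refine ⟨hp.1.map _, ?_⟩
  rw [VecCalc.lap_apply]
  simp only [← polyConj_d]
  rw [← map_sum, ← VecCalc.lap_apply, hp.2, map_zero]

lemma IsHarmonicPoly.smooth_sum_ang_ang {n : ℕ} {p : Poly ℂ}
    (hp : IsHarmonicPoly n p) :
    ∑ j, smoothCalc.ang j (smoothCalc.ang j (polyToSmooth p))
      = (-((n : ℂ) * (n + 1))) • polyToSmooth p := by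
  rw [← map_smul, ← hp.sum_ang_ang, map_sum]
  simp only [compat_polyToSmooth.ang]

/-! ### Fourier coefficients of radiating Helmholtz fields -/

lemma spherePairing_X_mul (a : Fin 3) (f q : SmoothFun) (r : ℝ) :
    spherePairing r (SmoothFun.X a * f) q = r * spherePairing r f (SmoothFun.X a * q) := by
  change sphereIntegral (SmoothFun.dilate r _ * q)
    = r * sphereIntegral (SmoothFun.dilate r f * (SmoothFun.X a * q))
  rw [map_mul (SmoothFun.dilate r), SmoothFun.dilate_X, smul_mul_assoc, smul_mul_assoc,
    map_smul, smul_eq_mul, mul_assoc, mul_left_comm (SmoothFun.X a)]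

lemma fieldPairing_radialField (v : Fin 3 → SmoothFun) (q : SmoothFun) (r : ℝ) :
    r * fieldPairing r v (smoothCalc.radialField q) = spherePairing r (smoothCalc.xdot v) q := by
  simp only [VecCalc.xdot, map_sum, LinearMap.sum_apply, Finset.mul_sum, fieldPairing_apply]
  exact Finset.sum_congr rfl fun j _ => (spherePairing_X_mul j _ _ r).symm

lemma fieldPairing_xcross (v w : Fin 3 → SmoothFun) (r : ℝ) :
    fieldPairing r (smoothCalc.xcrossₗ v) w = -(r * fieldPairing r v (smoothCalc.xcrossₗ w)) := by
  change fieldPairing r (smoothCalc.xcross v) w = -(r * fieldPairing r v (smoothCalc.xcross w))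
  simp only [fieldPairing_apply, VecCalc.xcross, smoothCalc, map_sub, LinearMap.sub_apply,
    Fin.sum_univ_three, spherePairing_X_mul, Fin.isValue, Fin.reduceAdd, zero_add]
  ring

lemma fieldPairing_toroidalField_toroidalField {n : ℕ} {p : Poly ℂ} (hp : IsHarmonicPoly n p)
    (f : SmoothFun) (r : ℝ) :
    fieldPairing r (smoothCalc.toroidalField f) (smoothCalc.toroidalField (polyToSmooth p))
      = (n : ℂ) * (n + 1) * spherePairing r f (polyToSmooth p) := by
  rw [fieldPairing_apply]
  change ∑ j, spherePairing r (smoothCalc.ang j f) (smoothCalc.ang j (polyToSmooth p)) = _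
  simp only [spherePairing_ang]
  rw [Finset.sum_neg_distrib, ← map_sum, hp.smooth_sum_ang_ang, map_smul, smul_eq_mul]
  ring

lemma norm_smul_sphere {r : ℝ} (hr : 0 ≤ r) (y : S2) : ‖r • (y : E3)‖ = r := by
  rw [norm_smul, norm_eq_of_mem_sphere, mul_one, Real.norm_of_nonneg hr]

lemma rsq_apply (x : E3) : (smoothCalc.rsq).1 x = ((‖x‖ ^ 2 : ℝ) : ℂ) := by
  rw [EuclideanSpace.norm_sq_eq]
  simp only [VecCalc.rsq, Fin.sum_univ_three, Real.norm_eq_abs, sq_abs]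
  push_cast
  rfl

/-- The Helmholtz equation `Δ f + k² f = 0` in `|x| > a`. -/
def IsHelmholtz (k a : ℝ) (f : SmoothFun) : Prop :=
  ∀ x : E3, a < ‖x‖ → (smoothCalc.lap f).1 x = -(k : ℂ) ^ 2 * f.1 x

lemma isBessel_spherePairing {k a : ℝ} (ha : 0 ≤ a) {f : SmoothFun} (hf : IsHelmholtz k a f)
    {n : ℕ} {p : Poly ℂ} (hp : IsHarmonicPoly n p) :
    IsBessel k n a (fun r => spherePairing r f (polyToSmooth p))
      (fun r => spherePairing r (smoothCalc.eul f) (polyToSmooth p)) := by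
  intro r hr
  have hr0 : 0 < r := ha.trans_lt hr
  refine ⟨hasDerivAt_spherePairing f _ hr0.ne',
    (hasDerivAt_spherePairing _ _ hr0.ne').congr_deriv ?_⟩
  congr 1
  have hlap : spherePairing r (smoothCalc.rsq * smoothCalc.lap f) (polyToSmooth p)
      = -(k : ℂ) ^ 2 * r ^ 2 * spherePairing r f (polyToSmooth p) := by
    trans spherePairing r ((-(k : ℂ) ^ 2 * r ^ 2) • f) (polyToSmooth p)
    · refine spherePairing_congr fun y => congrArg (· * _) ?_
      change (smoothCalc.rsq).1 _ * (smoothCalc.lap f).1 _ = _ * f.1 _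
      rw [rsq_apply, norm_smul_sphere hr0.le, hf _ (by rwa [norm_smul_sphere hr0.le])]
      push_cast
      ring
    · rw [map_smul, LinearMap.smul_apply, smul_eq_mul]
  have hang : spherePairing r (∑ j, smoothCalc.ang j (smoothCalc.ang j f)) (polyToSmooth p)
      = -((n : ℂ) * (n + 1)) * spherePairing r f (polyToSmooth p) := by
    rw [neg_mul, ← fieldPairing_toroidalField_toroidalField hp, fieldPairing_toroidalField, neg_neg]
    rfl
  rw [VecCalc.rsq_mul_lap, map_add, map_add, LinearMap.add_apply, LinearMap.add_apply, hang] at hlap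
  linear_combination hlap

lemma tendsto_integral_of_tendsto_cobounded {g : E3 → ℂ} (hg : Continuous g)
    (h : Tendsto g (Bornology.cobounded E3) (𝓝 0)) {q : S2 → ℂ} (hq : Continuous q) :
    Tendsto (fun r : ℝ => ∫ y : S2, g (r • (y : E3)) * q y ∂sigma) atTop (𝓝 0) := by
  have hray (y : S2) : Tendsto (fun r : ℝ => r • (y : E3)) atTop (Bornology.cobounded E3) := by
    rw [← tendsto_norm_atTop_iff_cobounded]
    refine tendsto_id.congr' ?_
    filter_upwards [eventually_ge_atTop 0] with r hr using (norm_smul_sphere hr y).symm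
  have hbound : ∀ᶠ r : ℝ in atTop, ∀ y : S2, ‖g (r • (y : E3))‖ ≤ 1 := by
    have h1 := (tendsto_zero_iff_norm_tendsto_zero.mp h).eventually_le_const one_pos
    rw [← comap_norm_atTop, eventually_comap] at h1
    filter_upwards [h1, eventually_ge_atTop 0] with r hr hr0 y using hr _ (norm_smul_sphere hr0 y)
  have key := tendsto_integral_filter_of_dominated_convergence (μ := sigma) (l := atTop)
    (F := fun (r : ℝ) (y : S2) => g (r • (y : E3)) * q y) (f := fun y => 0 * q y) (fun y => ‖q y‖)
    (.of_forall fun r => ((hg.comp (by fun_prop)).mul hq).aestronglyMeasurable)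
    (hbound.mono fun r hr => .of_forall fun y => by
      rw [norm_mul]
      exact mul_le_of_le_one_left (norm_nonneg _) (hr y))
    (integrable_of_continuous hq.norm) (.of_forall fun y => (h.comp (hray y)).mul_const _)
  simpa only [zero_mul, integral_zero] using key

/-- The outgoing condition `x · ∇ f - i k |x| f → 0` for a smooth function. -/
def IsRadiating (k : ℝ) (f : SmoothFun) : Prop :=
  Tendsto (fun x : E3 => (smoothCalc.eul f).1 x - Complex.I * ((k * ‖x‖ : ℝ) : ℂ) * f.1 x)
    (Bornology.cobounded E3) (𝓝 0)

lemma IsRadiating.tendsto_spherePairing {k : ℝ} {f : SmoothFun} (h : IsRadiating k f)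
    (q : SmoothFun) :
    Tendsto (fun r : ℝ => spherePairing r (smoothCalc.eul f) q
      - Complex.I * ((k * r : ℝ) : ℂ) * spherePairing r f q) atTop (𝓝 0) := by
  have hcont : Continuous fun x : E3 =>
      (smoothCalc.eul f).1 x - Complex.I * ((k * ‖x‖ : ℝ) : ℂ) * f.1 x := by
    have h1 := SmoothFun.continuous f
    have h2 := SmoothFun.continuous (smoothCalc.eul f)
    fun_prop
  refine (tendsto_integral_of_tendsto_cobounded hcont h (SmoothFun.continuous_sphere q)).congr' ?_
  filter_upwards [eventually_ge_atTop 0] with r hr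
  rw [spherePairing_apply, spherePairing_apply, ← integral_const_mul, ← integral_sub]
  · refine integral_congr_ae (.of_forall fun y => ?_)
    simp only [norm_smul_sphere hr]
    ring
  · exact integrable_of_continuous (SmoothFun.continuous_sphere
      (SmoothFun.dilate r (smoothCalc.eul f) * q))
  · exact (integrable_of_continuous
      (SmoothFun.continuous_sphere (SmoothFun.dilate r f * q))).const_mul _

section FourierCoefficients

variable {k a : ℝ} (hk : 0 < k) (ha : 0 ≤ a)

include hk ha

lemma exists_spherePairing_eq_scaledHankel {f : SmoothFun} (hf : IsHelmholtz k a f)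
    (hrad : IsRadiating k f) {n : ℕ} {p : Poly ℂ} (hp : IsHarmonicPoly n p) :
    ∃ α : ℂ, ∀ r, a < r → spherePairing r f (polyToSmooth p) = α * scaledHankel k n r := by
  obtain ⟨α, h⟩ := (isBessel_spherePairing ha hf hp).eq_scaledHankel_of_radiating hk ha
    (hrad.tendsto_spherePairing _)
  exact ⟨α, fun r hr => (h r hr).1⟩

lemma IsBessel.tendsto_radiating_of_combination {n : ℕ} {F F1 P Q : ℝ → ℂ}
    (hF : IsBessel k n a F F1) (hP : ∀ r, a < r → HasDerivAt P (Q r / r) r) (c : ℂ)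
    (hPF : ∀ r, a < r → r * P r = F1 r + c * F r)
    (hrad : Tendsto (fun r : ℝ => Q r - Complex.I * ((k * r : ℝ) : ℂ) * P r) atTop (𝓝 0)) :
    Tendsto (fun r : ℝ => F1 r - Complex.I * ((k * r : ℝ) : ℂ) * F r) atTop (𝓝 0) := by
  obtain ⟨hF0, hF1⟩ := hF.tendsto_zero hk ha
  have hkc : (k : ℂ) ≠ 0 := by exact_mod_cast hk.ne'
  have hlim := (((hrad.sub (hF1.const_mul (c - 2))).sub
    ((hF0.mul tendsto_ofReal_inv).const_mul ((n : ℂ) * (n + 1) - c))).const_mul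
      (Complex.I / k)).sub (hF0.const_mul c)
  simp only [mul_zero, sub_zero] at hlim
  refine hlim.congr' ?_
  filter_upwards [eventually_gt_atTop a] with r hr
  have hrc : (r : ℂ) ≠ 0 := by exact_mod_cast (ha.trans_lt hr).ne'
  -- Differentiating `r P = F₁ + c F` and inserting the Bessel equation for `F₁'`.
  have hQ : r * Q r = (c - 2) * F1 r + ((n : ℂ) * (n + 1) - c - (k : ℂ) ^ 2 * r ^ 2) * F r := by
    have hleft := (Complex.ofRealCLM.hasDerivAt (x := r)).fun_mul (hP r hr)
    have hright := (hF r hr).2.fun_add ((hF r hr).1.const_mul c)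
    have heq : (fun s : ℝ => Complex.ofRealCLM s * P s) =ᶠ[𝓝 r] fun s => F1 s + c * F s := by
      filter_upwards [lt_mem_nhds hr] with s hs using hPF s hs
    have h := hleft.unique (hright.congr_of_eventuallyEq heq)
    simp only [Complex.ofRealCLM_apply, Complex.ofReal_one] at h
    field_simp at h
    linear_combination h - hPF r hr
  have hPr : P r = (F1 r + c * F r) / r := by rw [← hPF r hr]; field_simp
  have hQr : Q r = _ / r := (eq_div_iff hrc).mpr ((mul_comm _ _).trans hQ)
  rw [hPr, hQr]
  push_cast
  field_simp
  ring_nf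
  simp only [Complex.I_sq]
  ring

lemma exists_spherePairing_eq_of_combination {f : SmoothFun} (hf : IsHelmholtz k a f)
    {v w : Fin 3 → SmoothFun} (hv : ∀ j, IsRadiating k (v j))
    {n : ℕ} {p : Poly ℂ} (hp : IsHarmonicPoly n p) (c : ℂ)
    (hvw : ∀ r : ℝ, r * fieldPairing r v w
      = spherePairing r (smoothCalc.eul f) (polyToSmooth p)
        + c * spherePairing r f (polyToSmooth p)) :
    ∃ α : ℂ, ∀ r, a < r → spherePairing r f (polyToSmooth p) = α * scaledHankel k n r ∧
      spherePairing r (smoothCalc.eul f) (polyToSmooth p) = α * scaledHankelDeriv k n r := by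
  have hB := isBessel_spherePairing ha hf hp
  refine hB.eq_scaledHankel_of_radiating hk ha
    (hB.tendsto_radiating_of_combination hk ha (P := fun r => fieldPairing r v w)
      (Q := fun r => fieldPairing r (fun j => smoothCalc.eul (v j)) w)
      (fun r hr => ?_) c (fun r _ => hvw r) ?_)
  · simp only [fieldPairing_apply, Finset.sum_div]
    exact HasDerivAt.fun_sum fun j _ => hasDerivAt_spherePairing _ _ (ha.trans_lt hr).ne'
  · simp only [fieldPairing_apply, Finset.mul_sum, ← Finset.sum_sub_distrib]
    simpa using tendsto_finsetSum Finset.univ fun j _ => (hv j).tendsto_spherePairing (w j)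

lemma exists_spherePairing_eq_of_radiating_grad {f : SmoothFun} (hf : IsHelmholtz k a f)
    (hrad : ∀ j, IsRadiating k (SmoothFun.d j f)) {n : ℕ} {p : Poly ℂ}
    (hp : IsHarmonicPoly n p) :
    ∃ α : ℂ, ∀ r, a < r → spherePairing r f (polyToSmooth p) = α * scaledHankel k n r ∧
      spherePairing r (smoothCalc.eul f) (polyToSmooth p) = α * scaledHankelDeriv k n r := by
  refine exists_spherePairing_eq_of_combination hk ha hf
    (w := smoothCalc.radialField (polyToSmooth p)) hrad hp 0 fun r => ?_
  rw [zero_mul, add_zero, fieldPairing_radialField, VecCalc.eul_apply]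
  rfl

omit hk ha in
lemma fieldPairing_tangentField {v : Fin 3 → SmoothFun} (hdiv : smoothCalc.div v = 0)
    (q : SmoothFun) (r : ℝ) :
    r * fieldPairing r v (-smoothCalc.tangentField q)
      = spherePairing r (smoothCalc.eul (smoothCalc.xdot v)) q
        + 1 * spherePairing r (smoothCalc.xdot v) q := by
  have hang : ∑ j, smoothCalc.ang j (smoothCalc.xcrossₗ v j)
      = -smoothCalc.xdot v - smoothCalc.eul (smoothCalc.xdot v) := by
    change ∑ j, smoothCalc.ang j (smoothCalc.xcross v j) = _
    rw [VecCalc.sum_ang_xcross, hdiv]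
    ring
  rw [map_neg, mul_neg, VecCalc.tangentField, LinearMap.comp_apply, ← fieldPairing_xcross,
    fieldPairing_toroidalField, hang]
  simp only [map_sub, map_neg, LinearMap.sub_apply, LinearMap.neg_apply]
  ring

lemma exists_spherePairing_xdot_eq {v : Fin 3 → SmoothFun} (hv : ∀ j, IsHelmholtz k a (v j))
    (hdiv : smoothCalc.div v = 0) (hrad : ∀ j, IsRadiating k (v j)) {n : ℕ}
    {p : Poly ℂ} (hp : IsHarmonicPoly n p) :
    ∃ α : ℂ, ∀ r, a < r →
      spherePairing r (smoothCalc.xdot v) (polyToSmooth p) = α * scaledHankel k n r ∧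
      spherePairing r (smoothCalc.eul (smoothCalc.xdot v)) (polyToSmooth p)
        = α * scaledHankelDeriv k n r := by
  have hX : IsHelmholtz k a (smoothCalc.xdot v) := by
    intro x hx
    rw [VecCalc.lap_xdot, hdiv, mul_zero, add_zero]
    simp only [VecCalc.xdot, Fin.sum_univ_three]
    change (SmoothFun.X 0).1 x * (smoothCalc.lap (v 0)).1 x
      + (SmoothFun.X 1).1 x * (smoothCalc.lap (v 1)).1 x
      + (SmoothFun.X 2).1 x * (smoothCalc.lap (v 2)).1 x = _ * ((SmoothFun.X 0).1 x * (v 0).1 x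
      + (SmoothFun.X 1).1 x * (v 1).1 x + (SmoothFun.X 2).1 x * (v 2).1 x)
    rw [hv 0 x hx, hv 1 x hx, hv 2 x hx]
    ring
  exact exists_spherePairing_eq_of_combination hk ha hX hrad hp 1
    (fieldPairing_tangentField hdiv _)

end FourierCoefficients

/-! ### Polynomial fields generated by harmonic polynomials -/

section HarmonicSpan

variable {K : Type*} [Field K]

/-- The homogeneous harmonic polynomials of degree `n`, as a submodule. -/
def harmonicPolys (K : Type*) [Field K] (n : ℕ) : Submodule K (Poly K) :=
  MvPolynomial.homogeneousSubmodule (Fin 3) K n ⊓ LinearMap.ker (polyCalc K).lap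

/-- The span of the products `|x|²ˢ h` of total degree `n` with `h` a homogeneous harmonic
polynomial. -/
def harmonicSpan (K : Type*) [Field K] (n : ℕ) : Submodule K (Poly K) :=
  Submodule.span K {q | ∃ s m h, 2 * s + m = n ∧ IsHarmonicPoly m h ∧ q = (polyCalc K).rsq ^ s * h}

lemma isHomogeneous_rsq : ((polyCalc K).rsq).IsHomogeneous 2 :=
  MvPolynomial.IsHomogeneous.sum _ _ _ fun i _ => MvPolynomial.isHomogeneous_X_pow i 2

lemma isHomogeneous_lap {n : ℕ} {p : Poly K} (hp : p.IsHomogeneous n) :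
    ((polyCalc K).lap p).IsHomogeneous (n - 2) := by
  rw [VecCalc.lap_apply]
  exact MvPolynomial.IsHomogeneous.sum _ _ _ fun _ _ => hp.pderiv.pderiv

lemma d_eq_zero_of_isHomogeneous_zero {p : Poly K} (hp : p.IsHomogeneous 0) (i : Fin 3) :
    (polyCalc K).d i p = 0 := by
  rw [MvPolynomial.totalDegree_eq_zero_iff_eq_C.mp (Nat.le_zero.mp hp.totalDegree_le)]
  exact MvPolynomial.pderiv_C

lemma lap_rsq_pow_succ_mul {m : ℕ} {h : Poly K} (hh : IsHarmonicPoly m h) (s : ℕ) :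
    (polyCalc K).lap ((polyCalc K).rsq ^ (s + 1) * h)
      = ((2 * (s + 1) * (2 * s + 2 * m + 3) : ℕ) : K) • ((polyCalc K).rsq ^ s * h) := by
  induction s with
  | zero =>
    rw [zero_add, pow_one, VecCalc.lap_rsq_mul, hh.2, polyCalc_eul hh.1]
    simp only [MvPolynomial.smul_eq_C_mul]
    push_cast
    simp only [map_add, map_mul, map_ofNat, map_zero]
    ring
  | succ s ih =>
    have hom : ((polyCalc K).rsq ^ (s + 1) * h).IsHomogeneous (2 * (s + 1) + m) :=
      (isHomogeneous_rsq.pow (s + 1)).mul hh.1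
    rw [pow_succ', mul_assoc, VecCalc.lap_rsq_mul, ih, polyCalc_eul hom]
    simp only [MvPolynomial.smul_eq_C_mul]
    push_cast
    simp only [map_add, map_mul, map_one, map_ofNat]
    ring

lemma harmonicSpan_le_homogeneousSubmodule (n : ℕ) :
    harmonicSpan K n ≤ MvPolynomial.homogeneousSubmodule (Fin 3) K n := by
  rw [harmonicSpan, Submodule.span_le]
  rintro _ ⟨s, m, h, rfl, hh, rfl⟩
  exact (isHomogeneous_rsq.pow s).mul hh.1

lemma isHomogeneous_curl {m : ℕ} {F : Fin 3 → Poly K} (hF : ∀ j, (F j).IsHomogeneous m)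
    (j : Fin 3) :
    ((polyCalc K).curl F j).IsHomogeneous (m - 1) :=
  (hF _).pderiv.sub (hF _).pderiv

lemma curl_eq_zero_of_isHomogeneous_zero {F : Fin 3 → Poly K} (hF : ∀ j, (F j).IsHomogeneous 0) :
    (polyCalc K).curl F = 0 := by
  ext1 j
  rw [VecCalc.curl, d_eq_zero_of_isHomogeneous_zero (hF _),
    d_eq_zero_of_isHomogeneous_zero (hF _), sub_zero, Pi.zero_apply]

lemma grad_xdot_sub_xcross_curl {m : ℕ} {F : Fin 3 → Poly K} (hF : ∀ j, (F j).IsHomogeneous m) :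
    (fun j => (polyCalc K).d j ((polyCalc K).xdot F)) - (polyCalc K).xcrossₗ ((polyCalc K).curl F)
      = ((m + 1 : ℕ) : K) • F := by
  ext1 j
  change (polyCalc K).d j _ - (polyCalc K).xcross ((polyCalc K).curl F) j = _
  rw [VecCalc.d_xdot, polyCalc_eul (hF j), Pi.smul_apply, Nat.cast_succ, add_smul, one_smul]
  ring

lemma toroidalField_xdot_sub {m : ℕ} {F : Fin 3 → Poly K} (hF : ∀ j, (F j).IsHomogeneous m) :
    (polyCalc K).toroidalField ((polyCalc K).xdot F)
        - ((polyCalc K).radialField ((polyCalc K).xdot ((polyCalc K).curl F))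
          - (polyCalc K).rsq • (polyCalc K).curl F)
      = ((m + 1 : ℕ) : K) • (polyCalc K).xcrossₗ F := by
  rw [← map_smul, ← grad_xdot_sub_xcross_curl hF, map_sub, VecCalc.xcrossₗ_grad,
    VecCalc.xcrossₗ_xcrossₗ]

variable [CharZero K]

lemma harmonicSpan_le_map_lap (n : ℕ) :
    harmonicSpan K n ≤ (harmonicSpan K (n + 2)).map (polyCalc K).lap := by
  refine Submodule.span_le.mpr ?_
  rintro _ ⟨s, m, h, rfl, hh, rfl⟩
  refine ⟨((2 * (s + 1) * (2 * s + 2 * m + 3) : ℕ) : K)⁻¹ • ((polyCalc K).rsq ^ (s + 1) * h),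
    Submodule.smul_mem _ _ (Submodule.subset_span ⟨s + 1, m, h, by ring, hh, rfl⟩), ?_⟩
  rw [map_smul, lap_rsq_pow_succ_mul hh, smul_smul, inv_mul_cancel₀, one_smul]
  exact Nat.cast_ne_zero.mpr (by positivity)

lemma mem_harmonicSpan {n : ℕ} {p : Poly K} (hp : p.IsHomogeneous n) : p ∈ harmonicSpan K n := by
  have hharm (n : ℕ) {q : Poly K} (hq : IsHarmonicPoly n q) : q ∈ harmonicSpan K n :=
    Submodule.subset_span ⟨0, n, q, by simp, hq, by simp⟩
  induction n using Nat.strong_induction_on generalizing p with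
  | _ n ih =>
    rcases Nat.lt_or_ge n 2 with hn | hn
    · refine hharm n ⟨hp, ?_⟩
      rw [VecCalc.lap_apply]
      refine Finset.sum_eq_zero fun j _ => d_eq_zero_of_isHomogeneous_zero ?_ j
      have hd : ((polyCalc K).d j p).IsHomogeneous (n - 1) := hp.pderiv
      rwa [show n - 1 = 0 by omega] at hd
    · obtain ⟨q, hq, hqp⟩ := harmonicSpan_le_map_lap _
        (ih (n - 2) (by omega) (isHomogeneous_lap hp))
      rw [Nat.sub_add_cancel hn] at hq
      rw [← sub_add_cancel p q]
      refine Submodule.add_mem _ (hharm n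
        ⟨hp.sub (harmonicSpan_le_homogeneousSubmodule n hq), ?_⟩) hq
      rw [map_sub, hqp, sub_self]

section Fields

variable {N : Submodule K (Fin 3 → Poly K)}
  (hrsq : ∀ w : Fin 3 → Poly K, (polyCalc K).rsq • w ∈ N ↔ w ∈ N)

include hrsq

lemma map_mem_of_forall_isHarmonicPoly {Φ : Poly K →ₗ[K] (Fin 3 → Poly K)}
    (hΦ : ∀ q, Φ ((polyCalc K).rsq * q) = (polyCalc K).rsq • Φ q)
    (hN : ∀ n h, IsHarmonicPoly n h → Φ h ∈ N) (q : Poly K) : Φ q ∈ N := by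
  rw [← MvPolynomial.sum_homogeneousComponent q, map_sum]
  refine Submodule.sum_mem _ fun n _ => ?_
  suffices harmonicSpan K n ≤ N.comap Φ from
    this (mem_harmonicSpan (MvPolynomial.homogeneousComponent_isHomogeneous n q))
  refine Submodule.span_le.mpr ?_
  rintro _ ⟨s, m, h, -, hh, rfl⟩
  change Φ _ ∈ N
  induction s with
  | zero => simpa using hN m h hh
  | succ s ih => rwa [pow_succ', mul_assoc, hΦ, hrsq]

lemma xcross_curl_mem (hW : ∀ q, (polyCalc K).radialField q ∈ N)
    (hV : ∀ q, (polyCalc K).toroidalField q ∈ N) {l : ℕ} {E : Fin 3 → Poly K}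
    (hE : ∀ j, (E j).IsHomogeneous l) (hEE : (polyCalc K).curl ((polyCalc K).curl E) ∈ N) :
    (polyCalc K).xcrossₗ ((polyCalc K).curl E) ∈ N := by
  rcases l with _ | m
  · rw [curl_eq_zero_of_isHomogeneous_zero hE, map_zero]
    exact zero_mem N
  · rw [← Submodule.smul_mem_iff N (Nat.cast_ne_zero.mpr m.succ_ne_zero : ((m + 1 : ℕ) : K) ≠ 0),
      ← toroidalField_xdot_sub (m := m) (isHomogeneous_curl hE)]
    exact sub_mem (hV _) (sub_mem (hW _) ((hrsq _).mpr hEE))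

lemma mem_of_isHomogeneous (hW : ∀ q, (polyCalc K).radialField q ∈ N)
    (hV : ∀ q, (polyCalc K).toroidalField q ∈ N) (hU : ∀ q, (polyCalc K).tangentField q ∈ N)
    {l : ℕ} {E : Fin 3 → Poly K} (hE : ∀ j, (E j).IsHomogeneous l) : E ∈ N := by
  induction l using Nat.strong_induction_on generalizing E with
  | _ l ih =>
    have hEE : (polyCalc K).curl ((polyCalc K).curl E) ∈ N := by
      have hcurl := isHomogeneous_curl hE
      rcases Nat.lt_or_ge l 2 with hl | hl
      · rw [show l - 1 = 0 by omega] at hcurl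
        rw [curl_eq_zero_of_isHomogeneous_zero hcurl]
        exact zero_mem N
      · exact ih (l - 1 - 1) (by omega) (isHomogeneous_curl hcurl)
    rw [← Submodule.smul_mem_iff N (Nat.cast_ne_zero.mpr l.succ_ne_zero : ((l + 1 : ℕ) : K) ≠ 0),
      ← grad_xdot_sub_xcross_curl hE]
    refine sub_mem ((hrsq _).mp ?_) (xcross_curl_mem hrsq hW hV hE hEE)
    rw [VecCalc.rsq_smul_grad]
    exact sub_mem (hW _) (hU _)

theorem eq_top_of_harmonic_fields
    (hW : ∀ n h, IsHarmonicPoly n h → (polyCalc K).radialField h ∈ N)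
    (hV : ∀ n h, IsHarmonicPoly n h → (polyCalc K).toroidalField h ∈ N)
    (hU : ∀ n h, IsHarmonicPoly n h → (polyCalc K).tangentField h ∈ N) : N = ⊤ := by
  replace hW := map_mem_of_forall_isHarmonicPoly hrsq (VecCalc.radialField_rsq_mul _) hW
  replace hV := map_mem_of_forall_isHarmonicPoly hrsq (VecCalc.toroidalField_rsq_mul _) hV
  replace hU := map_mem_of_forall_isHarmonicPoly hrsq (VecCalc.tangentField_rsq_mul _) hU
  refine eq_top_iff.mpr fun E _ => ?_
  have hE : E = ∑ l ∈ Finset.range (∑ j, (E j).totalDegree + 1),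
      fun j => MvPolynomial.homogeneousComponent l (E j) := by
    ext1 j
    rw [Finset.sum_apply]
    conv_lhs => rw [← MvPolynomial.sum_homogeneousComponent (E j)]
    refine Finset.sum_subset (Finset.range_subset_range.mpr <| Nat.succ_le_succ <|
      Finset.single_le_sum (f := fun j => (E j).totalDegree) (fun _ _ => Nat.zero_le _)
        (Finset.mem_univ j)) fun l _ hl => ?_
    exact MvPolynomial.homogeneousComponent_eq_zero _ _ (by simpa using hl)
  rw [hE]
  exact sum_mem fun l _ => mem_of_isHomogeneous hrsq hW hV hU fun j =>
    MvPolynomial.homogeneousComponent_isHomogeneous l _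

end Fields

/-! ### The dimension of the space of harmonic polynomials -/

lemma eq_zero_of_lap_eq_zero {p : Poly K} (hp : (polyCalc K).lap p = 0)
    (h : ∀ m : Fin 3 →₀ ℕ, m 0 < 2 → p.coeff m = 0) : p = 0 := by
  ext m
  rw [MvPolynomial.coeff_zero]
  induction hm : m 0 using Nat.strong_induction_on generalizing m with
  | _ a ih =>
    rcases Nat.lt_or_ge a 2 with ha | ha
    · exact h m (hm ▸ ha)
    obtain ⟨m, rfl⟩ : ∃ m' : Fin 3 →₀ ℕ, m = m' + Finsupp.single 0 1 + Finsupp.single 0 1 := by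
      refine ⟨m - Finsupp.single 0 2, ?_⟩
      rw [add_assoc, ← Finsupp.single_add, tsub_add_cancel_of_le]
      exact Finsupp.single_le_iff.mpr (hm ▸ ha)
    have h0 : m 0 + 1 + 1 = a := by simpa using hm
    have hcoeff := congrArg (MvPolynomial.coeff m) hp
    simp only [VecCalc.lap_apply, polyCalc, Fin.sum_univ_three, MvPolynomial.coeff_add,
      MvPolynomial.coeff_pderiv, MvPolynomial.coeff_zero] at hcoeff
    -- On harmonic polynomials `∂₁² = -(∂₂² + ∂₃²)`, which lowers the degree in the first variable.
    rw [ih (m 0) (by omega) (m + Finsupp.single 1 1 + Finsupp.single 1 1) (by simp),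
      ih (m 0) (by omega) (m + Finsupp.single 2 1 + Finsupp.single 2 1) (by simp)] at hcoeff
    have h2 : (m 0 : K) + 1 + 1 ≠ 0 := by exact_mod_cast Nat.succ_ne_zero (m 0 + 1)
    simpa [Nat.cast_add_one_ne_zero, h2] using hcoeff

omit [CharZero K] in
/-- The coefficients of the monomials of degree `n` that have degree at most one in the first
variable. -/
def harmonicCoeffs (n : ℕ) : harmonicPolys K n →ₗ[K] (Fin (n + 1) → K) × (Fin n → K) :=
  let coeffs (a k : ℕ) : Poly K →ₗ[K] (Fin k → K) :=
    LinearMap.pi fun b => MvPolynomial.lcoeff K (Finsupp.equivFunOnFinite.symm ![a, b, n - a - b])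
  ((coeffs 0 (n + 1)).prod (coeffs 1 n)) ∘ₗ (harmonicPolys K n).subtype

lemma harmonicCoeffs_injective (n : ℕ) :
    Function.Injective (harmonicCoeffs (K := K) n) := by
  rw [injective_iff_map_eq_zero]
  rintro ⟨p, hp⟩ h
  obtain ⟨h0, h1⟩ := Prod.ext_iff.mp h
  refine Subtype.ext (eq_zero_of_lap_eq_zero hp.2 fun m hm => ?_)
  by_cases hdeg : m 0 + m 1 + m 2 = n
  · obtain hm0 | hm0 : m 0 = 0 ∨ m 0 = 1 := by omega
    · rw [← show Finsupp.equivFunOnFinite.symm ![0, m 1, n - 0 - m 1] = m by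
        ext i; fin_cases i <;> simp <;> omega]
      exact congrFun h0 ⟨m 1, by omega⟩
    · rw [← show Finsupp.equivFunOnFinite.symm ![1, m 1, n - 1 - m 1] = m by
        ext i; fin_cases i <;> simp <;> omega]
      exact congrFun h1 ⟨m 1, by omega⟩
  · refine MvPolynomial.IsHomogeneous.coeff_eq_zero hp.1 fun hd => hdeg ?_
    rwa [Finsupp.degree_eq_sum, Fin.sum_univ_three] at hd

instance (n : ℕ) : FiniteDimensional K (harmonicPolys K n) :=
  FiniteDimensional.of_injective (harmonicCoeffs n) (harmonicCoeffs_injective n)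

lemma finrank_harmonicPolys_le (n : ℕ) : Module.finrank K (harmonicPolys K n) ≤ 2 * n + 1 := by
  refine (LinearMap.finrank_le_finrank_of_injective (harmonicCoeffs_injective n)).trans_eq ?_
  rw [Module.finrank_prod, Module.finrank_fin_fun, Module.finrank_fin_fun]
  ring

end HarmonicSpan

/-! ### Square integrable fields on the unit sphere -/

/-- The algebra of polynomial functions on the unit sphere, closed under conjugation so that the
Stone–Weierstrass theorem applies. -/
def spherePoly : StarSubalgebra ℂ C(S2, ℂ) where
  carrier := {c | ∃ q : Poly ℂ, ∀ y : S2, c y = (polyToSmooth q).1 y}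
  mul_mem' := by
    rintro c c' ⟨q, hq⟩ ⟨q', hq'⟩
    exact ⟨q * q', fun y => by rw [map_mul, ContinuousMap.mul_apply, hq, hq']; rfl⟩
  add_mem' := by
    rintro c c' ⟨q, hq⟩ ⟨q', hq'⟩
    exact ⟨q + q', fun y => by rw [map_add, ContinuousMap.add_apply, hq, hq']; rfl⟩
  algebraMap_mem' a := ⟨MvPolynomial.C a, fun y => by
    rw [polyToSmooth_apply, MvPolynomial.eval_C]
    rfl⟩
  star_mem' := by
    rintro c ⟨q, hq⟩
    exact ⟨polyConj q, fun y => by rw [polyToSmooth_polyConj, ← hq]; rfl⟩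

lemma topologicalClosure_spherePoly : spherePoly.topologicalClosure = ⊤ := by
  refine ContinuousMap.starSubalgebra_topologicalClosure_eq_top_of_separatesPoints _ ?_
  intro y z hyz
  by_contra! hcoord
  refine hyz (Subtype.ext (PiLp.ext fun i => ?_))
  have h := hcoord (fun y : S2 => (polyToSmooth (MvPolynomial.X i)).1 y)
    ⟨⟨_, SmoothFun.continuous_sphere _⟩, ⟨MvPolynomial.X i, fun y => rfl⟩, rfl⟩
  simp only [polyToSmooth_apply, MvPolynomial.eval_X] at h
  exact_mod_cast h

lemma eq_zero_of_integral_poly_mul {g : Lp ℂ 2 sigma}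
    (h : ∀ q : Poly ℂ, ∫ y : S2, (polyToSmooth q).1 y * g y ∂sigma = 0) : g = 0 := by
  have hpoly (c : C(S2, ℂ)) (hc : c ∈ spherePoly) :
      inner ℂ (ContinuousMap.toLp (E := ℂ) 2 sigma ℂ c) g = 0 := by
    obtain ⟨q, hq⟩ := hc
    rw [L2.inner_def, ← h (polyConj q)]
    refine integral_congr_ae ?_
    filter_upwards [ContinuousMap.coeFn_toLp (E := ℂ) (p := 2) (𝕜 := ℂ) sigma c] with y hy
    rw [hy, hq, polyToSmooth_polyConj, RCLike.inner_apply, mul_comm]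
  have hcont (c : C(S2, ℂ)) : inner ℂ (ContinuousMap.toLp (E := ℂ) 2 sigma ℂ c) g = 0 := by
    have hc : c ∈ spherePoly.topologicalClosure := by
      rw [topologicalClosure_spherePoly]
      trivial
    have hclosed : IsClosed
        {c : C(S2, ℂ) | inner ℂ (ContinuousMap.toLp (E := ℂ) 2 sigma ℂ c) g = 0} :=
      isClosed_eq (by fun_prop) continuous_const
    exact closure_minimal hpoly hclosed hc
  exact (ContinuousMap.toLp_denseRange ℂ sigma ℂ (p := 2) (by norm_num)).eq_zero_of_inner_right
    ℂ hcont

/-- The Hilbert space `[L²(S²)]³`. -/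
abbrev SphereL2 : Type := Lp C3 2 sigma

lemma continuous_fieldOnSphere (r : ℝ) (v : Fin 3 → SmoothFun) :
    Continuous fun y : S2 => (WithLp.toLp 2 fun i => (v i).1 (r • (y : E3)) : C3) :=
  (PiLp.continuous_toLp 2 _).comp (continuous_pi fun i =>
    SmoothFun.continuous_sphere (SmoothFun.dilate r (v i)))

lemma memLp_of_continuous {F : Type*} [NormedAddCommGroup F] {g : S2 → F} (hg : Continuous g) :
    MemLp g 2 sigma :=
  hg.memLp_of_hasCompactSupport (HasCompactSupport.of_compactSpace g)

/-- The restriction of a smooth field to the sphere of radius `r`, rescaled to the unit sphere, as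
an element of `[L²(S²)]³`. -/
def fieldL2 (r : ℝ) : (Fin 3 → SmoothFun) →ₗ[ℂ] SphereL2 where
  toFun v := MemLp.toLp _ (memLp_of_continuous (continuous_fieldOnSphere r v))
  map_add' v w := MemLp.toLp_add (memLp_of_continuous (continuous_fieldOnSphere r v))
    (memLp_of_continuous (continuous_fieldOnSphere r w))
  map_smul' c v := MemLp.toLp_const_smul c (memLp_of_continuous (continuous_fieldOnSphere r v))

lemma coeFn_fieldL2 (r : ℝ) (v : Fin 3 → SmoothFun) :
    fieldL2 r v =ᵐ[sigma] fun y => WithLp.toLp 2 fun i => (v i).1 (r • (y : E3)) :=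
  (memLp_of_continuous (continuous_fieldOnSphere r v)).coeFn_toLp

/-- Complex conjugation of smooth functions. -/
instance : StarRing SmoothFun where
  star f := ⟨fun x => conj (f.1 x), Complex.conjCLE.contDiff.comp (SmoothFun.contDiff f)⟩
  star_involutive _ := Subtype.ext (funext fun _ => Complex.conj_conj _)
  star_mul _ _ := Subtype.ext (funext fun _ => (map_mul _ _ _).trans (mul_comm _ _))
  star_add _ _ := Subtype.ext (funext fun _ => map_add _ _ _)

instance : StarModule ℂ SmoothFun where
  star_smul c f := Subtype.ext (funext fun x => map_mul (starRingEnd ℂ) c (f.1 x))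

namespace SmoothFun

lemma star_apply (f : SmoothFun) (x : E3) : (star f).1 x = conj (f.1 x) := rfl

lemma star_d (j : Fin 3) (f : SmoothFun) : star (d j f) = d j (star f) := by
  ext x
  have h := Complex.conjCLE.toContinuousLinearMap.hasFDerivAt.comp x
    (differentiable f x).hasFDerivAt
  change conj (fderiv ℝ f.1 x _) = fderiv ℝ (fun x => conj (f.1 x)) x _
  rw [show fderiv ℝ (fun x => conj (f.1 x)) x = _ from h.fderiv]
  rfl

lemma star_X (j : Fin 3) : star (X j) = X j :=
  Subtype.ext (funext fun x => Complex.conj_ofReal (x j))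

lemma star_ang (j : Fin 3) (f : SmoothFun) :
    star (smoothCalc.ang j f) = smoothCalc.ang j (star f) := by
  simp only [VecCalc.ang_apply, smoothCalc, star_sub, star_mul', star_X, star_d]

lemma star_xcross (v : Fin 3 → SmoothFun) (j : Fin 3) :
    star (smoothCalc.xcross v j) = smoothCalc.xcross (star v) j := by
  simp only [VecCalc.xcross, smoothCalc, star_sub, star_mul', star_X, Pi.star_apply]

lemma star_polyToSmooth (p : Poly ℂ) : star (polyToSmooth p) = polyToSmooth (polyConj p) :=
  Subtype.ext (funext fun x => (polyToSmooth_polyConj p x).symm)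

end SmoothFun

lemma inner_fieldL2_left (v : Fin 3 → SmoothFun) (g : SphereL2) :
    inner ℂ (fieldL2 1 v) g = ∫ y : S2, ∑ i, (star (v i)).1 y * g y i ∂sigma := by
  rw [L2.inner_def]
  refine integral_congr_ae ?_
  filter_upwards [coeFn_fieldL2 1 v] with y hy
  rw [hy, PiLp.inner_apply]
  refine Finset.sum_congr rfl fun i _ => ?_
  rw [RCLike.inner_apply, mul_comm, SmoothFun.star_apply, one_smul]

lemma inner_fieldL2_fieldL2 (v w : Fin 3 → SmoothFun) (r : ℝ) :
    inner ℂ (fieldL2 1 v) (fieldL2 r w) = fieldPairing r w (star v) := by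
  simp only [inner_fieldL2_left, fieldPairing_apply, spherePairing_apply]
  rw [← integral_finsetSum]
  · refine integral_congr_ae ?_
    filter_upwards [coeFn_fieldL2 r w] with y hy
    rw [hy]
    exact Finset.sum_congr rfl fun i _ => mul_comm _ _
  · exact fun i _ => integrable_of_continuous <| SmoothFun.continuous_sphere
      (SmoothFun.dilate r (w i) * star (v i))

/-- The restriction of a polynomial field to the unit sphere. -/
def polyFieldL2 : (Fin 3 → Poly ℂ) →ₗ[ℂ] SphereL2 :=
  fieldL2 1 ∘ₗ polyToSmooth.toLinearMap.compLeft (Fin 3)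

lemma polyFieldL2_rsq_smul (w : Fin 3 → Poly ℂ) :
    polyFieldL2 ((polyCalc ℂ).rsq • w) = polyFieldL2 w := by
  refine Lp.ext ?_
  filter_upwards [coeFn_fieldL2 1 (fun i => polyToSmooth ((polyCalc ℂ).rsq * w i)),
    coeFn_fieldL2 1 (fun i => polyToSmooth (w i))] with y hy hy'
  refine hy.trans (Eq.trans (congrArg _ (funext fun i => ?_)) hy'.symm)
  rw [map_mul, compat_polyToSmooth.rsq]
  change (smoothCalc.rsq).1 _ * _ = _
  rw [rsq_apply, norm_smul_sphere zero_le_one, one_pow, Complex.ofReal_one, one_mul]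

lemma eq_zero_of_inner_polyFieldL2 {g : SphereL2} (h : ∀ w, inner ℂ (polyFieldL2 w) g = 0) :
    g = 0 := by
  have hcomp (i : Fin 3) : ∀ᵐ y ∂sigma, g y i = 0 := by
    let gi : Lp ℂ 2 sigma := (EuclideanSpace.proj (𝕜 := ℂ) i : C3 →L[ℂ] ℂ).compLp g
    have hgi : gi =ᵐ[sigma] fun y => g y i :=
      (EuclideanSpace.proj (𝕜 := ℂ) i : C3 →L[ℂ] ℂ).coeFn_compLp g
    have hgi_zero : gi = 0 := by
      refine eq_zero_of_integral_poly_mul fun q => ?_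
      rw [← h (Pi.single i (polyConj q))]
      refine (integral_congr_ae ?_).trans (inner_fieldL2_left _ g).symm
      filter_upwards [hgi] with y hy
      rw [hy, Finset.sum_eq_single i]
      · simp only [LinearMap.compLeft_apply, Function.comp_apply, Pi.single_eq_same,
          SmoothFun.star_apply, AlgHom.toLinearMap_apply, polyToSmooth_polyConj, Complex.conj_conj]
      · intro j _ hj
        simp only [LinearMap.compLeft_apply, Function.comp_apply, Pi.single_eq_of_ne hj, map_zero,
          star_zero, ZeroMemClass.coe_zero, Pi.zero_apply, zero_mul]
      · exact fun hi => absurd (Finset.mem_univ i) hi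
    filter_upwards [hgi, Lp.eq_zero_iff_ae_eq_zero.mp hgi_zero] with y hy hy0
    rw [← hy, hy0, Pi.zero_apply]
  rw [Lp.eq_zero_iff_ae_eq_zero]
  filter_upwards [ae_all_iff.mpr hcomp] with y hy
  exact PiLp.ext hy

/-! ### Vector spherical harmonics as smooth fields -/

lemma sqrtDelta_sq (n : ℕ) : (sqrtDelta n : ℂ) ^ 2 = (n : ℂ) * (n + 1) := by
  rw [← Complex.ofReal_pow, sqrtDelta, Real.sq_sqrt (by positivity)]
  push_cast
  rfl

lemma sqrtDelta_ne_zero {n : ℕ} (hn : n ≠ 0) : (sqrtDelta n : ℂ) ≠ 0 := by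
  have : 0 < n := Nat.pos_of_ne_zero hn
  exact Complex.ofReal_ne_zero.mpr (Real.sqrt_pos.mpr (by positivity)).ne'

lemma sqrtDelta_zero : sqrtDelta 0 = 0 := by
  rw [sqrtDelta, Nat.cast_zero, zero_mul, Real.sqrt_zero]

/-- The vector spherical harmonics of order `n` with potential `f`, as smooth fields: for `j = 0`,
`1`, `2` their restrictions to the unit sphere are the columns `V`, `U`, `W` of `M_n^m` when `f`
extends `Y_n^m`. On the unit sphere `∇_{S²} f = -x × (x × ∇ f)`, which gives the sign of `U`. -/
def vshField (n : ℕ) : Fin 3 → SmoothFun →ₗ[ℂ] (Fin 3 → SmoothFun) :=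
  ![(sqrtDelta n : ℂ)⁻¹ • smoothCalc.toroidalField,
    -(sqrtDelta n : ℂ)⁻¹ • smoothCalc.tangentField,
    smoothCalc.radialField]

lemma vshField_zero {j : Fin 3} (hj : j ≠ 2) : vshField 0 j = 0 := by
  fin_cases j
  · simp [vshField, sqrtDelta_zero]
  · simp [vshField, sqrtDelta_zero]
  · exact absurd rfl hj

lemma star_vshField (n : ℕ) (j : Fin 3) (f : SmoothFun) :
    star (vshField n j f) = vshField n j (star f) := by
  have hV (g : SmoothFun) : star (smoothCalc.toroidalField g) = smoothCalc.toroidalField (star g) :=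
    funext fun i => SmoothFun.star_ang i g
  have hU : star (smoothCalc.tangentField f) = smoothCalc.tangentField (star f) :=
    funext fun i => (SmoothFun.star_xcross _ i).trans
      (congrArg (fun v => smoothCalc.xcross v i) (hV f))
  have hW : star (smoothCalc.radialField f) = smoothCalc.radialField (star f) :=
    funext fun i => (star_mul' _ _).trans (congrArg (· * star f) (SmoothFun.star_X i))
  have hs : star ((sqrtDelta n : ℂ)⁻¹) = (sqrtDelta n : ℂ)⁻¹ := by
    rw [← Complex.ofReal_inv]
    exact Complex.conj_ofReal _
  fin_cases j
  · exact (star_smul _ _).trans (congrArg₂ (· • ·) hs (hV f))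
  · exact (star_smul _ _).trans (congrArg₂ (· • ·) ((star_neg _).trans (congrArg _ hs)) hU)
  · exact hW

lemma fieldPairing_one_comm (v w : Fin 3 → SmoothFun) :
    fieldPairing 1 v w = fieldPairing 1 w v := by
  simp only [fieldPairing_apply]
  exact Finset.sum_congr rfl fun i _ => spherePairing_congr fun y => by rw [one_smul, mul_comm]

lemma fieldPairing_one_radialField (v : Fin 3 → SmoothFun) (q : SmoothFun) :
    fieldPairing 1 v (smoothCalc.radialField q) = spherePairing 1 (smoothCalc.xdot v) q := by
  rw [← fieldPairing_radialField, Complex.ofReal_one, one_mul]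

lemma spherePairing_one_rsq_mul (f q : SmoothFun) :
    spherePairing 1 (smoothCalc.rsq * f) q = spherePairing 1 f q := by
  refine spherePairing_congr fun y => ?_
  change (smoothCalc.rsq).1 _ * f.1 _ * _ = _
  rw [rsq_apply, norm_smul_sphere zero_le_one, one_pow, Complex.ofReal_one, one_mul]

lemma fieldPairing_tangentField_toroidalField (f q : SmoothFun) :
    fieldPairing 1 (smoothCalc.tangentField f) (smoothCalc.toroidalField q) = 0 := by
  rw [fieldPairing_toroidalField]
  change -spherePairing 1 (∑ j, smoothCalc.ang j (smoothCalc.xcross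
    (fun i => smoothCalc.ang i f) j)) q = 0
  rw [VecCalc.sum_ang_xcross_ang, map_zero, LinearMap.zero_apply, neg_zero]

lemma fieldPairing_tangentField_tangentField {n : ℕ} {p : Poly ℂ} (hp : IsHarmonicPoly n p)
    (f : SmoothFun) :
    fieldPairing 1 (smoothCalc.tangentField f) (smoothCalc.tangentField (polyToSmooth p))
      = (n : ℂ) * (n + 1) * spherePairing 1 f (polyToSmooth p) := by
  have hxx : smoothCalc.xcrossₗ (smoothCalc.tangentField (polyToSmooth p))
      = -(smoothCalc.rsq • smoothCalc.toroidalField (polyToSmooth p)) := by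
    change smoothCalc.xcrossₗ (smoothCalc.xcrossₗ (smoothCalc.toroidalField _)) = _
    rw [VecCalc.xcrossₗ_xcrossₗ]
    change smoothCalc.radialField (smoothCalc.xdot fun i => smoothCalc.ang i _) - _ = _
    rw [VecCalc.xdot_ang, map_zero, zero_sub]
  change fieldPairing 1 (smoothCalc.xcrossₗ _) _ = _
  rw [fieldPairing_xcross, hxx, map_neg, Complex.ofReal_one, one_mul, neg_neg,
    ← fieldPairing_toroidalField_toroidalField hp, fieldPairing_one_comm, fieldPairing_apply,
    fieldPairing_one_comm, fieldPairing_apply]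
  exact Finset.sum_congr rfl fun i _ => spherePairing_one_rsq_mul _ _

lemma fieldPairing_radialField_radialField (f q : SmoothFun) :
    fieldPairing 1 (smoothCalc.radialField f) (smoothCalc.radialField q)
      = spherePairing 1 f q := by
  have hxdot : smoothCalc.xdot (smoothCalc.radialField f) = smoothCalc.rsq * f := by
    change ∑ i, SmoothFun.X i * (SmoothFun.X i * f) = (∑ i, SmoothFun.X i ^ 2) * f
    rw [Finset.sum_mul]
    exact Finset.sum_congr rfl fun i _ => by rw [← mul_assoc, ← pow_two]
  rw [fieldPairing_one_radialField, hxdot, spherePairing_one_rsq_mul]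

lemma fieldPairing_toroidalField_radialField (f q : SmoothFun) :
    fieldPairing 1 (smoothCalc.toroidalField f) (smoothCalc.radialField q) = 0 := by
  rw [fieldPairing_one_radialField]
  change spherePairing 1 (smoothCalc.xdot fun i => smoothCalc.ang i f) q = 0
  rw [VecCalc.xdot_ang, map_zero, LinearMap.zero_apply]

lemma fieldPairing_tangentField_radialField (f q : SmoothFun) :
    fieldPairing 1 (smoothCalc.tangentField f) (smoothCalc.radialField q) = 0 := by
  rw [fieldPairing_one_radialField]
  change spherePairing 1 (smoothCalc.xdot (smoothCalc.xcross _)) q = 0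
  rw [VecCalc.xdot_xcross, map_zero, LinearMap.zero_apply]

lemma fieldPairing_vshField (n n' : ℕ) (f : SmoothFun) {p : Poly ℂ} (hp : IsHarmonicPoly n' p)
    (j j' : Fin 3) :
    fieldPairing 1 (vshField n j f) (vshField n' j' (polyToSmooth p)) =
      if j = j' then (if j = 2 then 1 else
        (sqrtDelta n : ℂ)⁻¹ * (sqrtDelta n' : ℂ)⁻¹ * (sqrtDelta n' : ℂ) ^ 2) *
          spherePairing 1 f (polyToSmooth p) else 0 := by
  have hVU := fieldPairing_one_comm (smoothCalc.toroidalField f)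
    (smoothCalc.tangentField (polyToSmooth p))
  have hWV := fieldPairing_one_comm (smoothCalc.radialField f)
    (smoothCalc.toroidalField (polyToSmooth p))
  have hWU := fieldPairing_one_comm (smoothCalc.radialField f)
    (smoothCalc.tangentField (polyToSmooth p))
  rw [fieldPairing_tangentField_toroidalField] at hVU
  rw [fieldPairing_toroidalField_radialField] at hWV
  rw [fieldPairing_tangentField_radialField] at hWU
  fin_cases j <;> fin_cases j' <;>
    simp [vshField, hVU, hWV, hWU, fieldPairing_tangentField_toroidalField,
      fieldPairing_toroidalField_radialField, fieldPairing_tangentField_radialField,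
      fieldPairing_toroidalField_toroidalField hp, fieldPairing_tangentField_tangentField hp,
      fieldPairing_radialField_radialField, sqrtDelta_sq, mul_assoc, mul_left_comm]

/-! ### The Hilbert basis of vector spherical harmonics -/

/-- An orthonormal system of `2 n + 1` homogeneous harmonic polynomials in each degree `n`. -/
structure IsHarmonicPolySystem (p : ℕ → ℤ → Poly ℂ) : Prop where
  harmonic : ∀ (n : ℕ) (m : ℤ), m ∈ Finset.Icc (-(n : ℤ)) n → IsHarmonicPoly n (p n m)
  orthonormal : ∀ (n n' : ℕ) (m m' : ℤ),
    m ∈ Finset.Icc (-(n : ℤ)) n → m' ∈ Finset.Icc (-(n' : ℤ)) n' →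
    spherePairing 1 (polyToSmooth (p n m)) (polyToSmooth (polyConj (p n' m')))
      = if n = n' ∧ m = m' then 1 else 0

/-- The vector spherical harmonics as elements of `[L²(S²)]³`. -/
def vshL2 (p : ℕ → ℤ → Poly ℂ) (n : ℕ) (m : ℤ) (j : Fin 3) : SphereL2 :=
  fieldL2 1 (vshField n j (polyToSmooth (p n m)))

/-- The indices of the nonzero vector spherical harmonics: `U` and `V` vanish in order `0`. -/
abbrev VshIndex : Type :=
  {i : ℕ × ℤ × Fin 3 // i.2.1 ∈ Finset.Icc (-(i.1 : ℤ)) i.1 ∧ (i.1 = 0 → i.2.2 = 2)}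

/-- The nonzero vector spherical harmonics. -/
def vshFamily (p : ℕ → ℤ → Poly ℂ) (i : VshIndex) : SphereL2 := vshL2 p i.1.1 i.1.2.1 i.1.2.2

lemma vshL2_zero (p : ℕ → ℤ → Poly ℂ) (m : ℤ) {j : Fin 3} (hj : j ≠ 2) : vshL2 p 0 m j = 0 := by
  rw [vshL2, vshField_zero hj, LinearMap.zero_apply, map_zero]

lemma toroidalField_of_isHarmonicPoly_zero {q : Poly ℂ} (hq : IsHarmonicPoly 0 q) :
    smoothCalc.toroidalField (polyToSmooth q) = 0 := by
  funext j
  change smoothCalc.ang j _ = 0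
  rw [← compat_polyToSmooth.ang, VecCalc.ang_apply, d_eq_zero_of_isHomogeneous_zero hq.1,
    d_eq_zero_of_isHomogeneous_zero hq.1, mul_zero, mul_zero, sub_zero, map_zero]

lemma toroidalField_eq_smul_vshField {n : ℕ} {q : Poly ℂ} (hq : IsHarmonicPoly n q) :
    smoothCalc.toroidalField (polyToSmooth q)
      = (sqrtDelta n : ℂ) • vshField n 0 (polyToSmooth q) := by
  rcases eq_or_ne n 0 with rfl | hn
  · rw [sqrtDelta_zero, Complex.ofReal_zero, zero_smul, toroidalField_of_isHarmonicPoly_zero hq]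
  · exact (smul_inv_smul₀ (sqrtDelta_ne_zero hn) _).symm

lemma tangentField_eq_smul_vshField {n : ℕ} {q : Poly ℂ} (hq : IsHarmonicPoly n q) :
    smoothCalc.tangentField (polyToSmooth q)
      = -(sqrtDelta n : ℂ) • vshField n 1 (polyToSmooth q) := by
  rcases eq_or_ne n 0 with rfl | hn
  · rw [sqrtDelta_zero, Complex.ofReal_zero, neg_zero, zero_smul, VecCalc.tangentField,
      LinearMap.comp_apply, toroidalField_of_isHarmonicPoly_zero hq, map_zero]
  · change _ = -(sqrtDelta n : ℂ) •
      (-(sqrtDelta n : ℂ)⁻¹ • smoothCalc.tangentField (polyToSmooth q))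
    rw [smul_smul, neg_mul_neg, mul_inv_cancel₀ (sqrtDelta_ne_zero hn), one_smul]

section HarmonicPolySystem

variable {p : ℕ → ℤ → Poly ℂ} (hp : IsHarmonicPolySystem p)
include hp

lemma inner_vshL2 {n n' : ℕ} {m m' : ℤ} (hm : m ∈ Finset.Icc (-(n : ℤ)) n)
    (hm' : m' ∈ Finset.Icc (-(n' : ℤ)) n') (j j' : Fin 3) :
    inner ℂ (vshL2 p n m j) (vshL2 p n' m' j') =
      if n = n' ∧ m = m' ∧ j = j' ∧ (n = 0 → j = 2) then 1 else 0 := by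
  rw [vshL2, vshL2, inner_fieldL2_fieldL2, star_vshField, SmoothFun.star_polyToSmooth,
    fieldPairing_vshField _ _ _ (hp.harmonic n m hm).polyConj, hp.orthonormal n' n m' m hm' hm]
  by_cases hind : n = n' ∧ m = m' ∧ j = j'
  · obtain ⟨rfl, rfl, rfl⟩ := hind
    rcases eq_or_ne j 2 with rfl | hj
    · simp
    rcases eq_or_ne n 0 with rfl | hn
    · simp [hj, sqrtDelta_zero]
    · have hs := sqrtDelta_ne_zero hn
      simp only [if_true, if_neg hj, hn, false_imp_iff, and_self, mul_one]
      field_simp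
  · have hind' : ¬(n = n' ∧ m = m' ∧ j = j' ∧ (n = 0 → j = 2)) :=
      fun h => hind ⟨h.1, h.2.1, h.2.2.1⟩
    rw [if_neg hind']
    by_cases hj : j' = j
    · have hnm : ¬(n' = n ∧ m' = m) := fun h => hind ⟨h.1.symm, h.2.symm, hj.symm⟩
      rw [if_neg hnm, mul_zero, ite_self]
    · rw [if_neg hj]

lemma orthonormal_vshFamily : Orthonormal ℂ (vshFamily p) := by
  classical
  rw [orthonormal_iff_ite]
  rintro ⟨⟨n, m, j⟩, hm, hj⟩ ⟨⟨n', m', j'⟩, hm', hj'⟩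
  rw [vshFamily, vshFamily, inner_vshL2 hp hm hm']
  refine if_congr ?_ rfl rfl
  rw [Subtype.mk.injEq, Prod.mk.injEq, Prod.mk.injEq]
  exact ⟨fun h => ⟨h.1, h.2.1, h.2.2.1⟩, fun h => ⟨h.1, h.2.1, h.2.2, hj⟩⟩

lemma linearIndependent_harmonicPolys (n : ℕ) :
    LinearIndependent ℂ fun m : Finset.Icc (-(n : ℤ)) n => p n m := by
  rw [linearIndependent_iff']
  intro s c hc m hm
  have hpair : ∑ m' ∈ s, c m' *
      spherePairing 1 (polyToSmooth (p n m')) (polyToSmooth (polyConj (p n m))) = 0 := by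
    have := congrArg
      (fun q => spherePairing 1 (polyToSmooth q) (polyToSmooth (polyConj (p n m)))) hc
    simpa only [map_sum, map_smul, LinearMap.sum_apply, LinearMap.smul_apply, smul_eq_mul,
      map_zero, LinearMap.zero_apply] using this
  rw [Finset.sum_eq_single_of_mem m hm] at hpair
  · simpa only [hp.orthonormal n n m m m.2 m.2, and_self, if_true, mul_one] using hpair
  · intro m' _ hm'
    rw [hp.orthonormal n n m' m m'.2 m.2, if_neg fun h => hm' (Subtype.ext h.2), mul_zero]

lemma span_harmonicPolys (n : ℕ) :
    Submodule.span ℂ (Set.range fun m : Finset.Icc (-(n : ℤ)) n => p n m) = harmonicPolys ℂ n := by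
  have hli := linearIndependent_harmonicPolys hp n
  refine Submodule.eq_of_le_of_finrank_le ?_ ?_
  · rw [Submodule.span_le]
    rintro _ ⟨m, rfl⟩
    exact hp.harmonic n m m.2
  · rw [finrank_span_eq_card hli, Fintype.card_coe, Int.card_Icc]
    have := finrank_harmonicPolys_le (K := ℂ) n
    omega

lemma inner_vshField_eq_zero {g : SphereL2} (hg : ∀ i, inner ℂ (vshFamily p i) g = 0) {n : ℕ}
    {q : Poly ℂ} (hq : IsHarmonicPoly n q) (j : Fin 3) :
    inner ℂ (fieldL2 1 (vshField n j (polyToSmooth q))) g = 0 := by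
  let Φ : Poly ℂ →ₗ[ℂ] SphereL2 := fieldL2 1 ∘ₗ vshField n j ∘ₗ polyToSmooth.toLinearMap
  have hspan : Submodule.span ℂ (Set.range fun m : Finset.Icc (-(n : ℤ)) n => p n m)
      ≤ (ℂ ∙ g)ᗮ.comap Φ := by
    rw [Submodule.span_le]
    rintro _ ⟨m, rfl⟩
    refine Submodule.mem_orthogonal_singleton_iff_inner_left.mpr ?_
    by_cases hj : n = 0 → j = 2
    · exact hg ⟨(n, m, j), m.2, hj⟩
    · obtain ⟨rfl, hj2⟩ := Classical.not_imp.mp hj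
      exact (congrArg (inner ℂ · g) (vshL2_zero p m hj2)).trans (inner_zero_left g)
  rw [span_harmonicPolys hp] at hspan
  exact Submodule.mem_orthogonal_singleton_iff_inner_left.mp (hspan hq)

lemma eq_zero_of_inner_vshFamily {g : SphereL2} (hg : ∀ i, inner ℂ (vshFamily p i) g = 0) :
    g = 0 := by
  let N : Submodule ℂ (Fin 3 → Poly ℂ) := (ℂ ∙ g)ᗮ.comap polyFieldL2
  have hmem (w : Fin 3 → Poly ℂ) : w ∈ N ↔ inner ℂ (polyFieldL2 w) g = 0 :=
    Submodule.mem_orthogonal_singleton_iff_inner_left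
  suffices N = ⊤ from eq_zero_of_inner_polyFieldL2 fun w => (hmem w).mp (this ▸ trivial)
  refine eq_top_of_harmonic_fields (fun w => ?_) (fun n q hq => ?_) (fun n q hq => ?_)
    fun n q hq => ?_
  · rw [hmem, hmem, polyFieldL2_rsq_smul]
  · rw [hmem, polyFieldL2, LinearMap.comp_apply, compat_polyToSmooth.radialField]
    exact inner_vshField_eq_zero hp hg hq 2
  · rw [hmem, polyFieldL2, LinearMap.comp_apply, compat_polyToSmooth.toroidalField,
      toroidalField_eq_smul_vshField hq, map_smul, inner_smul_left,
      inner_vshField_eq_zero hp hg hq, mul_zero]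
  · rw [hmem, polyFieldL2, LinearMap.comp_apply, compat_polyToSmooth.tangentField,
      tangentField_eq_smul_vshField hq, map_smul, inner_smul_left,
      inner_vshField_eq_zero hp hg hq, mul_zero]

/-- The Hilbert basis of vector spherical harmonics. -/
def vshBasis : HilbertBasis VshIndex ℂ SphereL2 :=
  HilbertBasis.mkOfOrthogonalEqBot (orthonormal_vshFamily hp) <| (Submodule.eq_bot_iff _).mpr
    fun _ hg => eq_zero_of_inner_vshFamily hp fun i =>
      (Submodule.mem_orthogonal _ _).mp hg _ (Submodule.subset_span ⟨i, rfl⟩)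

lemma coe_vshBasis : ⇑(vshBasis hp) = vshFamily p :=
  HilbertBasis.coe_mkOfOrthogonalEqBot _ _

end HarmonicPolySystem

lemma tendsto_sum_range_sum_Icc {ι E : Type*} [Fintype ι] [AddCommMonoid E] [TopologicalSpace E]
    {F : ℕ × ℤ × ι → E} {g : E} (hF : HasSum F g)
    (hzero : ∀ (n : ℕ) (m : ℤ) j, m ∉ Finset.Icc (-(n : ℤ)) n → F (n, m, j) = 0) :
    Tendsto (fun N => ∑ n ∈ Finset.range N, ∑ m ∈ Finset.Icc (-(n : ℤ)) n, ∑ j, F (n, m, j))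
      atTop (𝓝 g) := by
  let S (N : ℕ) : Finset (ℕ × ℤ × ι) :=
    Finset.range N ×ˢ (Finset.Icc (-(N : ℤ)) N ×ˢ Finset.univ)
  have hS : Tendsto S atTop atTop := by
    refine tendsto_atTop_finset_of_monotone (fun a b hab => ?_) fun ⟨n, m, j⟩ => ?_
    · refine Finset.product_subset_product (Finset.range_subset_range.mpr hab)
        (Finset.product_subset_product (Finset.Icc_subset_Icc ?_ ?_) subset_rfl) <;> omega
    · refine ⟨n + 1 + m.natAbs, ?_⟩
      simp only [S, Finset.mem_product, Finset.mem_range, Finset.mem_Icc, Finset.mem_univ, and_true]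
      omega
  refine (hF.comp hS).congr fun N => ?_
  simp only [Function.comp, S, Finset.sum_product]
  refine Finset.sum_congr rfl fun n hn => (Finset.sum_subset ?_ ?_).symm
  · have := Finset.mem_range.mp hn
    apply Finset.Icc_subset_Icc <;> omega
  · exact fun m _ hm => Finset.sum_eq_zero fun j _ => hzero n m j hm

section HarmonicPolySystem

variable {p : ℕ → ℤ → Poly ℂ} (hp : IsHarmonicPolySystem p)
include hp

lemma tendsto_vsh_expansion (g : SphereL2) :
    Tendsto (fun N : ℕ => ∑ n ∈ Finset.range N, ∑ m ∈ Finset.Icc (-(n : ℤ)) n, ∑ j,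
      inner ℂ (vshL2 p n m j) g • vshL2 p n m j) atTop (𝓝 g) := by
  have hbasis := (vshBasis hp).hasSum_repr g
  simp only [HilbertBasis.repr_apply_apply, coe_vshBasis] at hbasis
  let F (i : ℕ × ℤ × Fin 3) : SphereL2 := if i.2.1 ∈ Finset.Icc (-(i.1 : ℤ)) i.1 then
    inner ℂ (vshL2 p i.1 i.2.1 i.2.2) g • vshL2 p i.1 i.2.1 i.2.2 else 0
  have hF : HasSum F g := by
    have hcomp : F ∘ Subtype.val = fun i : VshIndex => inner ℂ (vshFamily p i) g • vshFamily p i :=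
      funext fun i => if_pos i.2.1
    rw [← hcomp] at hbasis
    refine (Subtype.val_injective.hasSum_iff fun ⟨n, m, j⟩ hi => ?_).mp hbasis
    refine ite_eq_right_iff.mpr fun hm => ?_
    obtain ⟨rfl, hj⟩ := Classical.not_imp.mp fun h => hi ⟨⟨(n, m, j), hm, h⟩, rfl⟩
    rw [vshL2_zero p m hj, smul_zero]
  refine (tendsto_sum_range_sum_Icc hF fun n m j hm => if_neg hm).congr fun N => ?_
  exact Finset.sum_congr rfl fun n _ => Finset.sum_congr rfl fun m hm =>
    Finset.sum_congr rfl fun j _ => if_pos hm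

lemma exists_inner_vshFamily_eq {c : VshIndex → ℂ} (hc : Summable fun i => ‖c i‖ ^ 2) :
    ∃ g : SphereL2, ∀ i, inner ℂ (vshFamily p i) g = c i := by
  have hmem : Memℓp c 2 := (memℓp_gen_iff (by norm_num)).mpr (by simpa using hc)
  refine ⟨(vshBasis hp).repr.symm ⟨c, hmem⟩, fun i => ?_⟩
  rw [← coe_vshBasis hp, ← HilbertBasis.repr_apply_apply, LinearIsometryEquiv.apply_symm_apply]

lemma summable_inner_vshFamily (g : SphereL2) :
    Summable fun i => ‖inner ℂ (vshFamily p i) g‖ ^ 2 :=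
  (orthonormal_vshFamily hp).inner_products_summable g

end HarmonicPolySystem

/-! ### Spheres of radius `r` -/

lemma measurableEmbedding_dilate {r : ℝ} (hr : 0 < r) :
    MeasurableEmbedding fun y : S2 => r • (y : E3) := by
  have hc : Continuous fun y : S2 => r • (y : E3) := by fun_prop
  exact (hc.isClosedEmbedding fun y z h =>
    Subtype.ext (smul_right_injective E3 hr.ne' h)).measurableEmbedding

lemma ofReal_sq_ne_zero {r : ℝ} (hr : 0 < r) : ENNReal.ofReal (r ^ 2) ≠ 0 :=
  (ENNReal.ofReal_pos.mpr (pow_pos hr 2)).ne'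

lemma integral_sphereMeasure {G : Type*} [NormedAddCommGroup G] [NormedSpace ℝ G] {r : ℝ}
    (hr : 0 < r) (F : E3 → G) :
    ∫ x, F x ∂(sphereMeasure r) = (r ^ 2) • ∫ y : S2, F (r • (y : E3)) ∂sigma := by
  rw [sphereMeasure, integral_smul_measure, (measurableEmbedding_dilate hr).integral_map,
    ENNReal.toReal_ofReal (by positivity)]

lemma ae_sphereMeasure_iff {r : ℝ} (hr : 0 < r) {P : E3 → Prop} :
    (∀ᵐ x ∂(sphereMeasure r), P x) ↔ ∀ᵐ y : S2 ∂sigma, P (r • (y : E3)) := by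
  rw [sphereMeasure, Measure.ae_ennreal_smul_measure_eq (ofReal_sq_ne_zero hr),
    (measurableEmbedding_dilate hr).ae_map_iff]

lemma memLp_sphereMeasure_iff {r : ℝ} (hr : 0 < r) {f : E3 → C3} :
    MemLp f 2 (sphereMeasure r) ↔ MemLp (fun y : S2 => f (r • (y : E3))) 2 sigma := by
  have h := ofReal_sq_ne_zero hr
  rw [← Function.comp_def f, ← (measurableEmbedding_dilate hr).memLp_map_measure_iff, sphereMeasure]
  refine ⟨fun hf => ?_, fun hf => hf.smul_measure ENNReal.ofReal_ne_top⟩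
  have hinv := hf.smul_measure (c := (ENNReal.ofReal (r ^ 2))⁻¹) (ENNReal.inv_ne_top.mpr h)
  rwa [smul_smul, ENNReal.inv_mul_cancel h ENNReal.ofReal_ne_top, one_smul] at hinv

lemma eLpNorm_sphereMeasure {r : ℝ} (hr : 0 < r) (f : E3 → C3) :
    eLpNorm f 2 (sphereMeasure r) = ENNReal.ofReal (r ^ 2) ^ (1 / (2 : ENNReal)).toReal *
      eLpNorm (fun y : S2 => f (r • (y : E3))) 2 sigma := by
  rw [sphereMeasure, eLpNorm_smul_measure_of_ne_top (by norm_num),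
    (measurableEmbedding_dilate hr).eLpNorm_map_measure]
  rfl

lemma tendsto_ennreal_const_mul_zero_iff {ι : Type*} {l : Filter ι} {f : ι → ENNReal} {c : ENNReal}
    (hc0 : c ≠ 0) (hct : c ≠ ⊤) :
    Tendsto (fun i => c * f i) l (𝓝 0) ↔ Tendsto f l (𝓝 0) := by
  constructor
  · intro h
    have hinv := ENNReal.Tendsto.const_mul (a := c⁻¹) h (.inr (ENNReal.inv_ne_top.mpr hc0))
    simpa only [← mul_assoc, ENNReal.inv_mul_cancel hc0 hct, one_mul, mul_zero] using hinv
  · intro h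
    simpa only [mul_zero] using ENNReal.Tendsto.const_mul h (.inr hct)

lemma tendsto_eLpNorm_sphereMeasure_iff {r : ℝ} (hr : 0 < r) {f : ℕ → E3 → C3} :
    Tendsto (fun N => eLpNorm (f N) 2 (sphereMeasure r)) atTop (𝓝 0) ↔
      Tendsto (fun N => eLpNorm (fun y : S2 => f N (r • (y : E3))) 2 sigma) atTop (𝓝 0) := by
  simp only [eLpNorm_sphereMeasure hr]
  exact tendsto_ennreal_const_mul_zero_iff
    (ENNReal.rpow_pos (ENNReal.ofReal_pos.mpr (pow_pos hr 2)) ENNReal.ofReal_ne_top).ne'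
    (ENNReal.rpow_ne_top_of_nonneg ENNReal.toReal_nonneg ENNReal.ofReal_ne_top)

lemma hasL2Sum_iff {r : ℝ} (hr : 0 < r) {f : ℕ → E3 → C3} {ψ : E3 → C3} {F : ℕ → SphereL2}
    {Ψ : SphereL2} (hF : ∀ n, F n =ᵐ[sigma] fun y => f n (r • (y : E3)))
    (hΨ : Ψ =ᵐ[sigma] fun y => ψ (r • (y : E3))) :
    HasL2Sum r f ψ ↔ Tendsto (fun N : ℕ => ∑ n ∈ Finset.range N, F n) atTop (𝓝 Ψ) := by
  rw [HasL2Sum, tendsto_eLpNorm_sphereMeasure_iff hr, Lp.tendsto_Lp_iff_tendsto_eLpNorm']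
  refine tendsto_congr fun N => ?_
  rw [eLpNorm_sub_comm]
  refine eLpNorm_congr_ae ?_
  filter_upwards [Lp.coeFn_finsetSum (Finset.range N) F, ae_all_iff.mpr hF, hΨ] with y hsum hf hψ
  rw [Pi.sub_apply, hsum, hψ, Finset.sum_apply]
  exact congrArg _ (Finset.sum_congr rfl fun n _ => (hf n).symm)

lemma exists_ae_eq_dilate {r : ℝ} (hr : 0 < r) (g : SphereL2) :
    ∃ ψ : L2S r, (fun y : S2 => ψ (r • (y : E3))) =ᵐ[sigma] g := by
  obtain ⟨f, -, hfg⟩ := (measurableEmbedding_dilate hr).exists_stronglyMeasurable_extend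
    (Lp.stronglyMeasurable g) (fun _ => ⟨0⟩)
  have hmem : MemLp f 2 (sphereMeasure r) := by
    rw [memLp_sphereMeasure_iff hr, ← Function.comp_def f, hfg]
    exact Lp.memLp g
  refine ⟨hmem.toLp, ?_⟩
  filter_upwards [(ae_sphereMeasure_iff hr).mp hmem.coeFn_toLp] with y hy
  exact hy.trans (congrFun hfg y)

lemma exists_sphereL2_ae_eq_dilate {r : ℝ} (hr : 0 < r) (ψ : L2S r) :
    ∃ g : SphereL2, g =ᵐ[sigma] fun y => ψ (r • (y : E3)) :=
  ⟨((memLp_sphereMeasure_iff hr).mp (Lp.memLp ψ)).toLp, MemLp.coeFn_toLp _⟩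

/-! ### The matrices of vector spherical harmonics -/

lemma hasFDerivAt_unitVec {y : E3} (hy : ‖y‖ = 1) :
    HasFDerivAt unitVec (ContinuousLinearMap.id ℝ E3 - (innerSL ℝ y).smulRight y) y := by
  have hsq : HasFDerivAt (fun z : E3 => ‖z‖ ^ 2) (2 • innerSL ℝ y) y :=
    (hasStrictFDerivAt_norm_sq y).hasFDerivAt
  have hnorm := hsq.sqrt (by rw [hy]; norm_num)
  simp only [Real.sqrt_sq (norm_nonneg _), hy] at hnorm
  have hinv := (hasDerivAt_inv (𝕜 := ℝ) (x := ‖y‖) (by rw [hy]; norm_num)).comp_hasFDerivAt y hnorm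
  refine (hinv.smul (hasFDerivAt_id y)).congr_fderiv ?_
  ext v i
  simp only [Function.comp_apply, hy, inv_one, one_pow, Real.sqrt_one, id_eq, one_smul, neg_smul,
    add_apply, sub_apply, neg_apply, smul_apply, ContinuousLinearMap.smulRight_apply,
    ContinuousLinearMap.id_apply, PiLp.add_apply, PiLp.sub_apply, PiLp.neg_apply, PiLp.smul_apply,
    smul_eq_mul, nsmul_eq_mul, Nat.cast_ofNat]
  ring

lemma unitVec_of_norm_eq_one {y : E3} (hy : ‖y‖ = 1) : unitVec y = y := by
  rw [unitVec, hy, inv_one, one_smul]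

lemma norm_unitVec {z : E3} (hz : z ≠ 0) : ‖unitVec z‖ = 1 := by
  rw [unitVec, norm_smul, norm_inv, norm_norm, inv_mul_cancel₀ (norm_ne_zero_iff.mpr hz)]

lemma unitVec_smul {r : ℝ} (hr : 0 < r) (y : S2) : unitVec (r • (y : E3)) = y := by
  rw [unitVec, norm_smul_sphere hr.le, smul_smul, inv_mul_cancel₀ hr.ne', one_smul]

lemma surfGrad_eq {f : E3 → ℂ} {P : SmoothFun} (hf : ∀ x : E3, ‖x‖ = 1 → f x = P.1 x) {y : E3}
    (hy : ‖y‖ = 1) (i : Fin 3) : surfGrad f y i = -(smoothCalc.tangentField P i).1 y := by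
  have hy0 : y ≠ 0 := norm_pos_iff.mp (hy ▸ one_pos)
  have heq : (fun z => f (unitVec z)) =ᶠ[𝓝 y] P.1 ∘ unitVec := by
    filter_upwards [isOpen_ne.mem_nhds hy0] with z hz
    exact hf _ (norm_unitVec hz)
  have hcomp := (SmoothFun.differentiable P (unitVec y)).hasFDerivAt.comp y (hasFDerivAt_unitVec hy)
  rw [unitVec_of_norm_eq_one hy] at hcomp
  have htan : smoothCalc.tangentField P i
      = SmoothFun.X i * smoothCalc.eul P - smoothCalc.rsq * SmoothFun.d i P :=
    smoothCalc.xcross_ang P i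
  rw [surfGrad, pd, heq.fderiv_eq, hcomp.fderiv, htan]
  change fderiv ℝ P.1 y (EuclideanSpace.single i 1 - inner ℝ y (EuclideanSpace.single i 1) • y)
    = -((SmoothFun.X i).1 y * (smoothCalc.eul P).1 y - (smoothCalc.rsq).1 y * pd i P.1 y)
  rw [map_sub, map_smul, ← SmoothFun.eul_eq_fderiv, rsq_apply, hy,
    EuclideanSpace.inner_single_right, SmoothFun.X_apply, pd, one_pow, Complex.ofReal_one, one_mul,
    one_mul, Complex.real_smul, neg_sub, conj_trivial]

lemma crossProduct_eq_xcross (v : Fin 3 → SmoothFun) (x : E3) :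
    (fun i => ((x i : ℝ) : ℂ)) ⨯₃ (fun i => (v i).1 x)
      = fun i => (smoothCalc.xcross v i).1 x := by
  ext i
  rw [cross_apply]
  fin_cases i <;> rfl

lemma xcross_vshField_one_apply (n : ℕ) (P : SmoothFun) {y : E3} (hy : ‖y‖ = 1) (i : Fin 3) :
    (smoothCalc.xcross (vshField n 1 P) i).1 y = (vshField n 0 P i).1 y := by
  have hcross : smoothCalc.xcrossₗ (vshField n 1 P)
      = (sqrtDelta n : ℂ)⁻¹ • smoothCalc.rsq • smoothCalc.toroidalField P := by
    change smoothCalc.xcrossₗ (-(sqrtDelta n : ℂ)⁻¹ •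
      smoothCalc.xcrossₗ (smoothCalc.toroidalField P)) = _
    have hdot : smoothCalc.xdot (smoothCalc.toroidalField P) = 0 := smoothCalc.xdot_ang P
    rw [map_smul, smoothCalc.xcrossₗ_xcrossₗ, hdot, map_zero, zero_sub, smul_neg, neg_smul, neg_neg]
  have hrsq : (smoothCalc.rsq).1 y = 1 := by rw [rsq_apply, hy, one_pow, Complex.ofReal_one]
  change (smoothCalc.xcrossₗ (vshField n 1 P) i).1 y = _
  rw [hcross]
  change _ * ((smoothCalc.rsq).1 y * _) = _
  rw [hrsq, one_mul]
  rfl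

/-- The system `Y` is given on the unit sphere by the polynomials `p`. -/
def IsPolySystem (Y : ℕ → ℤ → E3 → ℂ) (p : ℕ → ℤ → Poly ℂ) : Prop :=
  ∀ (n : ℕ) (m : ℤ), m ∈ Finset.Icc (-(n : ℤ)) n → ∀ x : E3, ‖x‖ = 1 →
    Y n m x = (polyToSmooth (p n m)).1 x

lemma IsPolySystem.isHarmonicPolySystem {Y : ℕ → ℤ → E3 → ℂ} {p : ℕ → ℤ → Poly ℂ}
    (hY : IsSphericalHarmonicSystem Y) (hp : IsPolySystem Y p)
    (hharm : ∀ (n : ℕ) (m : ℤ), m ∈ Finset.Icc (-(n : ℤ)) n → IsHarmonicPoly n (p n m)) :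
    IsHarmonicPolySystem p := by
  refine ⟨hharm, fun n n' m m' hm hm' => ?_⟩
  rw [← hY.orthonormal n n' m m' hm hm', integral_sphereMeasure one_pos, one_pow, one_smul,
    spherePairing_apply]
  refine integral_congr_ae (.of_forall fun y => ?_)
  simp only [one_smul]
  rw [hp n m hm _ (norm_eq_of_mem_sphere y), hp n' m' hm' _ (norm_eq_of_mem_sphere y),
    ← polyToSmooth_polyConj]

lemma exists_isPolySystem {Y : ℕ → ℤ → E3 → ℂ} (hY : IsSphericalHarmonicSystem Y) :
    ∃ p, IsHarmonicPolySystem p ∧ IsPolySystem Y p := by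
  have hex (n : ℕ) (m : ℤ) : ∃ q : Poly ℂ, m ∈ Finset.Icc (-(n : ℤ)) n →
      IsHarmonicPoly n q ∧ ∀ x : E3, ‖x‖ = 1 → Y n m x = (polyToSmooth q).1 x := by
    by_cases hm : m ∈ Finset.Icc (-(n : ℤ)) n
    · obtain ⟨q, hhom, hharm, hval⟩ := hY.harmonic n m hm
      exact ⟨q, fun _ => ⟨⟨hhom, hharm⟩, fun x hx => by rw [hval x hx, polyToSmooth_apply]⟩⟩
    · exact ⟨0, fun h => absurd h hm⟩
  choose p hp using hex
  have hYp : IsPolySystem Y p := fun n m hm => (hp n m hm).2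
  exact ⟨p, hYp.isHarmonicPolySystem hY fun n m hm => (hp n m hm).1, hYp⟩

lemma vshM_apply {Y : ℕ → ℤ → E3 → ℂ} {p : ℕ → ℤ → Poly ℂ} (hp : IsPolySystem Y p) {n : ℕ} {m : ℤ}
    (hm : m ∈ Finset.Icc (-(n : ℤ)) n) (y : S2) (i j : Fin 3) :
    vshM Y n m y i j = (vshField n j (polyToSmooth (p n m)) i).1 y := by
  have hy : ‖(y : E3)‖ = 1 := norm_eq_of_mem_sphere y
  have hU : vshU Y n m y = fun i => (vshField n 1 (polyToSmooth (p n m)) i).1 y := by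
    funext i
    change (sqrtDelta n : ℂ)⁻¹ * surfGrad (Y n m) y i = -(sqrtDelta n : ℂ)⁻¹ * _
    rw [surfGrad_eq (hp n m hm) hy, mul_neg, neg_mul]
  have hV : vshV Y n m y = fun i => (vshField n 0 (polyToSmooth (p n m)) i).1 y := by
    rw [vshV, hU, crossProduct_eq_xcross]
    exact funext (xcross_vshField_one_apply n _ hy)
  fin_cases j
  · exact congrFun hV i
  · exact congrFun hU i
  · exact (congrArg (· * ((y : E3) i : ℂ)) (hp n m hm y hy)).trans (mul_comm _ _)

lemma coeFn_vshL2 {Y : ℕ → ℤ → E3 → ℂ} {p : ℕ → ℤ → Poly ℂ} (hp : IsPolySystem Y p) {n : ℕ} {m : ℤ}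
    (hm : m ∈ Finset.Icc (-(n : ℤ)) n) (j : Fin 3) :
    vshL2 p n m j =ᵐ[sigma] fun y => WithLp.toLp 2 fun i => vshM Y n m y i j := by
  filter_upwards [coeFn_fieldL2 1 (vshField n j (polyToSmooth (p n m)))] with y hy
  simp only [vshL2, hy, one_smul, vshM_apply hp hm]

lemma integral_vshM {Y : ℕ → ℤ → E3 → ℂ} {p : ℕ → ℤ → Poly ℂ} (hp : IsPolySystem Y p) {r : ℝ}
    (hr : 0 < r) {φ : E3 → C3} {g : SphereL2} (hg : g =ᵐ[sigma] fun y => φ (r • (y : E3))) {n : ℕ}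
    {m : ℤ} (hm : m ∈ Finset.Icc (-(n : ℤ)) n) :
    ∫ x, (vshM Y n m (unitVec x))ᴴ *ᵥ (φ x).ofLp ∂(sphereMeasure r)
      = fun j => ((r : ℂ) ^ 2) * inner ℂ (vshL2 p n m j) g := by
  have hae : (fun y : S2 => (vshM Y n m (unitVec (r • (y : E3))))ᴴ *ᵥ (φ (r • (y : E3))).ofLp)
      =ᵐ[sigma] fun y j => inner ℂ (vshL2 p n m j y) (g y) := by
    filter_upwards [hg, ae_all_iff.mpr (coeFn_vshL2 hp hm)] with y hy hM
    ext j
    rw [hy, unitVec_smul hr, hM, PiLp.inner_apply]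
    simp only [RCLike.inner_apply']
    rfl
  rw [integral_sphereMeasure hr, integral_congr_ae hae]
  ext j
  rw [Pi.smul_apply, eval_integral fun j => L2.integrable_inner (vshL2 p n m j) g, L2.inner_def,
    Complex.real_smul, Complex.ofReal_pow]

/-- The combination of order `n` of vector spherical harmonics with coefficients `c`. -/
def vshSum (p : ℕ → ℤ → Poly ℂ) (c : ℕ → ℤ → Fin 3 → ℂ) (n : ℕ) : SphereL2 :=
  ∑ m ∈ Finset.Icc (-(n : ℤ)) n, ∑ j, c n m j • vshL2 p n m j

lemma coeFn_vshSum {Y : ℕ → ℤ → E3 → ℂ} {p : ℕ → ℤ → Poly ℂ} (hp : IsPolySystem Y p)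
    (c : ℕ → ℤ → Fin 3 → ℂ) (n : ℕ) :
    vshSum p c n =ᵐ[sigma] fun y => WithLp.toLp 2 (∑ m ∈ Finset.Icc (-(n : ℤ)) n,
      vshM Y n m y *ᵥ c n m) := by
  have hsum : vshSum p c n = fieldL2 1 (∑ m ∈ Finset.Icc (-(n : ℤ)) n, ∑ j,
      c n m j • vshField n j (polyToSmooth (p n m))) := by
    simp only [vshSum, vshL2, map_sum, map_smul]
  rw [hsum]
  filter_upwards [coeFn_fieldL2 1 (∑ m ∈ Finset.Icc (-(n : ℤ)) n, ∑ j,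
      c n m j • vshField n j (polyToSmooth (p n m)))] with y hy
  rw [hy]
  congr 1
  funext i
  let ev : SmoothFun →ₗ[ℂ] ℂ := LinearMap.proj (y : E3) ∘ₗ SmoothFun.val.toLinearMap
  change (_ : SmoothFun).1 ((1 : ℝ) • (y : E3)) = _
  rw [one_smul]
  change ev _ = _
  simp only [Finset.sum_apply, map_sum, Pi.smul_apply, map_smul, Matrix.mulVec, dotProduct]
  refine Finset.sum_congr rfl fun m hm => Finset.sum_congr rfl fun j _ => ?_
  rw [vshM_apply hp hm, smul_eq_mul, mul_comm]
  rfl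

lemma inner_vshSum {p : ℕ → ℤ → Poly ℂ} (hp : IsHarmonicPolySystem p) (c : ℕ → ℤ → Fin 3 → ℂ)
    {n n' : ℕ} {m : ℤ} (hm : m ∈ Finset.Icc (-(n : ℤ)) n) (j : Fin 3) :
    inner ℂ (vshL2 p n m j) (vshSum p c n')
      = if n = n' ∧ (n = 0 → j = 2) then c n m j else 0 := by
  have hterm (m' : ℤ) (hm' : m' ∈ Finset.Icc (-(n' : ℤ)) n') (j' : Fin 3) :
      inner ℂ (vshL2 p n m j) (c n' m' j' • vshL2 p n' m' j')
        = if m = m' then if j = j' then if n = n' ∧ (n = 0 → j = 2) then c n' m' j' else 0 else 0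
          else 0 := by
    rw [inner_smul_right, inner_vshL2 hp hm hm', mul_ite, mul_one, mul_zero, ← ite_and, ← ite_and]
    exact if_congr (by tauto) rfl rfl
  simp only [vshSum, inner_sum]
  rw [Finset.sum_congr rfl fun m' hm' => Finset.sum_congr rfl fun j' _ => hterm m' hm' j']
  rcases eq_or_ne n n' with rfl | hn
  · simp only [Finset.sum_ite_irrel, Finset.sum_const_zero, Finset.sum_ite_eq, Finset.mem_univ, hm,
      if_true]
  · simp only [hn, false_and, if_false, ite_self, Finset.sum_const_zero]

lemma inner_vshL2_of_tendsto {p : ℕ → ℤ → Poly ℂ} (hp : IsHarmonicPolySystem p)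
    {c : ℕ → ℤ → Fin 3 → ℂ} {g : SphereL2}
    (hg : Tendsto (fun N : ℕ => ∑ n ∈ Finset.range N, vshSum p c n) atTop (𝓝 g)) {n : ℕ} {m : ℤ}
    (hm : m ∈ Finset.Icc (-(n : ℤ)) n) (j : Fin 3) :
    inner ℂ (vshL2 p n m j) g = if n = 0 → j = 2 then c n m j else 0 := by
  have hlim := (tendsto_const_nhds (x := vshL2 p n m j)).inner (𝕜 := ℂ) hg
  refine tendsto_nhds_unique hlim (tendsto_const_nhds.congr' ?_)
  filter_upwards [eventually_gt_atTop n] with N hN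
  simp only [inner_sum, inner_vshSum hp c hm, ite_and, Finset.sum_ite_eq, Finset.mem_range, hN,
    if_true]

lemma vshSum_congr {p : ℕ → ℤ → Poly ℂ} {c c' : ℕ → ℤ → Fin 3 → ℂ} {n : ℕ}
    (h : ∀ m ∈ Finset.Icc (-(n : ℤ)) n, ∀ j, (n = 0 → j = 2) → c n m j = c' n m j) :
    vshSum p c n = vshSum p c' n := by
  refine Finset.sum_congr rfl fun m hm => Finset.sum_congr rfl fun j _ => ?_
  by_cases hj : n = 0 → j = 2
  · rw [h m hm j hj]
  · obtain ⟨rfl, hj2⟩ := Classical.not_imp.mp hj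
    rw [vshL2_zero _ _ hj2, smul_zero, smul_zero]

lemma tendsto_vshSum {p : ℕ → ℤ → Poly ℂ} (hp : IsHarmonicPolySystem p) {c : ℕ → ℤ → Fin 3 → ℂ}
    {g : SphereL2} (hc : ∀ n : ℕ, ∀ m ∈ Finset.Icc (-(n : ℤ)) n, ∀ j, (n = 0 → j = 2) →
      inner ℂ (vshL2 p n m j) g = c n m j) :
    Tendsto (fun N : ℕ => ∑ n ∈ Finset.range N, vshSum p c n) atTop (𝓝 g) := by
  refine (tendsto_vsh_expansion hp g).congr fun N => Finset.sum_congr rfl fun n _ => ?_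
  exact vshSum_congr (c := fun n m j => inner ℂ (vshL2 p n m j) g) (hc n)

/-! ### Helmholtz decomposition of radiating elastic fields -/

/-- The vector field with given smooth components. -/
def toField (u : Fin 3 → SmoothFun) (x : E3) : C3 := WithLp.toLp 2 fun i => (u i).1 x

lemma contDiff_toField (u : Fin 3 → SmoothFun) : ContDiff ℝ ∞ (toField u) :=
  PiLp.contDiff_toLp.comp (contDiff_pi.mpr fun i => SmoothFun.contDiff (u i))

lemma grad_coe (f : SmoothFun) : grad f.1 = toField fun i => SmoothFun.d i f := rfl

lemma dvg_toField (u : Fin 3 → SmoothFun) : dvg (toField u) = (smoothCalc.div u).1 := by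
  funext x
  simp only [dvg, VecCalc.div, Fin.sum_univ_three]
  rfl

lemma curl_toField (u : Fin 3 → SmoothFun) : curl (toField u) = toField (smoothCalc.curl u) := by
  funext x
  ext i
  fin_cases i <;> rfl

/-- The projection to a component. -/
def component (i : Fin 3) : C3 →L[ℝ] ℂ :=
  (EuclideanSpace.proj (𝕜 := ℂ) i : C3 →L[ℂ] ℂ).restrictScalars ℝ

lemma coe_lap (f : SmoothFun) : (smoothCalc.lap f).1 = Laplacian.laplacian f.1 := by
  funext x
  have hd : Differentiable ℝ (fderiv ℝ f.1) :=
    ((SmoothFun.contDiff f).fderiv_right (m := ∞) (by simp)).differentiable (by simp)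
  have h (j : Fin 3) : (SmoothFun.d j (SmoothFun.d j f)).1 x = iteratedFDeriv ℝ 2 f.1 x
      ![EuclideanSpace.basisFun (Fin 3) ℝ j, EuclideanSpace.basisFun (Fin 3) ℝ j] := by
    rw [iteratedFDeriv_two_apply, EuclideanSpace.basisFun_apply]
    change fderiv ℝ (fun y => fderiv ℝ f.1 y _) x _ = _
    rw [fderiv_clm_apply (hd x) (differentiableAt_const _)]
    simp
  rw [InnerProductSpace.laplacian_eq_iteratedFDeriv_orthonormalBasis f.1
    (EuclideanSpace.basisFun (Fin 3) ℝ)]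
  simp only [VecCalc.lap_apply, Fin.sum_univ_three, ← h]
  rfl

lemma laplacian_toField (u : Fin 3 → SmoothFun) :
    Laplacian.laplacian (toField u) = toField fun i => smoothCalc.lap (u i) := by
  funext x
  ext i
  have h := ((contDiff_toField u).of_le (m := 2) (by
    simpa using WithTop.coe_le_coe.mpr
      (le_top : (2 : ℕ∞) ≤ ⊤))).contDiffAt.laplacian_CLM_comp_left (x := x) (l := component i)
  exact h.symm.trans (congrFun (coe_lap (u i)) x).symm

section EqOn

variable {O : Set E3} (hO : IsOpen O)
include hO

lemma eqOn_pd {f g : E3 → ℂ} (h : Set.EqOn f g O) (j : Fin 3) :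
    Set.EqOn (pd j f) (pd j g) O := fun x hx => by
  rw [pd, pd, (h.eventuallyEq_of_mem (hO.mem_nhds hx)).fderiv_eq]

lemma eqOn_grad {f g : E3 → ℂ} (h : Set.EqOn f g O) : Set.EqOn (grad f) (grad g) O := by
  intro x hx
  ext i
  exact eqOn_pd hO h i hx

variable {u v : E3 → C3} (h : Set.EqOn u v O)
include h

lemma eqOn_pd_component (i j : Fin 3) :
    Set.EqOn (pd j fun x => u x i) (pd j fun x => v x i) O :=
  eqOn_pd hO (fun _ hx => congrArg (· i) (h hx)) j

lemma eqOn_dvg : Set.EqOn (dvg u) (dvg v) O := fun _ hx =>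
  Finset.sum_congr rfl fun i _ => eqOn_pd_component hO h i i hx

lemma eqOn_curl : Set.EqOn (curl u) (curl v) O := fun x hx => by
  have hpd := fun i j => eqOn_pd_component hO h i j hx
  simp only [curl, hpd]

lemma eqOn_lame (la mu : ℝ) : Set.EqOn (lame la mu u) (lame la mu v) O := fun x hx => by
  rw [lame, lame, eqOn_grad hO (eqOn_dvg hO h) hx,
    (InnerProductSpace.laplacian_congr_nhds
      (h.eventuallyEq_of_mem (hO.mem_nhds hx))).eq_of_nhds]

end EqOn

lemma isOpen_norm_gt (a : ℝ) : IsOpen {x : E3 | a < ‖x‖} :=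
  isOpen_lt continuous_const continuous_norm

lemma isRadiating_of_sommerfeld {k a : ℝ} {F : E3 → C3} {g : Fin 3 → SmoothFun}
    (h : Sommerfeld k F) (hFg : Set.EqOn F (toField g) {x | a < ‖x‖}) (i : Fin 3) :
    IsRadiating k (g i) := by
  refine squeeze_zero_norm' ?_ h
  filter_upwards [(tendsto_norm_cobounded_atTop (E := E3)).eventually_gt_atTop (max a 0)] with x hx
  have hxa : a < ‖x‖ := (le_max_left _ _).trans_lt hx
  have hx0 : 0 < ‖x‖ := (le_max_right _ _).trans_lt hx
  have hx0' : (‖x‖ : ℂ) ≠ 0 := by exact_mod_cast hx0.ne'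
  have hd : DifferentiableAt ℝ (toField g) x := (contDiff_toField g).differentiable (by simp) x
  have hcomp : fderiv ℝ (g i).1 x = (component i).comp (fderiv ℝ (toField g) x) :=
    ((component i).hasFDerivAt.comp x hd.hasFDerivAt).fderiv
  set V := fderiv ℝ F x (unitVec x) - (Complex.I * (k : ℂ)) • F x with hV
  have hVi : V i = fderiv ℝ (g i).1 x (unitVec x) - Complex.I * k * (g i).1 x := by
    rw [hV, (hFg.eventuallyEq_of_mem ((isOpen_norm_gt a).mem_nhds hxa)).fderiv_eq, hFg hxa, hcomp]
    rfl
  have hradial : (smoothCalc.eul (g i)).1 x - Complex.I * ((k * ‖x‖ : ℝ) : ℂ) * (g i).1 x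
      = (‖x‖ : ℂ) * V i := by
    rw [hVi, SmoothFun.eul_eq_fderiv, unitVec, map_smul, Complex.real_smul]
    push_cast
    field_simp
  rw [hradial, norm_mul, Complex.norm_real, norm_norm]
  exact mul_le_mul_of_nonneg_left (PiLp.norm_apply_le V i) hx0.le

lemma exists_eqOn_toField {O : Set E3} (hO : IsOpen O) {v : E3 → C3} (hv : ContDiffOn ℝ ∞ v O)
    {a b : ℝ} (ha : 0 < a) (hab : a < b) (hsub : ∀ x : E3, a ≤ ‖x‖ → x ∈ O) :
    ∃ u : Fin 3 → SmoothFun, Set.EqOn v (toField u) {x | b < ‖x‖} := by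
  let χ : ContDiffBump (0 : E3) := ⟨a, b, ha, hab⟩
  have hsmooth (i : Fin 3) : ContDiff ℝ ∞ fun x => ((1 - χ x : ℝ) : ℂ) * v x i := by
    refine contDiff_iff_contDiffAt.mpr fun x => ?_
    rcases lt_or_ge ‖x‖ a with hx | hx
    · refine (contDiffAt_const (c := (0 : ℂ))).congr_of_eventuallyEq ?_
      filter_upwards [(isOpen_lt continuous_norm continuous_const).mem_nhds hx] with z hz
      have hz' : ‖z‖ < a := hz
      rw [χ.one_of_mem_closedBall (mem_closedBall_zero_iff.mpr hz'.le), sub_self,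
        Complex.ofReal_zero, zero_mul]
    · exact (Complex.ofRealCLM.contDiff.comp (contDiff_const.sub χ.contDiff)).contDiffAt.mul
        (((component i).contDiff.contDiffAt (x := v x)).comp x
          (hv.contDiffAt (hO.mem_nhds (hsub x hx))))
  refine ⟨fun i => ⟨_, hsmooth i⟩, fun x hx => ?_⟩
  have hx' : b < ‖x‖ := hx
  have hχ : χ x = 0 := χ.zero_of_le_dist ((dist_zero_right x).symm ▸ hx'.le)
  ext i
  change v x i = ((1 - χ x : ℝ) : ℂ) * v x i
  rw [hχ, sub_zero, Complex.ofReal_one, one_mul]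

/-- The smooth functions vanishing at all points of norm larger than `a`. -/
def vanishingOutside (a : ℝ) : Submodule ℂ SmoothFun where
  carrier := {f | Set.EqOn f.1 0 {x | a < ‖x‖}}
  add_mem' hf hg _ hx := (congrArg₂ (· + ·) (hf hx) (hg hx)).trans (add_zero 0)
  zero_mem' _ _ := rfl
  smul_mem' c _ hf _ hx := (congrArg (c * ·) (hf hx)).trans (mul_zero c)

lemma d_mem_vanishingOutside {a : ℝ} {f : SmoothFun} (h : f ∈ vanishingOutside a) (j : Fin 3) :
    SmoothFun.d j f ∈ vanishingOutside a := by
  intro x hx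
  change pd j f.1 x = 0
  rw [eqOn_pd (isOpen_norm_gt a) h j hx, pd, fderiv_zero]
  rfl

lemma div_mem_vanishingOutside {a : ℝ} {u : Fin 3 → SmoothFun} (h : ∀ i, u i ∈ vanishingOutside a) :
    smoothCalc.div u ∈ vanishingOutside a :=
  sum_mem fun i _ => d_mem_vanishingOutside (h i) i

lemma curl_mem_vanishingOutside {a : ℝ} {u : Fin 3 → SmoothFun}
    (h : ∀ i, u i ∈ vanishingOutside a) (j : Fin 3) : smoothCalc.curl u j ∈ vanishingOutside a :=
  sub_mem (d_mem_vanishingOutside (h _) _) (d_mem_vanishingOutside (h _) _)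

lemma isHelmholtz_of_mem_vanishingOutside {a k : ℝ} {b c : ℂ} (hb : b ≠ 0)
    (hk : b * (k : ℂ) ^ 2 = c) {f : SmoothFun}
    (h : b • smoothCalc.lap f + c • f ∈ vanishingOutside a) : IsHelmholtz k a f := by
  intro x hx
  have hfx : b * (smoothCalc.lap f).1 x + c * f.1 x = 0 := h hx
  rw [← hk] at hfx
  exact mul_left_cancel₀ hb (by linear_combination hfx)

lemma IsHelmholtz.const_smul {k a : ℝ} {f : SmoothFun} (h : IsHelmholtz k a f) (c : ℂ) :
    IsHelmholtz k a (c • f) := by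
  intro x hx
  rw [map_smul]
  change c * (smoothCalc.lap f).1 x = _ * (c * f.1 x)
  rw [h x hx]
  ring

section Decomposition

variable (la mu om : ℝ) (u : Fin 3 → SmoothFun)

/-- The left-hand side of the Navier equation for a field with smooth components. -/
def navier (i : Fin 3) : SmoothFun :=
  (mu : ℂ) • smoothCalc.lap (u i) + ((la + mu : ℝ) : ℂ) • smoothCalc.d i (smoothCalc.div u)
    + ((om ^ 2 : ℝ) : ℂ) • u i

/-- The potential `-k_p⁻² ∇ · u` of the compressional part of a field. -/
def compressionalPotential : SmoothFun := (-((kp la mu om : ℂ) ^ 2)⁻¹) • smoothCalc.div u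

/-- The shear part `k_s⁻² ∇ × (∇ × u)` of a field with smooth components. -/
def shearPart (i : Fin 3) : SmoothFun :=
  ((ks mu om : ℂ) ^ 2)⁻¹ • smoothCalc.curl (smoothCalc.curl u) i

variable {la mu om} {u}

lemma mul_kp_sq (hla : 0 < 2 * mu + la) :
    ((mu : ℂ) + ((la + mu : ℝ) : ℂ)) * (kp la mu om : ℂ) ^ 2 = ((om ^ 2 : ℝ) : ℂ) := by
  norm_cast
  rw [kp, div_pow, Real.sq_sqrt hla.le, show mu + (la + mu) = 2 * mu + la by ring,
    mul_div_cancel₀ _ hla.ne']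

lemma mul_ks_sq (hmu : 0 < mu) : (mu : ℂ) * (ks mu om : ℂ) ^ 2 = ((om ^ 2 : ℝ) : ℂ) := by
  norm_cast
  rw [ks, div_pow, Real.sq_sqrt hmu.le, mul_div_cancel₀ _ hmu.ne']

lemma navier_eq_smul_sub (hmu : 0 < mu) (hla : 0 < 2 * mu + la) (hom : 0 < om) (i : Fin 3) :
    navier la mu om u i = ((om ^ 2 : ℝ) : ℂ) •
      (u i - SmoothFun.d i (compressionalPotential la mu om u) - shearPart mu om u i) := by
  have hp : (kp la mu om : ℂ) ^ 2 ≠ 0 := pow_ne_zero 2 (by exact_mod_cast (kp_pos hla hom).ne')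
  have hs : (ks mu om : ℂ) ^ 2 ≠ 0 := pow_ne_zero 2 (by exact_mod_cast (ks_pos hmu hom).ne')
  have hcp : ((om ^ 2 : ℝ) : ℂ) * (-((kp la mu om : ℂ) ^ 2)⁻¹) = -(mu + ((la + mu : ℝ) : ℂ)) := by
    rw [← mul_kp_sq hla, mul_neg, mul_inv_cancel_right₀ hp]
  have hcs : ((om ^ 2 : ℝ) : ℂ) * ((ks mu om : ℂ) ^ 2)⁻¹ = mu := by
    rw [← mul_ks_sq hmu, mul_inv_cancel_right₀ hs]
  rw [navier, compressionalPotential, shearPart, Derivation.map_smul, VecCalc.curl_curl, smul_sub,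
    smul_sub, smul_smul, smul_smul, hcp, hcs]
  change _ + _ • SmoothFun.d i _ + _ = _ - _ • SmoothFun.d i _ - _ • (SmoothFun.d i _ - _)
  module

lemma navier_mem_vanishingOutside {a : ℝ} {v : E3 → C3}
    (huv : Set.EqOn v (toField u) {x | a < ‖x‖})
    (hv : ∀ x : E3, a < ‖x‖ → lame la mu v x + (om ^ 2) • v x = 0) (i : Fin 3) :
    navier la mu om u i ∈ vanishingOutside a := by
  intro x hx
  have h := hv x hx
  rw [eqOn_lame (isOpen_norm_gt a) huv la mu hx, huv hx, lame, laplacian_toField, dvg_toField,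
    grad_coe] at h
  exact congrArg (fun z : C3 => z i) h

variable {a : ℝ} (hu : ∀ i, navier la mu om u i ∈ vanishingOutside a)
include hu

lemma isHelmholtz_compressionalPotential (hla : 0 < 2 * mu + la) :
    IsHelmholtz (kp la mu om) a (compressionalPotential la mu om u) := by
  have hdiv := div_mem_vanishingOutside hu
  have hne : (mu : ℂ) + ((la + mu : ℝ) : ℂ) ≠ 0 := by
    norm_cast
    linarith
  exact (isHelmholtz_of_mem_vanishingOutside hne (mul_kp_sq hla)
    (smoothCalc.div_lame _ _ _ u ▸ hdiv)).const_smul _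

lemma isHelmholtz_shearPart (hmu : 0 < mu) (i : Fin 3) :
    IsHelmholtz (ks mu om) a (shearPart mu om u i) := by
  have hcurl := curl_mem_vanishingOutside (curl_mem_vanishingOutside hu) i
  exact (isHelmholtz_of_mem_vanishingOutside (by exact_mod_cast hmu.ne') (mul_ks_sq hmu)
    (smoothCalc.curl_curl_lame _ _ _ u i ▸ hcurl)).const_smul _

end Decomposition

lemma div_shearPart (mu om : ℝ) (u : Fin 3 → SmoothFun) :
    smoothCalc.div (shearPart mu om u) = 0 := by
  have h : smoothCalc.div (shearPart mu om u)
      = ((ks mu om : ℂ) ^ 2)⁻¹ • smoothCalc.div (smoothCalc.curl (smoothCalc.curl u)) := by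
    simp only [VecCalc.div, shearPart, Derivation.map_smul, Finset.smul_sum]
  rw [h, VecCalc.div_curl, smul_zero]

section Radiation

variable {la mu om a : ℝ} {v : E3 → C3} {u : Fin 3 → SmoothFun}
  (huv : Set.EqOn v (toField u) {x | a < ‖x‖}) (hv : Kupradze la mu om v)
include huv hv

lemma isRadiating_d_compressionalPotential (i : Fin 3) :
    IsRadiating (kp la mu om) (SmoothFun.d i (compressionalPotential la mu om u)) := by
  refine isRadiating_of_sommerfeld (a := a)
    (g := fun i => SmoothFun.d i (compressionalPotential la mu om u)) hv.1 (fun x hx => ?_) i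
  have hO := isOpen_norm_gt a
  rw [pPart, eqOn_grad hO (eqOn_dvg hO huv) hx, dvg_toField, grad_coe]
  ext i
  simp only [compressionalPotential, Derivation.map_smul, toField, PiLp.neg_apply, PiLp.smul_apply,
    Complex.real_smul, Complex.ofReal_inv, Complex.ofReal_pow]
  exact (neg_mul _ _).symm

lemma isRadiating_shearPart (i : Fin 3) : IsRadiating (ks mu om) (shearPart mu om u i) := by
  refine isRadiating_of_sommerfeld (a := a) hv.2 (fun x hx => ?_) i
  have hO := isOpen_norm_gt a
  rw [sPart, eqOn_curl hO (eqOn_curl hO huv) hx, curl_toField, curl_toField]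
  ext i
  simp only [toField, PiLp.smul_apply, Complex.real_smul, Complex.ofReal_inv, Complex.ofReal_pow]
  rfl

end Radiation

/-- Outside the ball of radius `a`, the field `u` is the sum of the gradient of `f` and of the
solenoidal field `w`, whose components are radiating solutions of Helmholtz equations with wave
numbers `k_p` and `k_s`. -/
structure IsDecomposition (la mu om a : ℝ) (u : Fin 3 → SmoothFun) (f : SmoothFun)
    (w : Fin 3 → SmoothFun) : Prop where
  eq : ∀ i, Set.EqOn (u i).1 (SmoothFun.d i f + w i).1 {x | a < ‖x‖}
  helmholtz_f : IsHelmholtz (kp la mu om) a f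
  helmholtz_w : ∀ i, IsHelmholtz (ks mu om) a (w i)
  div_w : smoothCalc.div w = 0
  radiating_f : ∀ i, IsRadiating (kp la mu om) (SmoothFun.d i f)
  radiating_w : ∀ i, IsRadiating (ks mu om) (w i)

lemma isDecomposition {la mu om a : ℝ} (hmu : 0 < mu) (hla : 0 < 2 * mu + la) (hom : 0 < om)
    {v : E3 → C3} {u : Fin 3 → SmoothFun} (huv : Set.EqOn v (toField u) {x | a < ‖x‖})
    (hv : ∀ x : E3, a < ‖x‖ → lame la mu v x + (om ^ 2) • v x = 0) (hrad : Kupradze la mu om v) :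
    IsDecomposition la mu om a u (compressionalPotential la mu om u) (shearPart mu om u) := by
  have hu := navier_mem_vanishingOutside huv hv
  refine ⟨fun i x hx => ?_, isHelmholtz_compressionalPotential hu hla, isHelmholtz_shearPart hu hmu,
    div_shearPart mu om u, isRadiating_d_compressionalPotential huv hrad,
    isRadiating_shearPart huv hrad⟩
  have hom' : ((om ^ 2 : ℝ) : ℂ) ≠ 0 := by exact_mod_cast (pow_pos hom 2).ne'
  have h := hu i
  rw [navier_eq_smul_sub hmu hla hom, Submodule.smul_mem_iff _ hom', sub_sub] at h
  exact sub_eq_zero.mp (h hx)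

lemma IsRadiatingSolution.exists_isDecomposition {la mu om R : ℝ} (hmu : 0 < mu)
    (hla : 0 < 2 * mu + la) (hom : 0 < om) (hR : 0 < R) {D : Set E3}
    (hD : closure D ⊆ Metric.ball 0 R) {h v : E3 → C3}
    (hv : IsRadiatingSolution la mu om D R h v) :
    ∃ (a : ℝ) (u : Fin 3 → SmoothFun) (f : SmoothFun) (w : Fin 3 → SmoothFun), 0 ≤ a ∧ a < R ∧
      Set.EqOn v (toField u) {x | a < ‖x‖} ∧ IsDecomposition la mu om a u f w := by
  obtain ⟨r, hrR, hr⟩ := exists_lt_subset_ball isClosed_closure hD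
  obtain ⟨b, hb, hbR⟩ := exists_between (max_lt hrR hR)
  obtain ⟨a, hba, haR⟩ := exists_between hbR
  have hb0 : 0 < b := (le_max_right _ _).trans_lt hb
  have hsub : ∀ x : E3, b ≤ ‖x‖ → x ∈ (closure D)ᶜ := fun x hx hxD =>
    absurd (mem_ball_zero_iff.mp (hr hxD)) (not_lt.mpr ((le_max_left _ _).trans (hb.le.trans hx)))
  obtain ⟨u, hu⟩ := exists_eqOn_toField isClosed_closure.isOpen_compl hv.smooth hb0 hba hsub
  exact ⟨a, u, _, _, (hb0.trans hba).le, haR, hu, isDecomposition hmu hla hom hu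
    (fun x hx => hv.navier x (hsub x (hba.trans hx).le)) hv.radiation⟩

/-! ### Coefficients of radiating elastic fields -/

lemma inner_vshL2_fieldL2 (p : ℕ → ℤ → Poly ℂ) (n : ℕ) (m : ℤ) (j : Fin 3) (r : ℝ)
    (u : Fin 3 → SmoothFun) : inner ℂ (vshL2 p n m j) (fieldL2 r u)
      = fieldPairing r u (vshField n j (polyToSmooth (polyConj (p n m)))) := by
  rw [vshL2, inner_fieldL2_fieldL2, star_vshField, SmoothFun.star_polyToSmooth]

section VshPairing

variable (n : ℕ) (r : ℝ) (v : Fin 3 → SmoothFun) (q : SmoothFun)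

lemma fieldPairing_vshField_zero : fieldPairing r v (vshField n 0 q)
    = (sqrtDelta n : ℂ)⁻¹ * fieldPairing r v (smoothCalc.toroidalField q) :=
  map_smul (fieldPairing r v) _ _

lemma fieldPairing_vshField_one : fieldPairing r v (vshField n 1 q)
    = -(sqrtDelta n : ℂ)⁻¹ * fieldPairing r v (smoothCalc.tangentField q) :=
  map_smul (fieldPairing r v) _ _

lemma vshField_two : vshField n 2 q = smoothCalc.radialField q := rfl

end VshPairing

lemma fieldPairing_grad_toroidalField (r : ℝ) (f q : SmoothFun) :
    fieldPairing r (fun i => SmoothFun.d i f) (smoothCalc.toroidalField q) = 0 := by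
  have hsum : ∑ j, smoothCalc.ang j (SmoothFun.d j f) = 0 := smoothCalc.sum_ang_d f
  rw [fieldPairing_toroidalField, hsum, map_zero, LinearMap.zero_apply, neg_zero]

lemma fieldPairing_grad_tangentField {n : ℕ} {p : Poly ℂ} (hp : IsHarmonicPoly n p)
    (f : SmoothFun) (r : ℝ) :
    r * fieldPairing r (fun i => SmoothFun.d i f) (smoothCalc.tangentField (polyToSmooth p))
      = -((n : ℂ) * (n + 1) * spherePairing r f (polyToSmooth p)) := by
  rw [← fieldPairing_toroidalField_toroidalField hp, ← smoothCalc.xcrossₗ_grad f,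
    fieldPairing_xcross, neg_neg]
  rfl

lemma scaledHankel_add_scaledHankelDeriv_ne_zero {k : ℝ} (hk : 0 < k) (n : ℕ) {r : ℝ}
    (hr : 0 < r) : scaledHankel k n r + scaledHankelDeriv k n r ≠ 0 := by
  intro h
  have him := scaledHankel_im_pos hk n hr
  rw [eq_neg_of_add_eq_zero_right h, neg_mul, Complex.mul_conj, Complex.neg_im, Complex.ofReal_im,
    neg_zero] at him
  exact him.false

section Coefficients

variable {k a : ℝ} (hk : 0 < k) (ha : 0 ≤ a) {n : ℕ} {p : Poly ℂ} (hp : IsHarmonicPoly n p)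

include hk ha hp

lemma exists_fieldPairing_vshField_zero_eq {w : Fin 3 → SmoothFun}
    (hw : ∀ i, IsHelmholtz k a (w i)) (hrad : ∀ i, IsRadiating k (w i)) :
    ∃ α : ℂ, ∀ r, a < r →
      fieldPairing r w (vshField n 0 (polyToSmooth p)) = scaledHankel k n r * α := by
  choose b hb using fun i => exists_spherePairing_eq_scaledHankel hk ha (hw i) (hrad i) (hp.ang i)
  refine ⟨(sqrtDelta n : ℂ)⁻¹ * ∑ i, b i, fun r hr => ?_⟩
  have htor (i : Fin 3) : spherePairing r (w i) (smoothCalc.toroidalField (polyToSmooth p) i)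
      = b i * scaledHankel k n r := by
    rw [← hb i r hr, compat_polyToSmooth.ang]
    rfl
  rw [fieldPairing_vshField_zero, fieldPairing_apply]
  simp only [htor, ← Finset.sum_mul]
  ring

lemma exists_fieldPairing_vshField_solenoidal_eq {w : Fin 3 → SmoothFun}
    (hw : ∀ i, IsHelmholtz k a (w i)) (hdiv : smoothCalc.div w = 0)
    (hrad : ∀ i, IsRadiating k (w i)) :
    ∃ β : ℂ, ∀ r, a < r →
      fieldPairing r w (vshField n 1 (polyToSmooth p))
        = -(scaledHankel k n r + scaledHankelDeriv k n r) / r * β ∧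
      fieldPairing r w (vshField n 2 (polyToSmooth p))
        = -(sqrtDelta n * scaledHankel k n r) / r * β := by
  obtain ⟨γ, hγ⟩ := exists_spherePairing_xdot_eq hk ha hw hdiv hrad hp
  have htan (r : ℝ) (hr : a < r) :
      r * fieldPairing r w (smoothCalc.tangentField (polyToSmooth p))
        = -(γ * (scaledHankel k n r + scaledHankelDeriv k n r)) := by
    have h := fieldPairing_tangentField hdiv (polyToSmooth p) r
    rw [(hγ r hr).1, (hγ r hr).2, map_neg] at h
    linear_combination -h
  -- In order `0` the field `U` vanishes while `h_0 + t h_0'` does not.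
  have hγ_zero : n = 0 → γ = 0 := by
    rintro rfl
    have hr : a < a + 1 := lt_add_one a
    have h := htan _ hr
    rw [tangentField_eq_smul_vshField hp, sqrtDelta_zero, Complex.ofReal_zero, neg_zero, zero_smul,
      map_zero, mul_zero, zero_eq_neg] at h
    exact (mul_eq_zero.mp h).resolve_right
      (scaledHankel_add_scaledHankelDeriv_ne_zero hk 0 (ha.trans_lt hr))
  have hγ_delta : (sqrtDelta n : ℂ) * ((sqrtDelta n : ℂ)⁻¹ * γ) = γ := by
    rcases eq_or_ne n 0 with hn | hn
    · rw [hγ_zero hn, mul_zero, mul_zero]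
    · exact mul_inv_cancel_left₀ (sqrtDelta_ne_zero hn) γ
  refine ⟨-((sqrtDelta n : ℂ)⁻¹ * γ), fun r hr => ?_⟩
  have hrc : (r : ℂ) ≠ 0 := by exact_mod_cast (ha.trans_lt hr).ne'
  constructor <;> refine mul_left_cancel₀ hrc ?_
  · rw [fieldPairing_vshField_one, mul_left_comm, htan r hr]
    field_simp
  · rw [vshField_two, fieldPairing_radialField, (hγ r hr).1]
    field_simp
    linear_combination -scaledHankel k n r * hγ_delta

lemma exists_fieldPairing_vshField_grad_eq {f : SmoothFun} (hf : IsHelmholtz k a f)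
    (hrad : ∀ i, IsRadiating k (SmoothFun.d i f)) :
    ∃ β : ℂ, ∀ r, a < r →
      fieldPairing r (fun i => SmoothFun.d i f) (vshField n 0 (polyToSmooth p)) = 0 ∧
      fieldPairing r (fun i => SmoothFun.d i f) (vshField n 1 (polyToSmooth p))
        = sqrtDelta n * scaledHankel k n r / r * β ∧
      fieldPairing r (fun i => SmoothFun.d i f) (vshField n 2 (polyToSmooth p))
        = scaledHankelDeriv k n r / r * β := by
  obtain ⟨β, hβ⟩ := exists_spherePairing_eq_of_radiating_grad hk ha hf hrad hp
  refine ⟨β, fun r hr => ⟨?_, ?_, ?_⟩⟩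
  · rw [fieldPairing_vshField_zero, fieldPairing_grad_toroidalField, mul_zero]
  all_goals
    have hrc : (r : ℂ) ≠ 0 := by exact_mod_cast (ha.trans_lt hr).ne'
    refine mul_left_cancel₀ hrc ?_
  · rw [fieldPairing_vshField_one, mul_left_comm, fieldPairing_grad_tangentField hp, (hβ r hr).1,
      ← sqrtDelta_sq]
    field_simp
  · have heul : smoothCalc.xdot (fun i => SmoothFun.d i f) = smoothCalc.eul f :=
      (smoothCalc.eul_apply f).symm
    rw [vshField_two, fieldPairing_radialField, heul, (hβ r hr).2]
    field_simp

end Coefficients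

lemma norm_conjM_matA_mulVec (la mu om : ℝ) (n : ℕ) (r : ℝ) {c : Fin 3 → ℂ}
    (hc : c 1 = 0 ∨ c 2 = 0) (j : Fin 3) :
    ‖(conjM (matA la mu om n r) *ᵥ c) j‖ = ‖(matA la mu om n r *ᵥ c) j‖ := by
  -- Without one of its last two columns, each row of `A_n` has at most one nonzero entry.
  rcases hc with hc | hc <;> fin_cases j <;>
    simp [conjM, matA, Matrix.mulVec, dotProduct, Fin.sum_univ_three, hc, -map_mul, -map_div₀,
      -map_add, -map_neg]

lemma norm_add_sq_le_two_mul {E : Type*} [SeminormedAddCommGroup E] (x y : E) :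
    ‖x + y‖ ^ 2 ≤ 2 * (‖x‖ ^ 2 + ‖y‖ ^ 2) :=
  (pow_le_pow_left₀ (norm_nonneg _) (norm_add_le x y) 2).trans add_sq_le

namespace IsDecomposition

variable {la mu om a : ℝ} {u : Fin 3 → SmoothFun} {f : SmoothFun} {w : Fin 3 → SmoothFun}
  (hdec : IsDecomposition la mu om a u f w) (ha : 0 ≤ a)

include hdec ha

lemma fieldPairing_eq_add {r : ℝ} (hr : a < r) (q : Fin 3 → SmoothFun) :
    fieldPairing r u q
      = fieldPairing r (fun i => SmoothFun.d i f) q + fieldPairing r w q := by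
  rw [← LinearMap.add_apply, ← map_add, fieldPairing_apply, fieldPairing_apply]
  refine Finset.sum_congr rfl fun i _ => spherePairing_congr fun y => ?_
  have hy : a < ‖r • (y : E3)‖ := by rwa [norm_smul_sphere (ha.trans hr.le)]
  rw [hdec.eq i hy]
  rfl

variable (hkp : 0 < kp la mu om) (hks : 0 < ks mu om) {n : ℕ} {p : Poly ℂ}
  (hp : IsHarmonicPoly n p)

include hkp hks hp

lemma exists_shear_coeff : ∃ c : Fin 3 → ℂ, c 2 = 0 ∧ ∀ r, a < r → ∀ j,
    fieldPairing r w (vshField n j (polyToSmooth p)) = (matA la mu om n r *ᵥ c) j := by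
  obtain ⟨α, hα⟩ :=
    exists_fieldPairing_vshField_zero_eq hks ha hp hdec.helmholtz_w hdec.radiating_w
  obtain ⟨β, hβ⟩ := exists_fieldPairing_vshField_solenoidal_eq hks ha hp hdec.helmholtz_w
    hdec.div_w hdec.radiating_w
  refine ⟨![α, β, 0], rfl, fun r hr j => ?_⟩
  rw [matA_eq hkp hks n (ha.trans_lt hr)]
  fin_cases j
  · simp [Matrix.mulVec, dotProduct, Fin.sum_univ_three, hα r hr]
  · simp [Matrix.mulVec, dotProduct, Fin.sum_univ_three, hβ r hr]
  · simp [Matrix.mulVec, dotProduct, Fin.sum_univ_three, hβ r hr]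

lemma exists_compressional_coeff : ∃ c : Fin 3 → ℂ, c 1 = 0 ∧ ∀ r, a < r → ∀ j,
    fieldPairing r (fun i => SmoothFun.d i f) (vshField n j (polyToSmooth p))
      = (matA la mu om n r *ᵥ c) j := by
  obtain ⟨β, hβ⟩ :=
    exists_fieldPairing_vshField_grad_eq hkp ha hp hdec.helmholtz_f hdec.radiating_f
  refine ⟨![0, 0, β], rfl, fun r hr j => ?_⟩
  rw [matA_eq hkp hks n (ha.trans_lt hr)]
  fin_cases j
  · simp [Matrix.mulVec, dotProduct, Fin.sum_univ_three, hβ r hr]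
  · simp [Matrix.mulVec, dotProduct, Fin.sum_univ_three, hβ r hr]
  · simp [Matrix.mulVec, dotProduct, Fin.sum_univ_three, hβ r hr]

omit hp in
lemma exists_expansion {p : ℕ → ℤ → Poly ℂ} (hp : IsHarmonicPolySystem p) :
    ∃ α : ℕ → ℤ → Fin 3 → ℂ, ∀ r, a < r →
      (∀ n : ℕ, ∀ m ∈ Finset.Icc (-(n : ℤ)) n, ∀ j,
        inner ℂ (vshL2 p n m j) (fieldL2 r u) = (matA la mu om n r *ᵥ α n m) j) ∧
      ∃ g : SphereL2, ∀ n : ℕ, ∀ m ∈ Finset.Icc (-(n : ℤ)) n, ∀ j, (n = 0 → j = 2) →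
        inner ℂ (vshL2 p n m j) g = -(conjM (matA la mu om n r) *ᵥ α n m) j := by
  choose! s hs2 hs using fun (n : ℕ) (m : ℤ) (hm : m ∈ Finset.Icc (-(n : ℤ)) n) =>
    hdec.exists_shear_coeff ha hkp hks (hp.harmonic n m hm).polyConj
  choose! c hc1 hc using fun (n : ℕ) (m : ℤ) (hm : m ∈ Finset.Icc (-(n : ℤ)) n) =>
    hdec.exists_compressional_coeff ha hkp hks (hp.harmonic n m hm).polyConj
  simp only [← inner_vshL2_fieldL2] at hs hc
  refine ⟨fun n m => c n m + s n m, fun r hr => ⟨fun n m hm j => ?_, ?_⟩⟩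
  · rw [Matrix.mulVec_add, Pi.add_apply, ← hs n m hm r hr, ← hc n m hm r hr]
    simp only [inner_vshL2_fieldL2]
    exact hdec.fieldPairing_eq_add ha hr _
  let b (i : VshIndex) : ℂ :=
    -(conjM (matA la mu om i.1.1 r) *ᵥ (c i.1.1 i.1.2.1 + s i.1.1 i.1.2.1)) i.1.2.2
  have hb (i : VshIndex) : ‖b i‖ ^ 2
      ≤ 2 * (‖inner ℂ (vshFamily p i) (fieldL2 r fun i => SmoothFun.d i f)‖ ^ 2
        + ‖inner ℂ (vshFamily p i) (fieldL2 r w)‖ ^ 2) := by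
    obtain ⟨⟨n, m, j⟩, hm, -⟩ := i
    simp only [b, norm_neg]
    rw [Matrix.mulVec_add, Pi.add_apply, vshFamily, hs n m hm r hr, hc n m hm r hr,
      ← norm_conjM_matA_mulVec _ _ _ _ _ (.inl (hc1 n m hm)),
      ← norm_conjM_matA_mulVec _ _ _ _ _ (.inr (hs2 n m hm))]
    exact norm_add_sq_le_two_mul _ _
  have hsum : Summable fun i => ‖b i‖ ^ 2 := .of_nonneg_of_le (fun _ => by positivity) hb
    (((summable_inner_vshFamily hp _).add (summable_inner_vshFamily hp _)).mul_left 2)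
  obtain ⟨g, hg⟩ := exists_inner_vshFamily_eq hp hsum
  exact ⟨g, fun n m hm j hj => hg ⟨(n, m, j), hm, hj⟩⟩

end IsDecomposition

/-! ### The outgoing-to-incoming mapping -/

section OutgoingToIncoming

variable {la mu om r R : ℝ} {D : Set E3} {Y : ℕ → ℤ → E3 → ℂ} {p : ℕ → ℤ → Poly ℂ}

lemma coeFn_outTerm (hY : IsPolySystem Y p) (α : ℕ → ℤ → Fin 3 → ℂ) (hr : 0 < r) (n : ℕ) :
    vshSum p (fun n m => matA la mu om n r *ᵥ α n m) n
      =ᵐ[sigma] fun y => outTerm la mu om Y α n (r • (y : E3)) := by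
  filter_upwards [coeFn_vshSum hY (fun n m => matA la mu om n r *ᵥ α n m) n] with y hy
  rw [hy, outTerm, unitVec_smul hr, norm_smul_sphere hr.le]

lemma coeFn_inTerm (hY : IsPolySystem Y p) (α : ℕ → ℤ → Fin 3 → ℂ) (hr : 0 < r) (n : ℕ) :
    vshSum p (fun n m => -(conjM (matA la mu om n r) *ᵥ α n m)) n
      =ᵐ[sigma] fun y => inTerm la mu om Y α n (r • (y : E3)) := by
  filter_upwards [coeFn_vshSum hY (fun n m => -(conjM (matA la mu om n r) *ᵥ α n m)) n] with y hy
  rw [hy, inTerm, unitVec_smul hr, norm_smul_sphere hr.le]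
  simp only [Matrix.mulVec_neg, Finset.sum_neg_distrib]

lemma coeFn_otiTerm (hY : IsPolySystem Y p) (hR : 0 < R) {φ : E3 → C3} {g : SphereL2}
    (hg : g =ᵐ[sigma] fun y => φ (R • (y : E3))) (n : ℕ) :
    vshSum p (fun n m => -((conjM (matA la mu om n R) * (matA la mu om n R)⁻¹) *ᵥ
        fun j => inner ℂ (vshL2 p n m j) g)) n
      =ᵐ[sigma] fun y => otiTerm la mu om R Y φ n (R • (y : E3)) := by
  have hRc : (R : ℂ) ^ 2 ≠ 0 := pow_ne_zero 2 (by exact_mod_cast hR.ne')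
  filter_upwards [coeFn_vshSum hY (fun n m => -((conjM (matA la mu om n R) *
    (matA la mu om n R)⁻¹) *ᵥ fun j => inner ℂ (vshL2 p n m j) g)) n] with y hy
  rw [hy, otiTerm, unitVec_smul hR, Finset.smul_sum]
  congr 1
  refine Finset.sum_congr rfl fun m hm => ?_
  have hsmul : (fun j => (R : ℂ) ^ 2 * inner ℂ (vshL2 p n m j) g)
      = ((R : ℂ) ^ 2) • fun j => inner ℂ (vshL2 p n m j) g := rfl
  rw [integral_vshM hY hR hg hm, hsmul, Matrix.mulVec_smul, Matrix.mulVec_smul, smul_smul, neg_mul,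
    inv_mul_cancel₀ hRc, neg_smul, one_smul, Matrix.mulVec_neg]

lemma conjM_mul_inv_mulVec (hkp : 0 < kp la mu om) (hks : 0 < ks mu om) {n : ℕ} (hr : 0 < r)
    (α : Fin 3 → ℂ) {j : Fin 3} (hj : n = 0 → j = 2) :
    ((conjM (matA la mu om n r) * (matA la mu om n r)⁻¹) *ᵥ
      fun j => if n = 0 → j = 2 then (matA la mu om n r *ᵥ α) j else 0) j
      = (conjM (matA la mu om n r) *ᵥ α) j := by
  have hdet := (Matrix.isUnit_iff_isUnit_det _).mp (isUnit_matA hkp hks n hr)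
  rcases eq_or_ne n 0 with rfl | hn
  · -- The matrix `A_0` is diagonal, so that truncation to the last entry commutes with it.
    obtain rfl := hj rfl
    have htrunc : (fun j : Fin 3 => if 0 = 0 → j = 2 then (matA la mu om 0 r *ᵥ α) j else 0)
        = matA la mu om 0 r *ᵥ ![0, 0, α 2] := by
      rw [matA_eq hkp hks 0 hr]
      funext i
      fin_cases i <;> simp [Matrix.mulVec, dotProduct, Fin.sum_univ_three, sqrtDelta_zero]
    rw [htrunc, ← Matrix.mulVec_mulVec, Matrix.mulVec_mulVec ![0, 0, α 2],
      Matrix.nonsing_inv_mul _ hdet, Matrix.one_mulVec, matA_eq hkp hks 0 hr]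
    simp [conjM, Matrix.mulVec, dotProduct, Fin.sum_univ_three, sqrtDelta_zero]
  · simp only [hn, false_implies, if_true]
    rw [← Matrix.mulVec_mulVec, Matrix.mulVec_mulVec α, Matrix.nonsing_inv_mul _ hdet,
      Matrix.one_mulVec]

lemma exists_otiGraph (hmu : 0 < mu) (hla : 0 < 2 * mu + la) (hom : 0 < om) (hR : 0 < R)
    (hD : closure D ⊆ Metric.ball 0 R) (hp : IsHarmonicPolySystem p) (hY : IsPolySystem Y p)
    {φ : L2S R} (hφ : φ ∈ rangeG la mu om D R) : ∃ ψ, OtIGraph la mu om D R Y φ ψ := by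
  obtain ⟨h, v, hv⟩ := hφ
  obtain ⟨a, u, f, w, ha, haR, hvu, hdec⟩ :=
    hv.2.1.exists_isDecomposition hmu hla hom hR hD
  obtain ⟨α, hα⟩ := hdec.exists_expansion ha (kp_pos hla hom) (ks_pos hmu hom) hp
  obtain ⟨g, hg⟩ := (hα R haR).2
  obtain ⟨ψ, hψ⟩ := exists_ae_eq_dilate hR g
  refine ⟨ψ, h, v, α, hv, fun r hr => ?_,
    (hasL2Sum_iff hR (coeFn_inTerm hY α hR) hψ.symm).mpr (tendsto_vshSum hp hg)⟩
  have hr0 : 0 < r := hR.trans_le hr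
  have har : a < r := haR.trans_le hr
  refine (hasL2Sum_iff (Ψ := fieldL2 r u) hr0 (coeFn_outTerm hY α hr0) ?_).mpr
    (tendsto_vshSum hp fun n m hm j _ => (hα r har).1 n m hm j)
  filter_upwards [coeFn_fieldL2 r u] with y hy
  have hyr : a < ‖r • (y : E3)‖ := by rwa [norm_smul_sphere hr0.le]
  rw [hy, hvu hyr]
  rfl

lemma OtIGraph.hasL2Sum (hkp : 0 < kp la mu om) (hks : 0 < ks mu om) (hR : 0 < R)
    (hp : IsHarmonicPolySystem p) (hY : IsPolySystem Y p) {φ ψ : L2S R}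
    (h : OtIGraph la mu om D R Y φ ψ) : HasL2Sum R (otiTerm la mu om R Y φ) ψ := by
  obtain ⟨_, u, α, hu, hout, hin⟩ := h
  obtain ⟨gφ, hgφ⟩ := exists_sphereL2_ae_eq_dilate hR φ
  obtain ⟨gψ, hgψ⟩ := exists_sphereL2_ae_eq_dilate hR ψ
  have hgu : gφ =ᵐ[sigma] fun y => u (R • (y : E3)) := by
    filter_upwards [hgφ, (ae_sphereMeasure_iff hR).mp hu.2.2] with y hy hyu
    rw [hy, hyu]
  have hφ := (hasL2Sum_iff hR (coeFn_outTerm hY α hR) hgu).mp (hout R le_rfl)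
  have hψ := (hasL2Sum_iff hR (coeFn_inTerm hY α hR) hgψ).mp hin
  refine (hasL2Sum_iff hR (coeFn_otiTerm hY hR hgφ) hgψ).mpr (hψ.congr fun N => ?_)
  refine Finset.sum_congr rfl fun n _ => vshSum_congr fun m hm j hj => ?_
  have hcoeff : (fun j => inner ℂ (vshL2 p n m j) gφ)
      = fun j => if n = 0 → j = 2 then (matA la mu om n R *ᵥ α n m) j else 0 :=
    funext fun j => inner_vshL2_of_tendsto hp hφ hm j
  rw [hcoeff, Pi.neg_apply, Pi.neg_apply, conjM_mul_inv_mulVec hkp hks hR _ hj]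

lemma eq_of_hasL2Sum_otiTerm (hR : 0 < R) (hY : IsPolySystem Y p) {φ ψ ψ' : L2S R}
    (h : HasL2Sum R (otiTerm la mu om R Y φ) ψ) (h' : HasL2Sum R (otiTerm la mu om R Y φ) ψ') :
    ψ = ψ' := by
  obtain ⟨gφ, hgφ⟩ := exists_sphereL2_ae_eq_dilate hR φ
  obtain ⟨g, hg⟩ := exists_sphereL2_ae_eq_dilate hR ψ
  obtain ⟨g', hg'⟩ := exists_sphereL2_ae_eq_dilate hR ψ'
  obtain rfl : g = g' :=
    tendsto_nhds_unique ((hasL2Sum_iff hR (coeFn_otiTerm hY hR hgφ) hg).mp h)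
      ((hasL2Sum_iff hR (coeFn_otiTerm hY hR hgφ) hg').mp h')
  refine Lp.ext ((ae_sphereMeasure_iff hR).mpr ?_)
  filter_upwards [hg, hg'] with y hψ hψ'
  rw [← hψ, ← hψ']

end OutgoingToIncoming

end ElasticOtI

end

theorem mainTheorem7_general (la mu om R : ℝ) (hmu : 0 < mu) (hla : 0 < 2 * mu + la)
    (hom : 0 < om) (hR : 0 < R) (D : Set ElasticOtI.E3) (hD : closure D ⊆ Metric.ball 0 R)
    (Y : ℕ → ℤ → ElasticOtI.E3 → ℂ) (hY : ElasticOtI.IsSphericalHarmonicSystem Y) :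
    (∀ n : ℕ, IsUnit (ElasticOtI.matA la mu om n R)) ∧
    ∃ T : ElasticOtI.rangeG la mu om D R → ElasticOtI.L2S R,
      (∀ (φ : ElasticOtI.rangeG la mu om D R) (ψ : ElasticOtI.L2S R),
        ElasticOtI.OtIGraph la mu om D R Y φ ψ ↔ T φ = ψ) ∧
      ∀ φ : ElasticOtI.rangeG la mu om D R,
        ElasticOtI.HasL2Sum R
          (ElasticOtI.otiTerm la mu om R Y (φ : ElasticOtI.L2S R)) (T φ) := by
  have hkp := ElasticOtI.kp_pos hla hom
  have hks := ElasticOtI.ks_pos hmu hom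
  obtain ⟨p, hp, hYp⟩ := ElasticOtI.exists_isPolySystem hY
  choose T hT using fun φ : ElasticOtI.rangeG la mu om D R =>
    ElasticOtI.exists_otiGraph hmu hla hom hR hD hp hYp φ.2
  refine ⟨fun n => ElasticOtI.isUnit_matA hkp hks n hR, T, fun φ ψ => ⟨fun h => ?_, ?_⟩,
    fun φ => (hT φ).hasL2Sum hkp hks hR hp hYp⟩
  · exact ElasticOtI.eq_of_hasL2Sum_otiTerm hR hYp ((hT φ).hasL2Sum hkp hks hR hp hYp)
      (h.hasL2Sum hkp hks hR hp hYp)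
  · rintro rfl
    exact hT φ

theorem mainTheorem7 (la mu om R : ℝ) (hmu : 0 < mu) (hla : 0 < 2 * mu + 3 * la) (hom : 0 < om)
    (hR : 0 < R) (D : Set ElasticOtI.E3) (hD : ElasticOtI.IsObstacle D R)
    (Y : ℕ → ℤ → ElasticOtI.E3 → ℂ) (hY : ElasticOtI.IsSphericalHarmonicSystem Y) :
    (∀ n : ℕ, IsUnit (ElasticOtI.matA la mu om n R)) ∧
    ∃ T : ElasticOtI.rangeG la mu om D R → ElasticOtI.L2S R,
      (∀ (φ : ElasticOtI.rangeG la mu om D R) (ψ : ElasticOtI.L2S R),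
        ElasticOtI.OtIGraph la mu om D R Y φ ψ ↔ T φ = ψ) ∧
      ∀ φ : ElasticOtI.rangeG la mu om D R,
        ElasticOtI.HasL2Sum R
          (ElasticOtI.otiTerm la mu om R Y (φ : ElasticOtI.L2S R)) (T φ) :=
  mainTheorem7_general la mu om R hmu (by linarith) hom hR D hD.closure_subset Y hY
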